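/- **Setting (mother-quake model).** Let $E$ be a measurable space with a $\sigma$-finite reference measure $\nu$, let $p\in[0,1]$, $q=1-p$, and let $\gamma(u,s)$, $\varepsilon(u,s)$, $\lambda(u,s,y)$ be nonnegative, finite, jointly measurable functions ($u\in E$, $s\ge 0$, $y\in E\times[0,\infty)$). Put $a(y,s)=\int_E\lambda(u,s,y)\,\nu(du)$ and $\varepsilon(s)=\int_E\varepsilon(u,s)\,\nu(du)$, and assume that $\int_0^T\!\int_E\gamma(u,s)\,\nu(du)\,ds$, $\int_0^T\varepsilon(s)\,ds$ and, for every $y=(v,r)$, $\int_{(r,T]}a(y,s)\,ds$ are finite for all $T$. Quakes $y_i=(u_i,\tau_i)$, $i=1,2,\dots$, with marks $u_i\in E$, occur at times $0=\tau_0<\tau_1<\tau_2<\cdots$ with $\tau_i\to\infty$ ($\tau_i=\infty$ if there are fewer than $i$ quakes). Each is either a single quake or a cluster quake; these labels are not observed. Let $N$ and $C$ be the counting measures on $E\times[0,\infty)$ of the single and of the cluster quakes. No cluster is active at time $0$. A cluster quake that occurs when no cluster is active starts a new cluster and is its mother quake; a cluster quake that occurs when a cluster is active is an offspring, and the cluster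 then dies out with probability $p$, independently of all previous history. Let $D_t\in\{0,1\}$ indicate whether a cluster is active at time $t$, let $\alpha=D_t$, and let $\theta_0(y_i)$ be the indicator that $y_i$ is the mother quake of the currently active cluster (so $\theta_0(y_i)=0$ if none is active). Under the probability $P$: * $N$ is a Poisson random measure with mean measure $\gamma(u,s)\,\nu(du)\,ds$, its increments after any time $t$ are independent of the full history up to $t$, and $N$ is independent of $(C,D)$; * $C$ has, with respect to the full history, the predictable intensity (relative to $\nu(du)\,dt$) $$D_{t-}\sum_{i:\,\tau_i<t}\lambda(u,t,y_i)\,\theta_0(y_i)+(1-D_{t-})\,\varepsilon(u,t),$$ where $\theta_0(y_i)$ is evaluated at $t-$. Let $\mathcal F^O_t$ be generated by the times and marks of the quakes observed up to time $t$, and let $\pi(Z,t)=E^P[Z_t\mid\mathcal F^O_t]$, always taken as a càdlàg version in $t$. **Theorem.** For each $i$ the process $t\mapsto\pi(\theta_0(y_i)\alpha,t)$ has a càdlàg version, and for any such versions the following holds almost surely. (a) For all $k\ge 0$, all $t$ with $\tau_k\le t<\tau_{k+1}$ and all $1\le i\le k$, $$\pi(\theta_0(y_i)\alpha,t)=\pi(\theta_0(y_i)\alpha,\tau_k)\,e^{-\int_{\tau_k}^t(a(y_i,s)-\varepsilon(s))\,ds}\,b_k(t),$$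 $$b_k(t)=\frac1{\sum_{j=1}^k\pi(\theta_0(y_j)\alpha,\tau_k)\,e^{-\int_{\tau_k}^t(a(y_j,s)-\varepsilon(s))\,ds}+1-\sum_{j=1}^k\pi(\theta_0(y_j)\alpha,\tau_k)},$$ the denominator of $b_k(t)$ being positive. (b) For all $k\ge0$ with $\tau_{k+1}<\infty$, put $\gamma_{k+1}=\gamma(u_{k+1},\tau_{k+1})$, $\lambda_{k+1,i}=\lambda(u_{k+1},\tau_{k+1},y_i)$, $\varepsilon_{k+1}=\varepsilon(u_{k+1},\tau_{k+1})$ and $$d_{k+1}=\sum_{j=1}^k(\lambda_{k+1,j}-\varepsilon_{k+1})\,\pi(\theta_0(y_j)\alpha,\tau_{k+1}-)+\varepsilon_{k+1}+\gamma_{k+1}.$$ Then $d_{k+1}>0$ and $$\pi(\theta_0(y_i)\alpha,\tau_{k+1})=\frac{\pi(\theta_0(y_i)\alpha,\tau_{k+1}-)\,(\gamma_{k+1}+q\lambda_{k+1,i})}{d_{k+1}}\qquad(1\le i<k+1),$$ $$\pi(\theta_0(y_{k+1})\alpha,\tau_{k+1})=\frac{\varepsilon_{k+1}-\sum_{j=1}^k\varepsilon_{k+1}\,\pi(\theta_0(y_j)\alpha,\tau_{k+1}-)}{d_{k+1}}.$$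 -/

import Mathlib

open MeasureTheory ProbabilityTheory Set Filter Topology
open scoped NNReal ENNReal

noncomputable section

/-- Lebesgue measure on `[0, ∞)`. -/
def lebesgueNN : Measure ℝ≥0 := (volume : Measure ℝ).comap ((↑) : ℝ≥0 → ℝ)

/-- A labelled marked point process on `[0, ∞)` with marks in `E`. Quakes are numbered `0, 1, 2, …` in
order of occurrence; `time n = ∞` means that there are at most `n` quakes. Quake `n` has the mark
`mark n`, the hidden label `inCluster n` (`true`: cluster quake, `false`: single quake) and carries
a hidden coin `kill n`, which matters only if the quake is an offspring in an active cluster. -/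
structure QuakeProcess (Ω E : Type*) [MeasurableSpace Ω] [MeasurableSpace E] where
  time : ℕ → Ω → ℝ≥0∞
  mark : ℕ → Ω → E
  inCluster : ℕ → Ω → Bool
  kill : ℕ → Ω → Bool
  measurable_time : ∀ n, Measurable (time n)
  measurable_mark : ∀ n, Measurable (mark n)
  measurable_inCluster : ∀ n, Measurable (inCluster n)
  measurable_kill : ∀ n, Measurable (kill n)
  time_pos : ∀ ω, 0 < time 0 ω
  time_mono : ∀ n ω, time n ω ≤ time (n + 1) ω
  time_lt : ∀ n ω, time n ω ≠ ∞ → time n ω < time (n + 1) ω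
  tendsto_time : ∀ ω, Tendsto (fun n => time n ω) atTop (𝓝 ∞)

/-- The filtration generated by a marked point process with times `T n` and marks `X n`: at time `t`
one knows, for all `n`, `r ≤ t` and `A`, whether point `n` occurred by time `r` with mark in `A`. -/
def pointHistory {Ω S : Type*} [mΩ : MeasurableSpace Ω] [MeasurableSpace S]
    (T : ℕ → Ω → ℝ≥0∞) (X : ℕ → Ω → S)
    (hT : ∀ n, Measurable (T n)) (hX : ∀ n, Measurable (X n)) : Filtration ℝ≥0 mΩ where
  seq t := MeasurableSpace.generateFrom
    {s | ∃ (n : ℕ) (r : ℝ≥0) (A : Set S), r ≤ t ∧ MeasurableSet A ∧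
      s = {ω | T n ω ≤ (r : ℝ≥0∞) ∧ X n ω ∈ A}}
  mono' := by
    intro t t' htt'
    refine MeasurableSpace.generateFrom_mono ?_
    rintro s ⟨n, r, A, hr, hA, rfl⟩
    exact ⟨n, r, A, hr.trans htt', hA, rfl⟩
  le' := by
    intro t
    refine MeasurableSpace.generateFrom_le ?_
    rintro s ⟨n, r, A, -, hA, rfl⟩
    exact (measurableSet_le (hT n) measurable_const).inter (hX n hA)

namespace QuakeProcess

variable {Ω E : Type*} [mΩ : MeasurableSpace Ω] [MeasurableSpace E] (M : QuakeProcess Ω E)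

/-- The observation filtration `𝓕ᴼ`: times and marks of the quakes, without labels and coins. -/
def obsHistory : Filtration ℝ≥0 mΩ :=
  pointHistory M.time M.mark M.measurable_time M.measurable_mark

/-- The full history: times, marks, labels and coins of the quakes. -/
def fullHistory : Filtration ℝ≥0 mΩ :=
  pointHistory M.time (fun n ω => (M.mark n ω, M.inCluster n ω, M.kill n ω)) M.measurable_time
    (fun n => (M.measurable_mark n).prodMk ((M.measurable_inCluster n).prodMk (M.measurable_kill n)))

/-- The point `y_n = (u_n, τ_n)` (used only when `τ_n < ∞`). -/
def point (n : ℕ) (ω : Ω) : E × ℝ≥0 := (M.mark n ω, (M.time n ω).toNNReal)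

/-- The random counting measure on `E × [0, ∞)` of the quakes with label `b`. -/
def counting (b : Bool) (ω : Ω) : Measure (E × ℝ≥0) :=
  Measure.sum fun n =>
    if M.time n ω ≠ ∞ ∧ M.inCluster n ω = b then Measure.dirac (M.point n ω) else 0

/-- The process `N` of single quakes. -/
def N (ω : Ω) : Measure (E × ℝ≥0) := M.counting false ω

/-- The process `C` of cluster quakes. -/
def C (ω : Ω) : Measure (E × ℝ≥0) := M.counting true ω

/-- The mother quake of the active cluster after the first `n` quakes (`none`: no active cluster).
No cluster is active at time `0`. A cluster quake that occurs while no cluster is active becomes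
the mother of a new active cluster; one that occurs while a cluster is active is an offspring,
and the cluster dies out exactly when its coin says so. Single quakes change nothing. -/
def motherAfter : ℕ → Ω → Option ℕ
  | 0, _ => none
  | n + 1, ω =>
    match M.inCluster n ω, motherAfter n ω with
    | false, m => m
    | true, none => some n
    | true, some i => if M.kill n ω then none else some i

/-- The number of quakes in `[0, t]`. -/
def count (t : ℝ≥0) (ω : Ω) : ℕ := {n | M.time n ω ≤ t}.ncard

/-- The number of quakes in `[0, t)`. -/
def countBefore (t : ℝ≥0) (ω : Ω) : ℕ := {n | M.time n ω < t}.ncard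

/-- `D = 1` or `0` according as a cluster is active or not, given the active mother. -/
def activeOf (m : Option ℕ) : ℝ≥0 := if m.isSome then 1 else 0

/-- The indicator `θ₀(y_i)` that `y_i` is the mother of the active cluster, given the active mother. -/
def thetaOf (i : ℕ) (m : Option ℕ) : ℝ≥0 := if m = some i then 1 else 0

/-- The process `D_t` (which is also `α` at time `t`). -/
def D (t : ℝ≥0) (ω : Ω) : ℝ≥0 := activeOf (M.motherAfter (M.count t ω) ω)

/-- The left limit `D_{t-}`. -/
def DLeft (t : ℝ≥0) (ω : Ω) : ℝ≥0 := activeOf (M.motherAfter (M.countBefore t ω) ω)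

/-- `θ₀(y_i)` at time `t`. -/
def theta (i : ℕ) (t : ℝ≥0) (ω : Ω) : ℝ≥0 := thetaOf i (M.motherAfter (M.count t ω) ω)

/-- `θ₀(y_i)` just before time `t`. -/
def thetaLeft (i : ℕ) (t : ℝ≥0) (ω : Ω) : ℝ≥0 :=
  thetaOf i (M.motherAfter (M.countBefore t ω) ω)

/-- The cluster intensity
`λ(u, t, D_{t-}, η_{t-}) = D_{t-} ∑ᵢ λ(u, t, yᵢ) θ₀(yᵢ) + (1 - D_{t-}) ε(u, t)`,
the sum being over the quakes observed before `t`. -/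
def clusterIntensity (lam : E → ℝ≥0 → E × ℝ≥0 → ℝ≥0) (eps : E → ℝ≥0 → ℝ≥0)
    (u : E) (t : ℝ≥0) (ω : Ω) : ℝ≥0 :=
  M.DLeft t ω * ∑ i ∈ Finset.range (M.countBefore t ω), lam u t (M.point i ω) * M.thetaLeft i t ω
    + (1 - M.DLeft t ω) * eps u t

end QuakeProcess

/-- `X` is a Poisson random measure with mean measure `μ` under `P`. -/
structure IsPoissonRandomMeasure {Ω S : Type*} [MeasurableSpace Ω] [MeasurableSpace S]
    (P : Measure Ω) (X : Ω → Measure S) (μ : Measure S) : Prop where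
  law : ∀ B, MeasurableSet B → μ B < ∞ →
    P.map (fun ω => X ω B) = (poissonMeasure (μ B).toNNReal).map (fun n : ℕ => (n : ℝ≥0∞))
  indep : ∀ (m : ℕ) (B : Fin m → Set S), (∀ i, MeasurableSet (B i)) →
    Pairwise (fun i j => Disjoint (B i) (B j)) → iIndepFun (fun i ω => X ω (B i)) P

/-- The random counting measure `X` on `E × [0, ∞)` has the stochastic intensity
`lam u s ω ν(du) ds` with respect to the filtration `𝓕`:
`E ∫ H dX = E ∫∫ H(s, u) lam(u, s) ν(du) ds` for all nonnegative predictable `H`. -/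
def HasIntensity {Ω E : Type*} [mΩ : MeasurableSpace Ω] [mE : MeasurableSpace E]
    (P : Measure Ω) (𝓕 : Filtration ℝ≥0 mΩ) (X : Ω → Measure (E × ℝ≥0)) (ν : Measure E)
    (lam : E → ℝ≥0 → Ω → ℝ≥0) : Prop :=
  ∀ H : (ℝ≥0 × Ω) × E → ℝ≥0∞, Measurable[𝓕.predictable.prod mE] H →
    ∫⁻ ω, ∫⁻ x, H ((x.2, ω), x.1) ∂(X ω) ∂P
      = ∫⁻ ω, ∫⁻ s, ∫⁻ u, H ((s, ω), u) * (lam u s ω : ℝ≥0∞) ∂ν ∂lebesgueNN ∂P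

/-- The mother-quake model with single-quake intensity `gam`, cluster initiation intensity `eps`,
offspring intensity `lam`, reference measure `ν` and extinction probability `p`. -/
structure IsMotherQuakeModel {Ω E : Type*} [MeasurableSpace Ω] [MeasurableSpace E]
    (M : QuakeProcess Ω E) (P : Measure Ω) (ν : Measure E) (gam eps : E → ℝ≥0 → ℝ≥0)
    (lam : E → ℝ≥0 → E × ℝ≥0 → ℝ≥0) (p : ℝ) : Prop where
  /-- `N` is a Poisson random measure with mean measure `gam(u, s) ν(du) ds`. -/
  poisson : IsPoissonRandomMeasure P M.N
    ((ν.prod lebesgueNN).withDensity fun x => (gam x.1 x.2 : ℝ≥0∞))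
  /-- `N` is compatible with the history: its increments after `t` are independent of the history
  up to time `t`. -/
  compatible : ∀ t : ℝ≥0, Indep
    (MeasurableSpace.comap (fun ω => (M.N ω).restrict (univ ×ˢ Ioi t)) inferInstance)
    (M.fullHistory t) P
  /-- The single quakes are independent of the clusters. -/
  indep : IndepFun M.N (fun ω => (M.C ω, fun t : ℝ≥0 => M.D t ω)) P
  /-- `C` has the predictable intensity `λ(u, s, D_{s-}, η_{s-})`. -/
  intensity : HasIntensity P M.fullHistory M.C ν (M.clusterIntensity lam eps)
  /-- The coins are Bernoulli with parameter `p`, -/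
  kill_prob : ∀ n, P {ω | M.kill n ω = true} = ENNReal.ofReal p
  /-- and each one is independent of all previous history, including the time, mark and label of
  the quake that carries it. -/
  kill_indep : ∀ n, IndepFun (M.kill n)
    (fun ω => ((fun j : Fin n => (M.time j ω, M.mark j ω, M.inCluster j ω, M.kill j ω)),
      (M.time n ω, M.mark n ω, M.inCluster n ω))) P

/-- `π` is the càdlàg version of the filter `π(Z, t) = E[Z_t | 𝓕ᴼ_t]`. -/
structure IsFilterOf {Ω E : Type*} [MeasurableSpace Ω] [MeasurableSpace E]
    (M : QuakeProcess Ω E) (P : Measure Ω) (Z : ℝ≥0 → Ω → ℝ) (π : ℝ≥0 → Ω → ℝ) : Prop where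
  condExp : ∀ t, π t =ᵐ[P] P[Z t | M.obsHistory t]
  cadlag : ∀ᵐ ω ∂P, ∀ t, ContinuousWithinAt (fun s => π s ω) (Ici t) t ∧
    ∃ l, Tendsto (fun s => π s ω) (𝓝[<] t) (𝓝 l)

namespace QuakeProcess

variable {Ω E : Type*} [MeasurableSpace Ω] [MeasurableSpace E] (M : QuakeProcess Ω E)

/-- The process `θ₀(y_i) α`. -/
def thetaAlpha (i : ℕ) (t : ℝ≥0) (ω : Ω) : ℝ := ((M.theta i t ω * M.D t ω : ℝ≥0) : ℝ)

/-- The time of the `k`-th observation counted from `1`, and `0` for `k = 0`; between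
`lastTime k` and `time k` exactly `k` quakes have been observed. -/
def lastTime : ℕ → Ω → ℝ≥0∞
  | 0, _ => 0
  | k + 1, ω => M.time k ω

/-- `exp (-∫_{τ_k}^t (a(y_i, s) - ε(s)) ds)`, with `a(y, s) = ∫ λ(u, s, y) ν(du)` and
`ε(s) = ∫ ε(u, s) ν(du)`. -/
def decay (ν : Measure E) (eps : E → ℝ≥0 → ℝ≥0) (lam : E → ℝ≥0 → E × ℝ≥0 → ℝ≥0)
    (k i : ℕ) (t : ℝ≥0) (ω : Ω) : ℝ :=
  Real.exp (-∫ s in Ioc (M.lastTime k ω).toNNReal t,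
    ((∫ u, (lam u s (M.point i ω) : ℝ) ∂ν) - ∫ u, (eps u s : ℝ) ∂ν) ∂lebesgueNN)

/-- The denominator of `b_k(t)`. -/
def bDenom (ν : Measure E) (eps : E → ℝ≥0 → ℝ≥0) (lam : E → ℝ≥0 → E × ℝ≥0 → ℝ≥0)
    (π : ℕ → ℝ≥0 → Ω → ℝ) (k : ℕ) (t : ℝ≥0) (ω : Ω) : ℝ :=
  (∑ j ∈ Finset.range k, π j (M.lastTime k ω).toNNReal ω * M.decay ν eps lam k j t ω)
    + 1 - ∑ j ∈ Finset.range k, π j (M.lastTime k ω).toNNReal ω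

/-- The left limit `π(θ₀(y_j) α, τ-)` at the time `τ` of quake `k`. -/
def preJump (π : ℕ → ℝ≥0 → Ω → ℝ) (k j : ℕ) (ω : Ω) : ℝ :=
  Function.leftLim (fun s => π j s ω) (M.time k ω).toNNReal

/-- `γ(u, τ)` at the mark `u` and time `τ` of quake `k`. -/
def gamAt (gam : E → ℝ≥0 → ℝ≥0) (k : ℕ) (ω : Ω) : ℝ :=
  gam (M.mark k ω) (M.time k ω).toNNReal

/-- `ε(u, τ)` at the mark `u` and time `τ` of quake `k`. -/
def epsAt (eps : E → ℝ≥0 → ℝ≥0) (k : ℕ) (ω : Ω) : ℝ :=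
  eps (M.mark k ω) (M.time k ω).toNNReal

/-- `λ(u, τ, y_i)` at the mark `u` and time `τ` of quake `k`. -/
def lamAt (lam : E → ℝ≥0 → E × ℝ≥0 → ℝ≥0) (k i : ℕ) (ω : Ω) : ℝ :=
  lam (M.mark k ω) (M.time k ω).toNNReal (M.point i ω)

/-- The normalizer `∑ⱼ (λⱼ - ε) π(θ₀(y_j) α, τ-) + ε + γ` at quake `k`, with the sum over the
earlier quakes. -/
def jumpDenom (gam eps : E → ℝ≥0 → ℝ≥0) (lam : E → ℝ≥0 → E × ℝ≥0 → ℝ≥0)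
    (π : ℕ → ℝ≥0 → Ω → ℝ) (k : ℕ) (ω : Ω) : ℝ :=
  (∑ j ∈ Finset.range k, (M.lamAt lam k j ω - M.epsAt eps k ω) * M.preJump π k j ω)
    + M.epsAt eps k ω + M.gamAt gam k ω

end QuakeProcess

end

/-! The only hidden variable that matters is the active mother `m`: after `n` quakes it is `none` or
one of those quakes. Until the next quake both intensities are functions of `m` and of the first `n`
observed points (`clusterIntensity_eq`). Hence, given the full past, the next quake has density
`surv_m(s) * rate_m(u, s)` with respect to `ν(du) ds`, where `surv_m` is the exponential of minus
the integrated total rate (`setLIntegral_labelSet_mother`). A single quake leaves `m` alone; a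
cluster quake moves it by means of an independent coin. Filtering is therefore Bayes' rule, applied
quake by quake.

This yields an explicit recursion, `weight`: the new weight of `m'` is the averaged rate of jumps
into `m'` divided by the averaged total rate (`isPosterior_weight`). At a time `t` with exactly `k`
quakes so far, the absence of a further quake multiplies each weight by its survival probability,
and one normalizes (`posterior`, `explicitFilter_ae_eq_condExp`). The result is continuous between
quakes, hence càdlàg almost surely. Two càdlàg versions are indistinguishable
(`IsFilterOf.ae_forall_eq`), so the formulas need only be checked for this version.

For (a), the ratio of the survival probabilities of the states `some i` and `none` is the
exponential in the statement, because the contribution of `γ` is common to both (`surv_some`). For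
(b), an earlier mother stays active through a single quake or a surviving offspring, and the new
quake becomes a mother only from the inactive state. The denominator is positive because an observed
quake almost surely avoids the points where its conditional density vanishes
(`ae_mix_markRate_ne_zero`).

The analytic core is the survival formula `measure_no_quake`. No integral equation is solved: the
intensity identities are tested with the predictable process `exp (-Λ(s, t])` on the gap before the
next quake, `Λ` being the cumulative rate. The fundamental theorem of calculus for an atomless
measure evaluates the compensator and leaves exactly the survival probability. The intensity of the
single quakes with respect to the full history, needed there, follows from the mean measure and the
independence of increments (`hasIntensity_single`). -/

section MeasureLemmas

/-! ### Atomless measures on the half-line and the exponential formula -/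

theorem measurableEmbedding_nnreal_coe : MeasurableEmbedding ((↑) : ℝ≥0 → ℝ) :=
  MeasurableEmbedding.subtype_coe (measurableSet_Ici (a := (0 : ℝ)))

instance : NullSingletonClass lebesgueNN := by
  constructor
  intro x
  rw [lebesgueNN, measurableEmbedding_nnreal_coe.comap_apply]
  simp

theorem lebesgueNN_Iic_lt_top (T : ℝ≥0) : lebesgueNN (Iic T) < ∞ := by
  rw [lebesgueNN, measurableEmbedding_nnreal_coe.comap_apply]
  refine (measure_mono (t := Icc (0 : ℝ) T) ?_).trans_lt (by simp)
  rintro _ ⟨x, hx, rfl⟩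
  exact ⟨x.2, NNReal.coe_le_coe.2 hx⟩

instance : SigmaFinite lebesgueNN :=
  ⟨⟨{ set := fun n => Iic (n : ℝ≥0)
      set_mem := fun _ => trivial
      finite := fun n => lebesgueNN_Iic_lt_top n
      spanning := by
        refine eq_univ_of_forall fun x => mem_iUnion.2 ?_
        exact exists_nat_ge x }⟩⟩

/-- The measures with densities `φ` and `ψ` have the same restriction to `𝓖`, so they integrate
every `𝓖`-measurable function alike. No finiteness is needed, since the two traces agree on every
set. -/
theorem lintegral_mul_eq_of_forall_setLIntegral_eq {Ω : Type*} {𝓖 m0 : MeasurableSpace Ω}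
    {P : Measure Ω} (hm : 𝓖 ≤ m0) {φ ψ : Ω → ℝ≥0∞} (hφ : Measurable φ) (hψ : Measurable ψ)
    (h : ∀ A, MeasurableSet[𝓖] A → ∫⁻ ω in A, φ ω ∂P = ∫⁻ ω in A, ψ ω ∂P)
    {g : Ω → ℝ≥0∞} (hg : Measurable[𝓖] g) :
    ∫⁻ ω, g ω * φ ω ∂P = ∫⁻ ω, g ω * ψ ω ∂P := by
  have key : (P.withDensity φ).trim hm = (P.withDensity ψ).trim hm := by
    refine @Measure.ext _ 𝓖 _ _ fun A hA => ?_
    rw [trim_measurableSet_eq hm hA, trim_measurableSet_eq hm hA,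
      withDensity_apply _ (hm _ hA), withDensity_apply _ (hm _ hA), h A hA]
  have e (χ : Ω → ℝ≥0∞) (hχ : Measurable χ) :
      ∫⁻ ω, g ω * χ ω ∂P = ∫⁻ ω, g ω ∂((P.withDensity χ).trim hm) := by
    rw [lintegral_trim hm hg, lintegral_withDensity_eq_lintegral_mul _ hχ (hg.mono hm le_rfl)]
    simp [mul_comm]
  rw [e φ hφ, e ψ hψ, key]

/-- The measure is pushed forward to `ℝ`, where its distribution function is the primitive of the
constant 1 and is continuous for want of atoms. -/
theorem continuousOn_measureReal_Ioc {μ : Measure ℝ≥0} [NullSingletonClass μ] {a t : ℝ≥0}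
    (hfin : μ (Ioc a t) ≠ ∞) : ContinuousOn (fun s => μ.real (Ioc a s)) (Icc a t) := by
  have hmap : ∀ s : ℝ≥0, (μ.map ((↑) : ℝ≥0 → ℝ)) (Ioc (a : ℝ) s) = μ (Ioc a s) := fun s => by
    rw [Measure.map_apply NNReal.continuous_coe.measurable measurableSet_Ioc]
    congr 1
  have : NullSingletonClass (μ.map ((↑) : ℝ≥0 → ℝ)) := by
    constructor
    intro x
    rw [Measure.map_apply NNReal.continuous_coe.measurable (measurableSet_singleton x)]
    exact Set.Subsingleton.measure_zero (fun u hu v hv => NNReal.coe_injective (by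
      simp only [mem_preimage, mem_singleton_iff] at hu hv; rw [hu, hv])) μ
  rcases lt_or_ge t a with hta | hat
  · rw [Icc_eq_empty (not_le.2 hta)]; exact continuousOn_empty _
  have h1 : ContinuousOn (fun x => ∫ s in Ioc (a : ℝ) x, (1 : ℝ) ∂(μ.map ((↑) : ℝ≥0 → ℝ)))
      (Icc (a : ℝ) t) := by
    apply intervalIntegral.continuousOn_primitive
    rw [integrableOn_const_iff]
    right
    rw [← measure_congr Ioc_ae_eq_Icc, hmap]
    exact hfin.lt_top
  have h2 := h1.comp NNReal.continuous_coe.continuousOn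
    (show MapsTo ((↑) : ℝ≥0 → ℝ) (Icc a t) (Icc (a : ℝ) t) from
      fun x hx => ⟨NNReal.coe_le_coe.2 hx.1, NNReal.coe_le_coe.2 hx.2⟩)
  refine h2.congr fun s _ => ?_
  simp [Measure.real, hmap]

/-- A quadratic modulus of continuity forces the derivative to vanish everywhere. -/
theorem eq_of_abs_sub_le_sq {ψ : ℝ → ℝ} (h : ∀ x y, |ψ y - ψ x| ≤ (y - x) ^ 2) (x y : ℝ) :
    ψ x = ψ y := by
  have hd : ∀ x, HasDerivAt ψ 0 x := fun x => by
    rw [hasDerivAt_iff_isLittleO]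
    have : (fun y => ψ y - ψ x - (y - x) • (0 : ℝ)) =O[𝓝 x] fun y => (y - x) ^ 2 := by
      refine Asymptotics.IsBigO.of_bound 1 (Eventually.of_forall fun y => ?_)
      simpa using h x y
    refine this.trans_isLittleO ?_
    have := Asymptotics.isLittleO_pow_id (𝕜 := ℝ) (n := 2) (by norm_num)
    exact this.comp_tendsto (by
      have : Tendsto (fun y => y - x) (𝓝 x) (𝓝 (x - x)) := (continuous_id.sub continuous_const).tendsto x
      simpa using this)
  exact is_const_of_deriv_eq_zero (fun x => (hd x).differentiableAt) (fun x => (hd x).deriv) x y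

/-- The fundamental theorem of calculus in the clock `F s = μ (a, s]`, in which the integrand is its
own derivative. On an interval of mass `δ` both the integral and the increment of `e` lie within
`O(δ²)` of each other; reparametrized by `F`, their difference has a quadratic modulus and is
constant. -/
theorem integral_exp_neg_measureReal_Ioc {μ : Measure ℝ≥0} [NullSingletonClass μ] {a b t : ℝ≥0}
    (hab : a ≤ b) (hbt : b ≤ t) (hfin : μ (Ioc a t) ≠ ∞) :
    ∫ s in Ioc a b, Real.exp (-μ.real (Ioc s t)) ∂μ
      = Real.exp (-μ.real (Ioc b t)) - Real.exp (-μ.real (Ioc a t)) := by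
  set e : ℝ≥0 → ℝ := fun s => Real.exp (-μ.real (Ioc s t)) with he
  set F : ℝ≥0 → ℝ := fun s => μ.real (Ioc a s) with hF
  have fin : ∀ x y, a ≤ x → y ≤ t → μ (Ioc x y) ≠ ∞ := fun x y hx hy =>
    measure_ne_top_of_subset (Ioc_subset_Ioc hx hy) hfin
  have hadd : ∀ x y z, a ≤ x → x ≤ y → y ≤ z → z ≤ t →
      μ.real (Ioc x z) = μ.real (Ioc x y) + μ.real (Ioc y z) := fun x y z hx hxy hyz hz => by
    rw [← Ioc_union_Ioc_eq_Ioc hxy hyz, measureReal_union (Ioc_disjoint_Ioc_of_le le_rfl)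
      measurableSet_Ioc (fin _ _ hx (hyz.trans hz)) (fin _ _ (hx.trans hxy) hz)]
  have hmono : MonotoneOn e (Icc a t) := fun x hx y hy hxy => by
    have := hadd x y t hx.1 hxy hy.2 le_rfl
    have : 0 ≤ μ.real (Ioc x y) := measureReal_nonneg
    exact Real.exp_le_exp.2 (by linarith)
  have hle1 : ∀ s, e s ≤ 1 := fun s => by simp [he]
  have hint : ∀ x y, a ≤ x → y ≤ t → IntegrableOn e (Ioc x y) μ := fun x y hx hy => by
    have : IsFiniteMeasure (μ.restrict (Ioc x y)) := ⟨by simpa using (fin x y hx hy).lt_top⟩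
    refine Integrable.of_bound (aemeasurable_restrict_of_monotoneOn measurableSet_Ioc
      (hmono.mono fun s hs => ⟨hx.trans hs.1.le, hs.2.trans hy⟩)).aestronglyMeasurable 1 (Eventually.of_forall fun s => ?_)
    rw [Real.norm_of_nonneg (Real.exp_nonneg _)]; exact hle1 s
  -- The defect of the claimed identity; the goal is `Φ b = 0`, starting from `Φ a = 0`.
  set Φ : ℝ≥0 → ℝ := fun y => ∫ s in Ioc a y, e s ∂μ - (e y - e a) with hΦ
  have hstep : ∀ x y, a ≤ x → x ≤ y → y ≤ t → |Φ y - Φ x| ≤ (F y - F x) ^ 2 := by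
    intro x y hx hxy hy
    set δ := μ.real (Ioc x y) with hδ
    have hδ0 : 0 ≤ δ := measureReal_nonneg
    have hFd : F y - F x = δ := by simp only [hF, hadd a x y le_rfl hx hxy hy]; ring
    have hexy : e x = e y * Real.exp (-δ) := by
      simp only [he]; rw [← Real.exp_add, hadd x y t hx hxy hy le_rfl]; congr 1; ring
    have hI : Φ y - Φ x = ∫ s in Ioc x y, e s ∂μ - (e y - e x) := by
      simp only [hΦ]
      rw [← Ioc_union_Ioc_eq_Ioc hx hxy, setIntegral_union (Ioc_disjoint_Ioc_of_le le_rfl)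
        measurableSet_Ioc (hint _ _ le_rfl (hxy.trans hy)) (hint _ _ hx hy)]
      ring
    have hlow : e x * δ ≤ ∫ s in Ioc x y, e s ∂μ := by
      have := setIntegral_mono_on (μ := μ) (s := Ioc x y) (f := fun _ => e x) (g := e)
        (integrableOn_const (fin _ _ hx hy)) (hint _ _ hx hy) measurableSet_Ioc
        (fun s hs => hmono ⟨hx, hxy.trans hy⟩ ⟨hx.trans hs.1.le, hs.2.trans hy⟩ hs.1.le)
      rw [setIntegral_const, smul_eq_mul] at this
      linarith [mul_comm (e x) δ]
    have hup : ∫ s in Ioc x y, e s ∂μ ≤ e y * δ := by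
      have := setIntegral_mono_on (μ := μ) (s := Ioc x y) (g := fun _ => e y) (f := e)
        (hint _ _ hx hy) (integrableOn_const (fin _ _ hx hy)) measurableSet_Ioc
        (fun s hs => hmono ⟨hx.trans hs.1.le, hs.2.trans hy⟩ ⟨hx.trans hxy, hy⟩ hs.2)
      rw [setIntegral_const, smul_eq_mul] at this
      linarith [mul_comm (e y) δ]
    have hy0 : 0 < e y := Real.exp_pos _
    have hx0 : 0 < e x := Real.exp_pos _
    have h1 : e y - e x ≤ e y * δ := by
      rw [hexy]; nlinarith [Real.add_one_le_exp (-δ)]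
    have h2 : e x * δ ≤ e y - e x := by
      have : e y = e x * Real.exp δ := by
        rw [hexy, mul_assoc, ← Real.exp_add]; simp
      rw [this]; nlinarith [Real.add_one_le_exp δ]
    rw [hI, hFd, abs_le]
    -- Both quantities lie between `e x * δ` and `e y * δ`, so they differ by at most `(e y - e x) *
    -- δ ≤ e y * δ² ≤ δ²`.
    have h3 := hle1 y
    constructor <;> nlinarith
  have hcont := continuousOn_measureReal_Ioc hfin
  have hFmono : ∀ x y, x ≤ y → y ≤ t → F x ≤ F y := fun x y hxy hy =>
    measureReal_mono (Ioc_subset_Ioc_right hxy) (fin _ _ le_rfl hy)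
  have hF0 : F a = 0 := by simp [hF]
  have hsurj : ∀ v ∈ Icc 0 (F b), ∃ s ∈ Icc a b, F s = v := fun v hv => by
    have := intermediate_value_Icc hab (hcont.mono (Icc_subset_Icc_right hbt))
    exact this (by simpa [hF0] using hv)
  have hFb : (0 : ℝ) ≤ F b := measureReal_nonneg
  -- `F` may be flat, so `σ` is only some right inverse; this is harmless, because `hstep` makes `Φ`
  -- constant wherever `F` is.
  choose! σ hσ hFσ using hsurj
  have hsq : ∀ u ∈ Icc 0 (F b), ∀ v ∈ Icc 0 (F b), |Φ (σ v) - Φ (σ u)| ≤ (v - u) ^ 2 := by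
    intro u hu v hv
    rcases le_total (σ u) (σ v) with h | h
    · have := hstep _ _ (hσ u hu).1 h ((hσ v hv).2.trans hbt)
      rwa [hFσ u hu, hFσ v hv] at this
    · have := hstep _ _ (hσ v hv).1 h ((hσ u hu).2.trans hbt)
      rw [hFσ u hu, hFσ v hv] at this
      rw [abs_sub_comm]; nlinarith
  -- The projection onto `[0, F b]` is 1-Lipschitz, so it extends the quadratic bound to all of `ℝ`.
  have hconst := eq_of_abs_sub_le_sq (ψ := fun v => Φ (σ (projIcc 0 (F b) hFb v))) (fun x y => by
    refine (hsq _ (projIcc 0 (F b) hFb x).2 _ (projIcc 0 (F b) hFb y).2).trans ?_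
    exact sq_le_sq.2 (abs_projIcc_sub_projIcc hFb))
  have h0 := hconst 0 (F b)
  simp only [projIcc_left, projIcc_right] at h0
  have hl : (0 : ℝ) ∈ Icc 0 (F b) := ⟨le_rfl, hFb⟩
  have hr : F b ∈ Icc 0 (F b) := ⟨hFb, le_rfl⟩
  have e1 : Φ (σ 0) = Φ a := by
    have := hstep a (σ 0) le_rfl (hσ 0 hl).1 ((hσ 0 hl).2.trans hbt)
    rw [hFσ 0 hl, hF0] at this
    have := abs_nonpos_iff.1 (this.trans (by simp))
    linarith
  have e2 : Φ b = Φ (σ (F b)) := by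
    have := hstep (σ (F b)) b (hσ _ hr).1 (hσ _ hr).2 hbt
    rw [hFσ _ hr] at this
    have := abs_nonpos_iff.1 (this.trans (by simp))
    linarith
  have e3 : Φ a = 0 := by simp [hΦ]
  have : Φ b = 0 := by rw [e2, ← h0, e1, e3]
  simp only [hΦ] at this
  linarith

/-- The form used for survival probabilities: the subtracted term is moved across, so that all terms
are nonnegative extended reals. -/
theorem lintegral_exp_neg_measureReal_Ioc {μ : Measure ℝ≥0} [NullSingletonClass μ] {a b t : ℝ≥0}
    (hab : a ≤ b) (hbt : b ≤ t) (hfin : μ (Ioc a t) ≠ ∞) :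
    ∫⁻ s in Ioc a b, ENNReal.ofReal (Real.exp (-μ.real (Ioc s t))) ∂μ
      + ENNReal.ofReal (Real.exp (-μ.real (Ioc a t)))
      = ENNReal.ofReal (Real.exp (-μ.real (Ioc b t))) := by
  have hI := integral_exp_neg_measureReal_Ioc hab hbt hfin
  have hint : IntegrableOn (fun s => Real.exp (-μ.real (Ioc s t))) (Ioc a b) μ := by
    have hf : IsFiniteMeasure (μ.restrict (Ioc a b)) :=
      ⟨by simpa using (measure_ne_top_of_subset (Ioc_subset_Ioc_right hbt) hfin).lt_top⟩
    refine Integrable.of_bound (aemeasurable_restrict_of_monotoneOn measurableSet_Ioc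
      (fun x hx y hy hxy => ?_)).aestronglyMeasurable 1 (Eventually.of_forall fun s => ?_)
    · refine Real.exp_le_exp.2 (neg_le_neg (measureReal_mono (Ioc_subset_Ioc_left hxy) ?_))
      exact measure_ne_top_of_subset (Ioc_subset_Ioc_left hx.1.le) hfin
    · rw [Real.norm_of_nonneg (Real.exp_nonneg _)]; simp
  rw [← ofReal_integral_eq_lintegral_ofReal hint (Eventually.of_forall fun _ => Real.exp_nonneg _),
    ← ENNReal.ofReal_add (integral_nonneg fun _ => Real.exp_nonneg _) (Real.exp_nonneg _), hI]
  congr 1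
  ring

theorem lintegral_natCast_poissonMeasure (r : ℝ≥0) :
    ∫⁻ n, (n : ℝ≥0∞) ∂(poissonMeasure r) = r := by
  have h : HasSum (fun n : ℕ => Real.exp (-r) * r ^ n / n.factorial * n) (r : ℝ) := by
    -- The term at 0 vanishes and the shifted series is `r` times the Poisson probabilities.
    rw [← hasSum_nat_add_iff' 1]
    have := (hasSum_one_poissonMeasure r).mul_left (r : ℝ)
    simp only [mul_one] at this
    simp only [Finset.range_one, Finset.sum_singleton, Nat.cast_zero, mul_zero, sub_zero]
    refine this.congr_fun fun n => ?_
    rw [Nat.factorial_succ]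
    have : (n.factorial : ℝ) ≠ 0 := by positivity
    have : ((n : ℝ) + 1) ≠ 0 := by positivity
    push_cast
    field_simp
    ring
  rw [poissonMeasure, lintegral_sum_measure]
  simp only [lintegral_smul_measure, lintegral_dirac, smul_eq_mul]
  have e : ∀ n : ℕ, ENNReal.ofReal (Real.exp (-r) * r ^ n / n.factorial) * n
      = ENNReal.ofReal (Real.exp (-r) * r ^ n / n.factorial * n) := fun n => by
    rw [ENNReal.ofReal_mul (by positivity), ENNReal.ofReal_natCast]
  simp_rw [e]
  rw [← ENNReal.ofReal_tsum_of_nonneg (fun n => by positivity) h.summable, h.tsum_eq]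
  simp

end MeasureLemmas

/-! ### Histories of marked point processes and predictability -/

section PointHistory

/-- Serves maps that are measurable only on `W`, such as the projection to the first `n` points,
which is predictable only after those points have occurred. -/
theorem measurable_indicator_comp_of_subtype {Y Z : Type*} [MeasurableSpace Y] [MeasurableSpace Z]
    {f : Y → Z} {W : Set Y} (hW : MeasurableSet W) (hf : Measurable fun w : W => f w)
    {g : Z → ℝ≥0∞} (hg : Measurable g) : Measurable (W.indicator fun y => g (f y)) := by
  refine measurable_of_restrict_of_restrict_compl hW ?_ ?_
  · convert hg.comp hf using 1
    ext w; simp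
  · convert measurable_const (a := (0 : ℝ≥0∞)) using 1
    ext w; exact indicator_of_notMem w.2 _

variable {Ω S : Type*} [MeasurableSpace S]

/-- The σ-algebra generated by the first `n` points of a marked point process. -/
@[reducible]
def pointPast (T : ℕ → Ω → ℝ≥0∞) (X : ℕ → Ω → S) : ℕ → MeasurableSpace Ω
  | 0 => ⊥
  | n + 1 => pointPast T X n ⊔ MeasurableSpace.comap (fun ω => (X n ω, T n ω)) inferInstance

theorem measurable_into_pointPast {Y : Type*} [MeasurableSpace Y] {T : ℕ → Ω → ℝ≥0∞}
    {X : ℕ → Ω → S} {n : ℕ} {f : Y → Ω} (hT : ∀ i < n, Measurable fun y => T i (f y))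
    (hX : ∀ i < n, Measurable fun y => X i (f y)) : Measurable[_, pointPast T X n] f := by
  induction n with
  | zero =>
    intro U hU
    rcases MeasurableSpace.measurableSet_bot_iff.1 hU with rfl | rfl <;> simp
  | succ n ih =>
    rw [measurable_iff_comap_le, pointPast, MeasurableSpace.comap_sup, sup_le_iff]
    refine ⟨measurable_iff_comap_le.1 (ih (fun i hi => hT i (by omega)) fun i hi => hX i (by omega)),
      ?_⟩
    rw [MeasurableSpace.comap_comp, ← measurable_iff_comap_le]
    exact (hX n (by omega)).prodMk (hT n (by omega))

theorem pointPast_le_iff {T : ℕ → Ω → ℝ≥0∞} {X : ℕ → Ω → S} {n : ℕ} {m : MeasurableSpace Ω} :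
    pointPast T X n ≤ m ↔ ∀ i < n, Measurable[m] (fun ω => (X i ω, T i ω)) := by
  induction n with
  | zero => simp [pointPast]
  | succ n ih =>
    rw [pointPast, sup_le_iff, ih, ← measurable_iff_comap_le]
    constructor
    · rintro ⟨h1, h2⟩ i hi
      rcases Nat.lt_succ_iff_lt_or_eq.1 hi with h | rfl
      exacts [h1 i h, h2]
    · exact fun h => ⟨fun i hi => h i (by omega), h n (by omega)⟩

theorem measurable_pointPast_mark {T : ℕ → Ω → ℝ≥0∞} {X : ℕ → Ω → S} {n i : ℕ} (hi : i < n) :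
    Measurable[pointPast T X n] (X i) :=
  @Measurable.fst _ _ _ (pointPast T X n) _ _ _ (pointPast_le_iff.1 le_rfl i hi)

theorem measurable_pointPast_time {T : ℕ → Ω → ℝ≥0∞} {X : ℕ → Ω → S} {n i : ℕ} (hi : i < n) :
    Measurable[pointPast T X n] (T i) :=
  @Measurable.snd _ _ _ (pointPast T X n) _ _ _ (pointPast_le_iff.1 le_rfl i hi)

theorem pointPast_mono (T : ℕ → Ω → ℝ≥0∞) (X : ℕ → Ω → S) (n : ℕ) :
    pointPast T X n ≤ pointPast T X (n + 1) := le_sup_left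

variable [mΩ : MeasurableSpace Ω] {T : ℕ → Ω → ℝ≥0∞} {X : ℕ → Ω → S}
  (hT : ∀ n, Measurable (T n)) (hX : ∀ n, Measurable (X n))

theorem pointPast_le (hT : ∀ n, Measurable (T n)) (hX : ∀ n, Measurable (X n)) (n : ℕ) : pointPast T X n ≤ mΩ :=
  pointPast_le_iff.2 fun i _ => (hX i).prodMk (hT i)

theorem measurableSet_pointHistory_mark {t r : ℝ≥0} (hr : r ≤ t) (n : ℕ) {U : Set S}
    (hU : MeasurableSet U) :
    MeasurableSet[pointHistory T X hT hX t] {ω | T n ω ≤ r ∧ X n ω ∈ U} :=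
  MeasurableSpace.measurableSet_generateFrom ⟨n, r, U, hr, hU, rfl⟩

theorem measurableSet_pointHistory_time_min (t : ℝ≥0) (r : ℝ≥0∞) (n : ℕ) :
    MeasurableSet[pointHistory T X hT hX t] {ω | T n ω ≤ min r t} := by
  have h : min r (t : ℝ≥0∞) ≠ ∞ := ne_top_of_le_ne_top ENNReal.coe_ne_top (min_le_right _ _)
  have h2 : (min r (t : ℝ≥0∞)).toNNReal ≤ t := by
    rw [← ENNReal.coe_le_coe, ENNReal.coe_toNNReal h]; exact min_le_right _ _
  have := measurableSet_pointHistory_mark hT hX h2 n (U := univ) MeasurableSet.univ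
  rw [ENNReal.coe_toNNReal h] at this
  simpa using this

/-- Once `L ≤ t`, all of the first `n` points have occurred by time `t`. The restriction is
essential: `pointPast` records the mark of a point at time `∞`, which the history never reveals. -/
theorem measurable_subtype_pointPast_pointHistory {L : Ω → ℝ≥0∞} {n : ℕ}
    (hTL : ∀ i < n, ∀ ω, T i ω ≤ L ω) (t : ℝ≥0) :
    Measurable[(pointHistory T X hT hX t).comap Subtype.val, pointPast T X n]
      (fun w : {ω | L ω ≤ t} => (w : Ω)) := by
  let m : MeasurableSpace {ω | L ω ≤ t} := (pointHistory T X hT hX t).comap Subtype.val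
  refine measurable_into_pointPast (fun i hi => ?_) (fun i hi => ?_)
  · refine measurable_of_Iic fun r => ⟨_, measurableSet_pointHistory_time_min hT hX t r i, ?_⟩
    ext ⟨ω, hω⟩
    have : T i ω ≤ t := (hTL i hi ω).trans hω
    simp [this]
  · intro U hU
    refine ⟨_, measurableSet_pointHistory_mark hT hX le_rfl i hU, ?_⟩
    ext ⟨ω, hω⟩
    have : T i ω ≤ t := (hTL i hi ω).trans hω
    simp [this]

/-- A rational inserted between `g` and the current time writes the set as a countable union of
predictable rectangles. -/
theorem measurableSet_predictable_of_forall (𝓕 : Filtration ℝ≥0 mΩ) {g : Ω → ℝ≥0∞} {V : Set Ω}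
    (h : ∀ q : ℝ≥0, MeasurableSet[𝓕 q] {ω | g ω ≤ q ∧ ω ∈ V}) :
    MeasurableSet[𝓕.predictable] {x : ℝ≥0 × Ω | g x.2 < x.1 ∧ x.2 ∈ V} := by
  have : {x : ℝ≥0 × Ω | g x.2 < x.1 ∧ x.2 ∈ V}
      = ⋃ q : ℚ, Ioi (Real.toNNReal q) ×ˢ {ω | g ω ≤ Real.toNNReal q ∧ ω ∈ V} := by
    ext ⟨s, ω⟩
    simp only [mem_ofPred_eq, mem_iUnion, mem_prod, mem_Ioi]
    constructor
    · rintro ⟨h1, h2⟩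
      obtain ⟨q, -, h3, h4⟩ := ENNReal.lt_iff_exists_rat_btwn.1 h1
      exact ⟨q, ENNReal.coe_lt_coe.1 h4, h3.le, h2⟩
    · rintro ⟨q, h1, h2, h3⟩
      exact ⟨h2.trans_lt (ENNReal.coe_lt_coe.2 h1), h3⟩
  rw [this]
  exact @MeasurableSet.iUnion _ _ 𝓕.predictable _ _ fun q =>
    measurableSet_predictable_Ioi_prod (h _)

theorem measurable_fst_predictable (𝓕 : Filtration ℝ≥0 mΩ) :
    Measurable[𝓕.predictable] (Prod.fst : ℝ≥0 × Ω → ℝ≥0) := by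
  let := 𝓕.predictable
  refine measurable_of_Ioi fun r => ?_
  have := measurableSet_predictable_Ioi_prod (𝓕 := 𝓕) (i := r) (s := univ) (@MeasurableSet.univ _ (𝓕 r))
  convert this using 1
  ext; simp

/-- The predictable analogue: strictly after `L`, the first `n` points are known in the strict past.
-/
theorem measurable_subtype_pointPast_predictable {L : Ω → ℝ≥0∞} {n : ℕ}
    (hTL : ∀ i < n, ∀ ω, T i ω ≤ L ω) :
    Measurable[(pointHistory T X hT hX).predictable.comap Subtype.val, pointPast T X n]
      (fun w : {x : ℝ≥0 × Ω | L x.2 < x.1} => (w : ℝ≥0 × Ω).2) := by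
  let m : MeasurableSpace {x : ℝ≥0 × Ω | L x.2 < x.1} :=
    (pointHistory T X hT hX).predictable.comap Subtype.val
  refine measurable_into_pointPast (fun i hi => ?_) (fun i hi => ?_)
  · refine measurable_of_Iic fun r => ⟨_, measurableSet_predictable_of_forall _ (g := T i)
      (V := {ω | T i ω ≤ r}) fun q => ?_, ?_⟩
    · convert measurableSet_pointHistory_time_min hT hX q r i using 1
      ext ω; simp [and_comm]
    · ext ⟨⟨s, ω⟩, hω⟩
      have : T i ω < s := (hTL i hi ω).trans_lt hω
      simp [this]
  · intro U hU
    refine ⟨_, measurableSet_predictable_of_forall _ (g := T i) (V := X i ⁻¹' U)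
      fun q => measurableSet_pointHistory_mark hT hX le_rfl i hU, ?_⟩
    ext ⟨⟨s, ω⟩, hω⟩
    have : T i ω < s := (hTL i hi ω).trans_lt hω
    simp [this]

/-- This produces the predictable test functions of the whole proof. On `L < s ≤ T n` a function of
the first `n` points, the current time and a mark is predictable. The interval is closed on the
right, so it contains the next point and yet is the complement of a predictable set of the type `T n
< s`. -/
theorem measurable_predictable_between {E : Type*} [mE : MeasurableSpace E] {L : Ω → ℝ≥0∞} {n : ℕ}
    (hTL : ∀ i < n, ∀ ω, T i ω ≤ L ω)
    (hL : ∀ q : ℝ≥0, MeasurableSet[pointHistory T X hT hX q] {ω | L ω ≤ q})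
    {G : Ω × (E × ℝ≥0) → ℝ≥0∞} (hG : Measurable[(pointPast T X n).prod inferInstance] G) :
    Measurable[(pointHistory T X hT hX).predictable.prod mE]
      ({x : (ℝ≥0 × Ω) × E | L x.1.2 < x.1.1 ∧ (x.1.1 : ℝ≥0∞) ≤ T n x.1.2}.indicator
        fun x => G (x.1.2, (x.2, x.1.1))) := by
  let mY : MeasurableSpace (ℝ≥0 × Ω) := (pointHistory T X hT hX).predictable
  have hW : MeasurableSet {x : ℝ≥0 × Ω | L x.2 < x.1} := by
    simpa using measurableSet_predictable_of_forall (pointHistory T X hT hX) (g := L) (V := univ)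
      (by simpa using hL)
  have hW' : MeasurableSet {x : ℝ≥0 × Ω | (x.1 : ℝ≥0∞) ≤ T n x.2} := by
    have h := measurableSet_predictable_of_forall (pointHistory T X hT hX) (g := T n) (V := univ)
      (fun q => measurableSet_pointHistory_mark hT hX le_rfl n MeasurableSet.univ)
    convert h.compl using 1
    ext; simp
  set W2 : Set ((ℝ≥0 × Ω) × E) :=
    {x : (ℝ≥0 × Ω) × E | L x.1.2 < x.1.1 ∧ (x.1.1 : ℝ≥0∞) ≤ T n x.1.2} with hW2def
  have hW2 : MeasurableSet W2 := measurable_fst (hW.inter hW')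
  have hsub : Measurable[_, pointPast T X n] (fun w : W2 => w.1.1.2) :=
    (measurable_subtype_pointPast_predictable hT hX hTL).comp
      (f := fun w : W2 => (⟨w.1.1, w.2.1⟩ : {x : ℝ≥0 × Ω | L x.2 < x.1}))
      (Measurable.subtype_mk (measurable_fst.comp measurable_subtype_coe))
  let mZ : MeasurableSpace (Ω × (E × ℝ≥0)) := (pointPast T X n).prod inferInstance
  refine measurable_indicator_comp_of_subtype (f := fun x : (ℝ≥0 × Ω) × E => (x.1.2, (x.2, x.1.1)))
    hW2 ?_ hG
  refine @Measurable.prodMk _ _ _ _ (pointPast T X n) _ _ _ hsub ?_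
  exact (measurable_snd.comp measurable_subtype_coe).prodMk
    ((measurable_fst_predictable _).comp (measurable_fst.comp measurable_subtype_coe))

/-- Between the `n`-th point and the next one, the history contains nothing beyond the first `n`
points: generators that concern later points are empty there. -/
theorem exists_pointPast_inter_eq {L : Ω → ℝ≥0∞} {n : ℕ} (hmono : Monotone T) {t : ℝ≥0} {A : Set Ω}
    (hA : MeasurableSet[pointHistory T X hT hX t] A) :
    ∃ B, MeasurableSet[pointPast T X n] B ∧
      ∀ ω, L ω ≤ t → (t : ℝ≥0∞) < T n ω → (ω ∈ A ↔ ω ∈ B) := by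
  induction A, hA using MeasurableSpace.generateFrom_induction with
  | hC A hA _ =>
    obtain ⟨i, r, U, hr, hU, rfl⟩ := hA
    by_cases hi : i < n
    · refine ⟨{ω | T i ω ≤ r ∧ X i ω ∈ U}, ?_, fun _ _ _ => Iff.rfl⟩
      exact @MeasurableSet.inter _ (pointPast T X n) _ _
        (measurable_pointPast_time hi measurableSet_Iic) (measurable_pointPast_mark hi hU)
    · refine ⟨∅, @MeasurableSet.empty _ (pointPast T X n), fun ω _ h => ?_⟩
      have h1 : T n ω ≤ T i ω := hmono (not_lt.1 hi) ω
      have h2 : ¬ T i ω ≤ r := not_le.2 ((ENNReal.coe_le_coe.2 hr).trans_lt (h.trans_le h1))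
      simp [h2]
  | empty => exact ⟨∅, @MeasurableSet.empty _ (pointPast T X n), fun _ _ _ => Iff.rfl⟩
  | compl A _ ih =>
    obtain ⟨B, hB, h⟩ := ih
    exact ⟨Bᶜ, hB.compl, fun ω h1 h2 => not_congr (h ω h1 h2)⟩
  | iUnion A _ ih =>
    choose B hB h using ih
    refine ⟨⋃ i, B i, @MeasurableSet.iUnion _ _ (pointPast T X n) _ _ hB, fun ω h1 h2 => ?_⟩
    simp only [mem_iUnion]
    exact exists_congr fun i => h i ω h1 h2

end PointHistory

/-! ### Quake counts, active mothers and integrals over quakes -/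

namespace QuakeProcess

variable {Ω E : Type*} [mΩ : MeasurableSpace Ω] [mE : MeasurableSpace E] (M : QuakeProcess Ω E)

theorem measurable_point (n : ℕ) : Measurable (M.point n) :=
  (M.measurable_mark n).prodMk (M.measurable_time n).ennreal_toNNReal

theorem monotone_time : Monotone M.time :=
  monotone_nat_of_le_succ fun n ω => M.time_mono n ω

theorem time_lt_time {i n : ℕ} (h : i < n) {ω : Ω} (hfin : M.time i ω ≠ ∞) :
    M.time i ω < M.time n ω :=
  (M.time_lt i ω hfin).trans_le (M.monotone_time h ω)

theorem time_le_lastTime {i n : ℕ} (h : i < n) (ω : Ω) : M.time i ω ≤ M.lastTime n ω := by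
  cases n with
  | zero => omega
  | succ n => exact M.monotone_time (Nat.lt_succ_iff.1 h) ω

theorem lastTime_lt_time {n : ℕ} {ω : Ω} (h : M.lastTime n ω ≠ ∞) :
    M.lastTime n ω < M.time n ω := by
  cases n with
  | zero => exact M.time_pos ω
  | succ n => exact M.time_lt n ω h

theorem lastTime_le_time (n : ℕ) (ω : Ω) : M.lastTime n ω ≤ M.time n ω := by
  cases n with
  | zero => exact zero_le
  | succ n => exact M.time_mono n ω

theorem measurable_lastTime (n : ℕ) : Measurable (M.lastTime n) := by
  cases n with
  | zero => exact measurable_const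
  | succ n => exact M.measurable_time n

theorem ncard_Iio (n : ℕ) : (Iio n).ncard = n := by
  rw [← Finset.coe_Iio, ncard_coe_finset, Nat.card_Iio]

theorem countBefore_eq {n : ℕ} {s : ℝ≥0} {ω : Ω} (h1 : M.lastTime n ω < s)
    (h2 : (s : ℝ≥0∞) ≤ M.time n ω) : M.countBefore s ω = n := by
  rw [countBefore, ← ncard_Iio n]
  congr 1
  ext k
  refine ⟨fun h => ?_, fun h => (M.time_le_lastTime h ω).trans_lt h1⟩
  by_contra hk
  exact absurd (h2.trans (M.monotone_time (not_lt.1 hk) ω)) (not_le.2 h)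

theorem count_eq {n : ℕ} {t : ℝ≥0} {ω : Ω} (h1 : M.lastTime n ω ≤ t)
    (h2 : (t : ℝ≥0∞) < M.time n ω) : M.count t ω = n := by
  rw [count, ← ncard_Iio n]
  congr 1
  ext k
  refine ⟨fun h => ?_, fun h => (M.time_le_lastTime h ω).trans h1⟩
  by_contra hk
  exact absurd (h2.trans_le (M.monotone_time (not_lt.1 hk) ω)) (not_lt.2 h)

theorem lt_of_motherAfter_eq_some {n i : ℕ} {ω : Ω} (h : M.motherAfter n ω = some i) : i < n := by
  induction n generalizing i with
  | zero => simp [motherAfter] at h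
  | succ n ih =>
    rw [motherAfter] at h
    rcases hc : M.inCluster n ω with _ | _ <;> rcases hm : M.motherAfter n ω with _ | j <;>
      rcases hk : M.kill n ω with _ | _ <;> simp [hc, hm, hk] at h
    all_goals first | omega | (have := ih (h ▸ hm); omega)

/-- The possible values of the active mother after `n` quakes. -/
def states (n : ℕ) : Finset (Option ℕ) := (Finset.range n).insertNone

theorem motherAfter_mem_states (n : ℕ) (ω : Ω) : M.motherAfter n ω ∈ states n := by
  rcases h : M.motherAfter n ω with _ | i
  · simp [states]
  · simp [states, M.lt_of_motherAfter_eq_some h]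

theorem sum_states {R : Type*} [AddCommMonoid R] (n : ℕ) (f : Option ℕ → R) :
    ∑ m ∈ states n, f m = f none + ∑ i ∈ Finset.range n, f (some i) := by
  simp [states]

theorem motherAfter_succ (n : ℕ) (ω : Ω) : M.motherAfter (n + 1) ω =
    match M.inCluster n ω, M.motherAfter n ω with
    | false, m => m
    | true, none => some n
    | true, some i => if M.kill n ω then none else some i := rfl

/-- The intensity of cluster quakes, given the active mother. -/
def clusterRate (eps : E → ℝ≥0 → ℝ≥0) (lam : E → ℝ≥0 → E × ℝ≥0 → ℝ≥0) :
    Option ℕ → Ω → E → ℝ≥0 → ℝ≥0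
  | none, _, u, s => eps u s
  | some i, ω, u, s => lam u s (M.point i ω)

/-- Between two quakes the hidden state is frozen, so the intensity reduces to the rate attached to
the current mother. The right end of the gap is included because the intensity uses left limits. -/
theorem clusterIntensity_eq (eps : E → ℝ≥0 → ℝ≥0) (lam : E → ℝ≥0 → E × ℝ≥0 → ℝ≥0) {n : ℕ}
    {s : ℝ≥0} {ω : Ω} (h1 : M.lastTime n ω < s) (h2 : (s : ℝ≥0∞) ≤ M.time n ω) (u : E) :
    M.clusterIntensity lam eps u s ω = M.clusterRate eps lam (M.motherAfter n ω) ω u s := by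
  rw [clusterIntensity, DLeft, M.countBefore_eq h1 h2]
  rcases h : M.motherAfter n ω with _ | i
  · simp [activeOf, clusterRate]
  · have hi := M.lt_of_motherAfter_eq_some h
    rw [Finset.sum_eq_single i]
    · simp [activeOf, clusterRate, thetaLeft, M.countBefore_eq h1 h2, h, thetaOf]
    · intro j _ hj
      simp [thetaLeft, M.countBefore_eq h1 h2, h, thetaOf, hj.symm]
    · simp [hi]

/-- The event that quake `n` occurs and has label `b`. -/
def labelSet (b : Bool) (n : ℕ) : Set Ω := {ω | M.time n ω ≠ ∞ ∧ M.inCluster n ω = b}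

theorem measurableSet_labelSet (b : Bool) (n : ℕ) : MeasurableSet (M.labelSet b n) :=
  ((M.measurable_time n (measurableSet_singleton ∞)).compl).inter
    (M.measurable_inCluster n (measurableSet_singleton b))

theorem lintegral_counting (b : Bool) (ω : Ω) {f : E × ℝ≥0 → ℝ≥0∞} (hf : Measurable f) :
    ∫⁻ x, f x ∂(M.counting b ω)
      = ∑' n, (M.labelSet b n).indicator (fun ω => f (M.point n ω)) ω := by
  rw [counting, lintegral_sum_measure]
  congr 1
  ext n
  by_cases h : M.time n ω ≠ ∞ ∧ M.inCluster n ω = b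
  · rw [if_pos h, lintegral_dirac' _ hf, indicator_of_mem (show ω ∈ M.labelSet b n from h)]
  · rw [if_neg h, indicator_of_notMem (show ω ∉ M.labelSet b n from h)]; simp

theorem measurable_counting_apply (b : Bool) {B : Set (E × ℝ≥0)} (hB : MeasurableSet B) :
    Measurable fun ω => M.counting b ω B := by
  have : (fun ω => M.counting b ω B) = fun ω =>
      ∑' n, (M.labelSet b n).indicator (fun ω => B.indicator 1 (M.point n ω)) ω := by
    ext ω
    rw [← lintegral_indicator_one hB, M.lintegral_counting b ω (measurable_one.indicator hB)]
  rw [this]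
  exact Measurable.tsum fun n => Measurable.indicator
    ((measurable_one.indicator hB).comp (M.measurable_point n)) (M.measurableSet_labelSet b n)

/-- Quake `n` as a point of the product of the predictable base with the mark space. -/
def basePoint (n : ℕ) (ω : Ω) : (ℝ≥0 × Ω) × E := (((M.time n ω).toNNReal, ω), M.mark n ω)

theorem measurable_basePoint (n : ℕ) : Measurable (M.basePoint n) :=
  ((M.measurable_time n).ennreal_toNNReal.prodMk measurable_id).prodMk (M.measurable_mark n)

/-- Turns the left side of `HasIntensity` into a sum over quake numbers, from which a single quake
can be singled out. -/
theorem lintegral_lintegral_counting (P : Measure Ω) (b : Bool) {H : (ℝ≥0 × Ω) × E → ℝ≥0∞}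
    (hH : Measurable H) :
    ∫⁻ ω, ∫⁻ x, H ((x.2, ω), x.1) ∂(M.counting b ω) ∂P
      = ∑' n, ∫⁻ ω in M.labelSet b n, H (M.basePoint n ω) ∂P := by
  have : ∀ ω, ∫⁻ x, H ((x.2, ω), x.1) ∂(M.counting b ω)
      = ∑' n, (M.labelSet b n).indicator (fun ω => H (M.basePoint n ω)) ω := fun ω => by
    rw [M.lintegral_counting b ω (f := fun x => H ((x.2, ω), x.1)) (hH.comp (by fun_prop))]
    rfl
  simp_rw [this]
  have hm : ∀ n, Measurable ((M.labelSet b n).indicator fun ω => H (M.basePoint n ω)) := fun n =>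
    Measurable.indicator (hH.comp (M.measurable_basePoint n)) (M.measurableSet_labelSet b n)
  rw [lintegral_tsum fun n => (hm n).aemeasurable]
  simp_rw [lintegral_indicator (M.measurableSet_labelSet b _)]

end QuakeProcess

/-! ### Predictable rectangles and the intensity of single quakes -/

theorem predictable_le_prod {Ω : Type*} [mΩ : MeasurableSpace Ω] (𝓕 : Filtration ℝ≥0 mΩ) :
    𝓕.predictable ≤ (inferInstance : MeasurableSpace (ℝ≥0 × Ω)) := by
  refine measurableSpace_le_predictable_of_measurableSet (fun A hA => ?_) (fun i A hA => ?_)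
  · exact (measurableSet_singleton _).prod (𝓕.le _ _ hA)
  · exact measurableSet_Ioi.prod (𝓕.le _ _ hA)

theorem predictable_prod_le {Ω E : Type*} [mΩ : MeasurableSpace Ω] [mE : MeasurableSpace E]
    (𝓕 : Filtration ℝ≥0 mΩ) :
    𝓕.predictable.prod mE ≤ (inferInstance : MeasurableSpace ((ℝ≥0 × Ω) × E)) :=
  sup_le_sup (MeasurableSpace.comap_mono (predictable_le_prod 𝓕)) le_rfl

theorem IsPoissonRandomMeasure.lintegral_apply {Ω S : Type*} [MeasurableSpace Ω]
    [MeasurableSpace S] {P : Measure Ω} {X : Ω → Measure S} {μ : Measure S}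
    (h : IsPoissonRandomMeasure P X μ) {B : Set S} (hB : MeasurableSet B) (hfin : μ B < ∞)
    (hX : Measurable fun ω => X ω B) : ∫⁻ ω, X ω B ∂P = μ B := by
  have h1 : ∫⁻ ω, X ω B ∂P = ∫⁻ x, x ∂(P.map fun ω => X ω B) := by
    rw [lintegral_map measurable_id' hX]
  rw [h1, h.law B hB hfin, lintegral_map measurable_id' (by fun_prop),
    lintegral_natCast_poissonMeasure, ENNReal.coe_toNNReal hfin.ne]

theorem isPiSystem_predictable {Ω : Type*} [mΩ : MeasurableSpace Ω] (𝓕 : Filtration ℝ≥0 mΩ) :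
    IsPiSystem ({s | ∃ A, MeasurableSet[𝓕 ⊥] A ∧ s = {⊥} ×ˢ A} ∪
      {s : Set (ℝ≥0 × Ω) | ∃ i A, MeasurableSet[𝓕 i] A ∧ s = Set.Ioi i ×ˢ A}) := by
  rintro s (⟨A, hA, rfl⟩ | ⟨i, A, hA, rfl⟩) t (⟨B, hB, rfl⟩ | ⟨j, B, hB, rfl⟩) hne
  · left
    exact ⟨A ∩ B, hA.inter hB, by rw [prod_inter_prod, inter_self]⟩
  · obtain ⟨x, ⟨h1, -⟩, ⟨h2, -⟩⟩ := hne
    rw [mem_singleton_iff.1 h1] at h2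
    exact (not_lt_bot (mem_Ioi.1 h2)).elim
  · obtain ⟨x, ⟨h2, -⟩, ⟨h1, -⟩⟩ := hne
    rw [mem_singleton_iff.1 h1] at h2
    exact (not_lt_bot (mem_Ioi.1 h2)).elim
  · right
    refine ⟨i ⊔ j, A ∩ B, ?_, by rw [prod_inter_prod, Ioi_inter_Ioi]⟩
    exact (𝓕.mono le_sup_left _ hA).inter (𝓕.mono le_sup_right _ hB)

/-- Reduces an equality of measures on the predictable product σ-algebra to rectangles. -/
theorem generateFrom_predictable_prod {Ω E : Type*} [mΩ : MeasurableSpace Ω]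
    [mE : MeasurableSpace E] (𝓕 : Filtration ℝ≥0 mΩ) :
    𝓕.predictable.prod mE = MeasurableSpace.generateFrom (image2 (· ×ˢ ·)
      ({s | ∃ A, MeasurableSet[𝓕 ⊥] A ∧ s = {⊥} ×ˢ A} ∪
        {s : Set (ℝ≥0 × Ω) | ∃ i A, MeasurableSet[𝓕 i] A ∧ s = Set.Ioi i ×ˢ A})
      {B : Set E | MeasurableSet B}) := by
  refine (@generateFrom_eq_prod _ _ 𝓕.predictable _ _ _ rfl
    MeasurableSpace.generateFrom_measurableSet ?_ isCountablySpanning_measurableSet).symm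
  refine ⟨fun n => if n = 0 then {⊥} ×ˢ univ else Ioi ⊥ ×ˢ univ, fun n => ?_, ?_⟩
  · by_cases h : n = 0
    · simp only [h, if_true]; exact Or.inl ⟨univ, MeasurableSet.univ, rfl⟩
    · simp only [h, if_false]; exact Or.inr ⟨⊥, univ, MeasurableSet.univ, rfl⟩
  · refine eq_univ_of_forall fun x => mem_iUnion.2 ?_
    by_cases h : x.1 = ⊥
    · exact ⟨0, by simpa using h⟩
    · exact ⟨1, by simpa [bot_lt_iff_ne_bot, pos_iff_ne_zero] using h⟩

namespace QuakeProcess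

variable {Ω E : Type*} [mΩ : MeasurableSpace Ω] [mE : MeasurableSpace E] (M : QuakeProcess Ω E)

/-- The single quakes have intensity `gam` with respect to the full history. -/
theorem hasIntensity_single {P : Measure Ω} [IsProbabilityMeasure P] {ν : Measure E}
    [SigmaFinite ν] {gam : E → ℝ≥0 → ℝ≥0} (hgam : Measurable fun x : E × ℝ≥0 => gam x.1 x.2)
    (hgam_int : ∀ T : ℝ≥0, ∫⁻ s in Iic T, ∫⁻ u, (gam u s : ℝ≥0∞) ∂ν ∂lebesgueNN < ∞)
    (hpoi : IsPoissonRandomMeasure P M.N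
      ((ν.prod lebesgueNN).withDensity fun x => (gam x.1 x.2 : ℝ≥0∞)))
    (hcomp : ∀ t : ℝ≥0, Indep
      (MeasurableSpace.comap (fun ω => (M.N ω).restrict (univ ×ˢ Ioi t)) inferInstance)
      (M.fullHistory t) P) :
    HasIntensity P M.fullHistory M.N ν (fun u s _ => gam u s) := by
  classical
  set 𝓕 := M.fullHistory
  have hle := predictable_prod_le (E := E) 𝓕
  have hgam' : Measurable fun x : (ℝ≥0 × Ω) × E => (gam x.2 x.1.1 : ℝ≥0∞) :=
    (hgam.comp (measurable_snd.prodMk (measurable_fst.comp measurable_fst))).coe_nnreal_ennreal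
  have hgam2 : Measurable fun x : E × ℝ≥0 => (gam x.1 x.2 : ℝ≥0∞) := hgam.coe_nnreal_ennreal
  -- `Q1` and `Q2` represent the two sides of the intensity identity as integrals of `H`. It then
  -- suffices that they agree on the predictable σ-algebra.
  set Q1 : Measure ((ℝ≥0 × Ω) × E) :=
    Measure.sum fun n => (P.restrict (M.labelSet false n)).map (M.basePoint n) with hQ1
  set Q2 : Measure ((ℝ≥0 × Ω) × E) :=
    ((lebesgueNN.prod P).prod ν).withDensity fun x => (gam x.2 x.1.1 : ℝ≥0∞) with hQ2
  have hI1 : ∀ H : (ℝ≥0 × Ω) × E → ℝ≥0∞, Measurable H →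
      ∫⁻ ω, ∫⁻ x, H ((x.2, ω), x.1) ∂(M.N ω) ∂P = ∫⁻ x, H x ∂Q1 := fun H hH => by
    rw [hQ1, lintegral_sum_measure]
    simp_rw [lintegral_map hH (M.measurable_basePoint _)]
    exact M.lintegral_lintegral_counting P false hH
  have hI2 : ∀ H : (ℝ≥0 × Ω) × E → ℝ≥0∞, Measurable H →
      ∫⁻ ω, ∫⁻ s, ∫⁻ u, H ((s, ω), u) * (gam u s : ℝ≥0∞) ∂ν ∂lebesgueNN ∂P
        = ∫⁻ x, H x ∂Q2 := fun H hH => by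
    rw [hQ2, lintegral_withDensity_eq_lintegral_mul _ hgam' hH,
      lintegral_prod _ (hgam'.mul hH).aemeasurable,
      lintegral_prod _ ((hgam'.mul hH).lintegral_prod_right').aemeasurable,
      lintegral_lintegral_swap]
    · simp only [Pi.mul_apply, mul_comm]
    · exact ((hH.mul hgam').lintegral_prod_right'.comp measurable_swap).aemeasurable
  suffices h : Q1.trim hle = Q2.trim hle by
    intro H hH
    have hH' := hH.mono hle le_rfl
    rw [hI1 H hH', hI2 H hH', ← lintegral_trim hle hH, h, lintegral_trim hle hH]
  set μ := (ν.prod lebesgueNN).withDensity fun x => (gam x.1 x.2 : ℝ≥0∞) with hμ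
  have hμfin : ∀ T : ℝ≥0, μ (univ ×ˢ Iic T) < ∞ := fun T => by
    rw [hμ, withDensity_apply _ (MeasurableSet.univ.prod measurableSet_Iic), ← Measure.prod_restrict,
      Measure.restrict_univ, lintegral_prod_symm _ hgam2.aemeasurable]
    exact hgam_int T
  have hprod : ∀ (A : Set Ω) (B : Set E) (J : Set ℝ≥0), MeasurableSet A → MeasurableSet B →
      MeasurableSet J → Q1 ((J ×ˢ A) ×ˢ B) = ∫⁻ ω in A, M.N ω (B ×ˢ J) ∂P ∧
      Q2 ((J ×ˢ A) ×ˢ B) = P A * μ (B ×ˢ J) := by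
    intro A B J hA hB hJ
    have hS : MeasurableSet ((J ×ˢ A) ×ˢ B) := (hJ.prod hA).prod hB
    constructor
    · rw [← lintegral_indicator_one hS, ← hI1 _ (measurable_one.indicator hS),
        ← lintegral_indicator hA]
      congr 1
      ext ω
      by_cases h : ω ∈ A
      · rw [indicator_of_mem h, ← lintegral_indicator_one (hB.prod hJ)]
        congr 1; ext x; simp [indicator, h, and_comm]
      · simp [indicator, h]
    · rw [← lintegral_indicator_one hS, ← hI2 _ (measurable_one.indicator hS), hμ,
        withDensity_apply _ (hB.prod hJ), ← lintegral_indicator (hB.prod hJ),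
        lintegral_prod_symm _ (hgam2.indicator (hB.prod hJ)).aemeasurable, mul_comm,
        ← lintegral_indicator_one hA, ← lintegral_const_mul _ (measurable_one.indicator hA)]
      congr 1
      ext ω
      by_cases h : ω ∈ A
      · simp only [h, indicator_of_mem, Pi.one_apply, mul_one]
        congr 1; ext s; congr 1; ext u
        simp [indicator, h, and_comm]
      · simp [indicator, h]
  have hN0 : ∀ ω (B : Set E), M.N ω (B ×ˢ {0}) = 0 := fun ω B => by
    refine measure_mono_null (prod_mono_left (subset_univ B)) ?_
    have hm : MeasurableSet (univ ×ˢ {0} : Set (E × ℝ≥0)) :=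
      MeasurableSet.univ.prod (measurableSet_singleton 0)
    rw [← lintegral_indicator_one hm, N, M.lintegral_counting false ω (measurable_one.indicator hm),
      ENNReal.tsum_eq_zero]
    intro n
    by_cases h : ω ∈ M.labelSet false n
    · have h0 : (M.time n ω).toNNReal ≠ 0 := by
        rw [Ne, ENNReal.toNNReal_eq_zero_iff, not_or]
        exact ⟨((M.time_pos ω).trans_le (M.monotone_time (Nat.zero_le n) ω)).ne', h.1⟩
      simp [h, point, h0]
    · simp [h]
  -- The only probabilistic input: `N` after `t` is independent of an event of the history at `t`,
  -- and its mean is `μ`.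
  have hkey : ∀ (t T : ℝ≥0) (A : Set Ω) (B : Set E), MeasurableSet[𝓕 t] A → MeasurableSet B →
      ∫⁻ ω in A, M.N ω (B ×ˢ Ioc t T) ∂P = P A * μ (B ×ˢ Ioc t T) := by
    intro t T A B hA hB
    have hBJ : MeasurableSet (B ×ˢ Ioc t T) := hB.prod measurableSet_Ioc
    have hA' := 𝓕.le _ _ hA
    have h1 : ∀ ω, M.N ω (B ×ˢ Ioc t T) = (M.N ω).restrict (univ ×ˢ Ioi t) (B ×ˢ Iic T) := fun ω => by
      rw [Measure.restrict_apply (hB.prod measurableSet_Iic), prod_inter_prod, inter_univ,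
        inter_comm, Ioi_inter_Iic]
    have hm1 : Measurable[MeasurableSpace.comap (fun ω => (M.N ω).restrict (univ ×ˢ Ioi t))
        inferInstance] fun ω => M.N ω (B ×ˢ Ioc t T) := by
      simp_rw [h1]
      exact (Measure.measurable_coe (hB.prod measurableSet_Iic)).comp (comap_measurable _)
    have hcle : MeasurableSpace.comap (fun ω => (M.N ω).restrict (univ ×ˢ Ioi t)) inferInstance
        ≤ mΩ := by
      rw [← measurable_iff_comap_le]
      refine Measure.measurable_of_measurable_coe _ fun S hS => ?_
      simp_rw [Measure.restrict_apply hS]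
      exact M.measurable_counting_apply false (hS.inter (MeasurableSet.univ.prod measurableSet_Ioi))
    have := lintegral_mul_eq_lintegral_mul_lintegral_of_independent_measurableSpace hcle
      (𝓕.le t) (hcomp t) hm1 (measurable_const.indicator hA : Measurable[𝓕 t] (A.indicator fun _ => (1 : ℝ≥0∞)))
    rw [lintegral_indicator_const hA', one_mul, hpoi.lintegral_apply hBJ ((measure_mono (Set.prod_mono
      (subset_univ _) Ioc_subset_Iic_self)).trans_lt (hμfin T))
      (M.measurable_counting_apply false hBJ), mul_comm] at this
    rw [← this, ← lintegral_indicator hA']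
    congr 1; ext ω
    by_cases h : ω ∈ A <;> simp [h]
  -- The measures need not be finite, so they are compared on the time windows `[0, n]`, where the
  -- integrability of `gam` makes `Q2`, and through equality of masses also `Q1`, finite.
  set S : ℕ → Set ((ℝ≥0 × Ω) × E) := fun n => (Iic (n : ℝ≥0) ×ˢ univ) ×ˢ univ with hS
  have hSm : ∀ n, MeasurableSet[𝓕.predictable.prod mE] (S n) := fun n => by
    have h1 : MeasurableSet[𝓕.predictable] ((Prod.fst : ℝ≥0 × Ω → ℝ≥0) ⁻¹' (Iic (n : ℝ≥0))) :=
      measurable_fst_predictable 𝓕 measurableSet_Iic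
    have h2 := @measurable_fst _ E 𝓕.predictable mE _ h1
    have h3 : S n = Prod.fst ⁻¹' (Prod.fst ⁻¹' Iic (n : ℝ≥0)) := by ext; simp [hS]
    rw [h3]; exact h2
  have huniv : ⋃ n, S n = univ := eq_univ_of_forall fun x => mem_iUnion.2 (by
    obtain ⟨n, hn⟩ := exists_nat_ge x.1.1
    exact ⟨n, by simpa [hS] using hn⟩)
  rw [@Measure.ext_iff_of_iUnion_eq_univ _ _ (𝓕.predictable.prod mE) _ _ _ _ huniv]
  intro N
  have heval : ∀ (i : ℝ≥0) (A : Set Ω) (B : Set E), MeasurableSet[𝓕 i] A → MeasurableSet B →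
      Q1 ((Ioc i N ×ˢ A) ×ˢ B) = Q2 ((Ioc i N ×ˢ A) ×ˢ B) := fun i A B hA hB => by
    rw [(hprod A B _ (𝓕.le _ _ hA) hB measurableSet_Ioc).1,
      (hprod A B _ (𝓕.le _ _ hA) hB measurableSet_Ioc).2, hkey _ _ _ _ hA hB]
  have heval0 : ∀ (A : Set Ω) (B : Set E), MeasurableSet A → MeasurableSet B →
      Q1 (({0} ×ˢ A) ×ˢ B) = 0 ∧ Q2 (({0} ×ˢ A) ×ˢ B) = 0 := fun A B hA hB => by
    rw [(hprod A B _ hA hB (measurableSet_singleton 0)).1,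
      (hprod A B _ hA hB (measurableSet_singleton 0)).2]
    refine ⟨by simp [hN0], ?_⟩
    rw [hμ, withDensity_absolutelyContinuous _ _ (by simp [Measure.prod_prod]), mul_zero]
  have huni : Q1 (S N) = Q2 (S N) ∧ Q2 (S N) < ∞ := by
    have hd : Disjoint (({0} ×ˢ univ) ×ˢ univ : Set ((ℝ≥0 × Ω) × E))
        ((Ioc 0 (N : ℝ≥0) ×ˢ univ) ×ˢ univ) := by
      rw [Set.disjoint_left]; rintro ⟨⟨s, ω⟩, u⟩ h1 h2
      simp at h1 h2; exact h2.1.ne' h1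
    have hu : S N = (({0} ×ˢ univ) ×ˢ univ) ∪ ((Ioc 0 (N : ℝ≥0) ×ˢ univ) ×ˢ univ) := by
      ext ⟨⟨s, ω⟩, u⟩
      simp only [hS, mem_prod, mem_union, mem_univ, and_true, mem_Iic, mem_singleton_iff, mem_Ioc]
      constructor
      · intro h; rcases eq_or_ne s 0 with h0 | h0
        exacts [Or.inl h0, Or.inr ⟨pos_iff_ne_zero.2 h0, h⟩]
      · rintro (rfl | h)
        exacts [zero_le, h.2]
    have hm : MeasurableSet ((Ioc 0 (N : ℝ≥0) ×ˢ univ) ×ˢ univ : Set ((ℝ≥0 × Ω) × E)) :=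
      (measurableSet_Ioc.prod MeasurableSet.univ).prod MeasurableSet.univ
    refine ⟨?_, ?_⟩
    · rw [hu, measure_union hd hm, measure_union hd hm, (heval0 _ _ .univ .univ).1,
        (heval0 _ _ .univ .univ).2, heval _ _ _ .univ .univ]
    · rw [(hprod _ _ _ .univ .univ measurableSet_Iic).2]
      exact ENNReal.mul_lt_top (measure_lt_top _ _) (hμfin _)
  have hfin1 : IsFiniteMeasure ((Q1.trim hle).restrict (S N)) := ⟨by
    rw [Measure.restrict_apply .univ, univ_inter, trim_measurableSet_eq hle (hSm N), huni.1]
    exact huni.2⟩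
  refine @ext_of_generate_finite _ (𝓕.predictable.prod mE) _ _ _ (generateFrom_predictable_prod 𝓕)
    ((isPiSystem_predictable 𝓕).prod MeasurableSpace.isPiSystem_measurableSet) hfin1 ?_ ?_
  · rintro _ ⟨J, hJ, B, hB, rfl⟩
    have hJm : MeasurableSet[𝓕.predictable] J := MeasurableSpace.measurableSet_generateFrom hJ
    have hJB : MeasurableSet[𝓕.predictable.prod mE] (J ×ˢ B) :=
      @MeasurableSet.prod _ _ 𝓕.predictable _ _ _ hJm hB
    rw [Measure.restrict_apply hJB, Measure.restrict_apply hJB,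
      trim_measurableSet_eq hle (hJB.inter (hSm N)), trim_measurableSet_eq hle (hJB.inter (hSm N))]
    rcases hJ with ⟨A, hA, rfl⟩ | ⟨i, A, hA, rfl⟩
    · have h0 := heval0 A B (𝓕.le _ _ hA) hB
      exact (measure_mono_null inter_subset_left h0.1).trans
        (measure_mono_null inter_subset_left h0.2).symm
    · have : (Ioi i ×ˢ A) ×ˢ B ∩ S N = (Ioc i (N : ℝ≥0) ×ˢ A) ×ˢ B := by
        ext ⟨⟨s, ω⟩, u⟩
        simp only [hS, mem_inter_iff, mem_prod, mem_Ioi, mem_Iic, mem_univ, and_true, mem_Ioc]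
        tauto
      rw [this, heval i A B hA hB]
  · rw [Measure.restrict_apply .univ, Measure.restrict_apply .univ, univ_inter,
      trim_measurableSet_eq hle (hSm N), trim_measurableSet_eq hle (hSm N), huni.1]

end QuakeProcess

/-- The regularity assumptions on the intensities of the mother-quake model. -/
structure RegularRates {E : Type*} [MeasurableSpace E] (ν : Measure E) (gam eps : E → ℝ≥0 → ℝ≥0)
    (lam : E → ℝ≥0 → E × ℝ≥0 → ℝ≥0) : Prop where
  gam_meas : Measurable fun x : E × ℝ≥0 => gam x.1 x.2
  eps_meas : Measurable fun x : E × ℝ≥0 => eps x.1 x.2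
  lam_meas : Measurable fun x : E × ℝ≥0 × (E × ℝ≥0) => lam x.1 x.2.1 x.2.2
  gam_int : ∀ T : ℝ≥0, ∫⁻ s in Iic T, ∫⁻ u, (gam u s : ℝ≥0∞) ∂ν ∂lebesgueNN < ∞
  eps_int : ∀ T : ℝ≥0, ∫⁻ s in Iic T, ∫⁻ u, (eps u s : ℝ≥0∞) ∂ν ∂lebesgueNN < ∞
  lam_int : ∀ (y : E × ℝ≥0) (T : ℝ≥0),
    ∫⁻ s in Ioc y.2 T, ∫⁻ u, (lam u s y : ℝ≥0∞) ∂ν ∂lebesgueNN < ∞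

/-! ### Rates, survival probabilities and the gap before the next quake -/

namespace QuakeProcess

variable {Ω E : Type*} [mΩ : MeasurableSpace Ω] [mE : MeasurableSpace E] (M : QuakeProcess Ω E)

/-- The mark, label and coin of quake `n`. -/
def fullMark (n : ℕ) (ω : Ω) : E × Bool × Bool := (M.mark n ω, M.inCluster n ω, M.kill n ω)

theorem measurable_fullMark (n : ℕ) : Measurable (M.fullMark n) :=
  (M.measurable_mark n).prodMk ((M.measurable_inCluster n).prodMk (M.measurable_kill n))

/-- The σ-algebra of the times and marks of the first `n` quakes. -/
@[reducible]
def obsPast (n : ℕ) : MeasurableSpace Ω := pointPast M.time M.mark n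

/-- The σ-algebra of the times, marks, labels and coins of the first `n` quakes. -/
@[reducible]
def fullPast (n : ℕ) : MeasurableSpace Ω := pointPast M.time M.fullMark n

theorem obsPast_le_fullPast (n : ℕ) : M.obsPast n ≤ M.fullPast n := by
  refine pointPast_le_iff.2 fun i hi => ?_
  have h1 : Measurable[M.fullPast n] (M.fullMark i) := measurable_pointPast_mark hi
  have h2 : Measurable[M.fullPast n] (M.mark i) := measurable_fst.comp h1
  have h3 : Measurable[M.fullPast n] (M.time i) := measurable_pointPast_time hi
  exact h2.prodMk h3

theorem fullPast_le (n : ℕ) : M.fullPast n ≤ mΩ :=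
  pointPast_le M.measurable_time M.measurable_fullMark n

theorem obsPast_le (n : ℕ) : M.obsPast n ≤ mΩ :=
  (M.obsPast_le_fullPast n).trans (M.fullPast_le n)

section Composition

variable {Y : Type*} {mY : MeasurableSpace Y} {f : Y → Ω} {n : ℕ}

/-- Measurability is stated along a map `f` into the observed past, so that one lemma serves `Ω`
with either past, products with `E × ℝ≥0`, and constant maps, where `ω` is fixed. -/
theorem measurable_comp_point (hf : Measurable[mY, M.obsPast n] f) {i : ℕ} (hi : i < n) :
    Measurable fun y => M.point i (f y) :=
  ((measurable_pointPast_mark (X := M.mark) hi).comp hf).prodMk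
    ((measurable_pointPast_time (X := M.mark) hi).comp hf).ennreal_toNNReal

theorem measurable_comp_lastTime (hf : Measurable[mY, M.obsPast n] f) :
    Measurable fun y => M.lastTime n (f y) := by
  cases n with
  | zero => exact measurable_const
  | succ n => exact (measurable_pointPast_time (X := M.mark) n.lt_succ_self).comp hf

variable {ν : Measure E} {gam eps : E → ℝ≥0 → ℝ≥0} {lam : E → ℝ≥0 → E × ℝ≥0 → ℝ≥0}

theorem measurable_comp_clusterRate (h : RegularRates ν gam eps lam)
    (hf : Measurable[mY, M.obsPast n] f) {u : Y → E} {s : Y → ℝ≥0} (hu : Measurable u)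
    (hs : Measurable s) {m : Option ℕ} (hm : m ∈ states n) :
    Measurable fun y => M.clusterRate eps lam m (f y) (u y) (s y) := by
  cases m with
  | none => exact h.eps_meas.comp (hu.prodMk hs)
  | some i =>
    have hi : i < n := by simpa [states] using hm
    exact h.lam_meas.comp (hu.prodMk (hs.prodMk (M.measurable_comp_point hf hi)))

/-- The total intensity of quakes, given the active mother. -/
noncomputable def totalRate (ν : Measure E) (gam eps : E → ℝ≥0 → ℝ≥0)
    (lam : E → ℝ≥0 → E × ℝ≥0 → ℝ≥0) (m : Option ℕ) (ω : Ω) (s : ℝ≥0) : ℝ≥0∞ :=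
  ∫⁻ u, (gam u s + M.clusterRate eps lam m ω u s : ℝ≥0) ∂ν

/-- The cumulative intensity of quakes, given the active mother. -/
noncomputable def hazard (ν : Measure E) (gam eps : E → ℝ≥0 → ℝ≥0)
    (lam : E → ℝ≥0 → E × ℝ≥0 → ℝ≥0) (m : Option ℕ) (ω : Ω) : Measure ℝ≥0 :=
  lebesgueNN.withDensity (M.totalRate ν gam eps lam m ω)

/-- The probability that no quake occurs between the last of the first `n` quakes and time `t`,
given the first `n` quakes and the active mother. -/
noncomputable def surv (ν : Measure E) (gam eps : E → ℝ≥0 → ℝ≥0)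
    (lam : E → ℝ≥0 → E × ℝ≥0 → ℝ≥0) (n : ℕ) (m : Option ℕ) (ω : Ω) (t : ℝ≥0) : ℝ≥0 :=
  (Real.exp (-(M.hazard ν gam eps lam m ω).real (Ioc (M.lastTime n ω).toNNReal t))).toNNReal

instance (m : Option ℕ) (ω : Ω) : NullSingletonClass (M.hazard ν gam eps lam m ω) :=
  ⟨fun x => withDensity_absolutelyContinuous _ _ (measure_singleton x)⟩

variable [SigmaFinite ν]

theorem measurable_comp_totalRate (h : RegularRates ν gam eps lam)
    (hf : Measurable[mY, M.obsPast n] f) {s : Y → ℝ≥0}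
    (hs : Measurable s) {m : Option ℕ} (hm : m ∈ states n) :
    Measurable fun y => M.totalRate ν gam eps lam m (f y) (s y) := by
  refine Measurable.lintegral_prod_right' (f := fun x : Y × E =>
    ((gam x.2 (s x.1) + M.clusterRate eps lam m (f x.1) x.2 (s x.1) : ℝ≥0) : ℝ≥0∞)) ?_
  refine Measurable.coe_nnreal_ennreal (Measurable.add ?_ ?_)
  · exact h.gam_meas.comp (measurable_snd.prodMk (hs.comp measurable_fst))
  · exact M.measurable_comp_clusterRate h (hf.comp measurable_fst) measurable_snd
      (hs.comp measurable_fst) hm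

theorem measurable_comp_hazard (h : RegularRates ν gam eps lam)
    (hf : Measurable[mY, M.obsPast n] f) {s t : Y → ℝ≥0}
    (hs : Measurable s) (ht : Measurable t) {m : Option ℕ} (hm : m ∈ states n) :
    Measurable fun y => M.hazard ν gam eps lam m (f y) (Ioc (s y) (t y)) := by
  have : ∀ y, M.hazard ν gam eps lam m (f y) (Ioc (s y) (t y)) = ∫⁻ r,
      ({x : Y × ℝ≥0 | s x.1 < x.2 ∧ x.2 ≤ t x.1}.indicator
        (fun x => M.totalRate ν gam eps lam m (f x.1) x.2)) (y, r) ∂lebesgueNN := fun y => by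
    rw [hazard, withDensity_apply _ measurableSet_Ioc, ← lintegral_indicator measurableSet_Ioc]
    rfl
  simp_rw [this]
  refine Measurable.lintegral_prod_right' ((M.measurable_comp_totalRate h (hf.comp measurable_fst)
    measurable_snd hm).indicator ?_)
  exact (measurableSet_lt (f := fun x : Y × ℝ≥0 => s x.1) (hs.comp measurable_fst)
    measurable_snd).inter (measurableSet_le (g := fun x : Y × ℝ≥0 => t x.1) measurable_snd
    (ht.comp measurable_fst))

theorem measurable_comp_surv (h : RegularRates ν gam eps lam)
    (hf : Measurable[mY, M.obsPast n] f) {t : Y → ℝ≥0} (ht : Measurable t) {m : Option ℕ}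
    (hm : m ∈ states n) : Measurable fun y => M.surv ν gam eps lam n m (f y) (t y) :=
  (Real.measurable_exp.comp (M.measurable_comp_hazard h hf
    (M.measurable_comp_lastTime hf).ennreal_toNNReal ht hm).ennreal_toReal.neg).real_toNNReal

end Composition

theorem measurableSet_motherAfter (n : ℕ) (m : Option ℕ) :
    MeasurableSet[M.fullPast n] {ω | M.motherAfter n ω = m} := by
  -- With the discrete σ-algebra every map out of the countable space of mother, label and coin is
  -- measurable, so the recursion for the mother can be composed directly.
  let _ : MeasurableSpace (Option ℕ) := ⊤
  suffices h : Measurable[M.fullPast n] (M.motherAfter n) from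
    h (show MeasurableSet {m} from trivial)
  induction n with
  | zero => exact @measurable_const _ _ _ (M.fullPast 0) none
  | succ n ih =>
    have h1 : Measurable[M.fullPast (n + 1)] fun ω => (M.motherAfter n ω, (M.fullMark n ω).2) := by
      have h1 : Measurable[M.fullPast (n + 1)] (M.fullMark n) :=
        measurable_pointPast_mark n.lt_succ_self
      have h2 : Measurable[M.fullPast (n + 1)] fun ω => (M.fullMark n ω).2 :=
        measurable_snd.comp h1
      have h3 : Measurable[M.fullPast (n + 1)] (M.motherAfter n) :=
        ih.mono (pointPast_mono _ _ n) le_rfl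
      exact h3.prodMk h2
    have h2 : M.motherAfter (n + 1) = (fun x : Option ℕ × Bool × Bool =>
        match x.2.1, x.1 with
        | false, m => m
        | true, none => some n
        | true, some i => if x.2.2 then none else some i) ∘
          fun ω => (M.motherAfter n ω, (M.fullMark n ω).2) := rfl
    rw [h2]
    exact (measurable_of_countable _).comp h1

/-- The time interval between the last of the first `n` quakes and the next one. -/
def gap (n : ℕ) (ω : Ω) : Set ℝ≥0 := {s | M.lastTime n ω < s ∧ (s : ℝ≥0∞) ≤ M.time n ω}

theorem measurableSet_gap (n : ℕ) (ω : Ω) : MeasurableSet (M.gap n ω) :=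
  (measurableSet_lt measurable_const measurable_coe_nnreal_ennreal).inter
    (measurableSet_le measurable_coe_nnreal_ennreal measurable_const)

/-- An intensity of the quakes with label `b` governs the next quake after the first `n`. -/
theorem setLIntegral_labelSet_of_hasIntensity {P : Measure Ω} {ν : Measure E} {b : Bool}
    {κ : E → ℝ≥0 → Ω → ℝ≥0} (hκ : HasIntensity P M.fullHistory (M.counting b) ν κ) (n : ℕ)
    {G : Ω × (E × ℝ≥0) → ℝ≥0∞} (hG : Measurable[(M.fullPast n).prod inferInstance] G) :
    ∫⁻ ω in M.labelSet b n, G (ω, M.point n ω) ∂P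
      = ∫⁻ ω, ∫⁻ s in M.gap n ω, ∫⁻ u, G (ω, (u, s)) * κ u s ω ∂ν ∂lebesgueNN ∂P := by
  set W : Set ((ℝ≥0 × Ω) × E) :=
    {x : (ℝ≥0 × Ω) × E | M.lastTime n x.1.2 < x.1.1 ∧ (x.1.1 : ℝ≥0∞) ≤ M.time n x.1.2} with hW
  set H : (ℝ≥0 × Ω) × E → ℝ≥0∞ := W.indicator fun x => G (x.1.2, (x.2, x.1.1)) with hH
  have hL : ∀ q : ℝ≥0, MeasurableSet[pointHistory M.time M.fullMark M.measurable_time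
      M.measurable_fullMark q] {ω | M.lastTime n ω ≤ q} := fun q => by
    cases n with
    | zero =>
      have : {ω | M.lastTime 0 ω ≤ q} = univ := by ext; simp [lastTime]
      rw [this]; exact @MeasurableSet.univ _ (_)
    | succ n =>
      simpa [lastTime] using measurableSet_pointHistory_mark M.measurable_time M.measurable_fullMark
        (le_refl q) n MeasurableSet.univ
  have hHm : Measurable[M.fullHistory.predictable.prod mE] H :=
    measurable_predictable_between M.measurable_time M.measurable_fullMark
      (fun i hi ω => M.time_le_lastTime hi ω) hL hG
  have hmain := hκ H hHm
  -- The test function lives on the gap after the first `n` quakes, and quake `n` is the only quake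
  -- in it: earlier ones occur by `lastTime n`, later ones strictly after `time n`.
  rw [M.lintegral_lintegral_counting P b (hHm.mono (predictable_prod_le _) le_rfl),
    tsum_eq_single n] at hmain
  · convert hmain using 1
    · refine setLIntegral_congr_fun (M.measurableSet_labelSet b n) fun ω hω => ?_
      have hmem : M.basePoint n ω ∈ W := by
        have hlt : M.lastTime n ω < M.time n ω :=
          M.lastTime_lt_time (ne_top_of_le_ne_top hω.1 (M.lastTime_le_time n ω))
        simp only [hW, basePoint, mem_ofPred_eq, ENNReal.coe_toNNReal hω.1]
        exact ⟨hlt, le_rfl⟩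
      simp only [hH, indicator_of_mem hmem]
      rfl
    · congr 1; ext ω
      rw [← lintegral_indicator (M.measurableSet_gap n ω)]
      congr 1; ext s
      by_cases hs : s ∈ M.gap n ω
      · rw [indicator_of_mem hs]
        congr 1; ext u
        rw [hH, indicator_of_mem (show ((s, ω), u) ∈ W from hs)]
      · rw [indicator_of_notMem hs]
        have h0 : ∀ u, H ((s, ω), u) = 0 := fun u =>
          indicator_of_notMem (show ((s, ω), u) ∉ W from hs) _
        simp [h0]
  · intro k hk
    rw [← lintegral_zero (μ := P.restrict (M.labelSet b k))]
    refine setLIntegral_congr_fun (M.measurableSet_labelSet b k) fun ω hω => ?_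
    refine indicator_of_notMem (fun hmem => ?_) _
    simp only [hW, basePoint, mem_ofPred_eq, ENNReal.coe_toNNReal hω.1] at hmem
    rcases lt_or_gt_of_ne hk with h | h
    · exact absurd (M.time_le_lastTime h ω) (not_le.2 hmem.1)
    · refine absurd (M.time_lt_time h ?_) (not_lt.2 hmem.2)
      exact ne_top_of_le_ne_top hω.1 (M.monotone_time h.le ω)

end QuakeProcess

/-! ### The survival formula -/

namespace QuakeProcess

variable {Ω E : Type*} [mΩ : MeasurableSpace Ω] [mE : MeasurableSpace E] (M : QuakeProcess Ω E)
  {ν : Measure E} {gam eps : E → ℝ≥0 → ℝ≥0} {lam : E → ℝ≥0 → E × ℝ≥0 → ℝ≥0}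

theorem setLIntegral_labelSet_add {P : Measure Ω} (n : ℕ) (f : Ω → ℝ≥0∞) :
    ∫⁻ ω in M.labelSet false n, f ω ∂P + ∫⁻ ω in M.labelSet true n, f ω ∂P
      = ∫⁻ ω in {ω | M.time n ω ≠ ∞}, f ω ∂P := by
  have hd : Disjoint (M.labelSet false n) (M.labelSet true n) := by
    rw [Set.disjoint_left]; rintro ω ⟨-, h1⟩ ⟨-, h2⟩; simp [h1] at h2
  have hu : {ω | M.time n ω ≠ ∞} = M.labelSet false n ∪ M.labelSet true n := by
    ext ω
    simp only [labelSet, mem_union, mem_ofPred_eq]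
    rcases M.inCluster n ω <;> simp
  rw [hu, lintegral_union (M.measurableSet_labelSet true n) hd]

theorem lintegral_gam_add_clusterRate (h : RegularRates ν gam eps lam) (m : Option ℕ) (ω : Ω)
    (s : ℝ≥0) : M.totalRate ν gam eps lam m ω s
      = ∫⁻ u, (gam u s : ℝ≥0∞) ∂ν + ∫⁻ u, (M.clusterRate eps lam m ω u s : ℝ≥0∞) ∂ν := by
  have hg : Measurable fun u => (gam u s : ℝ≥0∞) :=
    (h.gam_meas.comp (measurable_id.prodMk measurable_const)).coe_nnreal_ennreal
  rw [totalRate, ← lintegral_add_left hg]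
  simp

theorem lintegral_clusterRate_lt_top (h : RegularRates ν gam eps lam) {n : ℕ} {m : Option ℕ} {ω : Ω}
    {t : ℝ≥0} (hm : m ∈ states n) (hL : M.lastTime n ω ≤ t) :
    ∫⁻ s in Ioc (M.lastTime n ω).toNNReal t, ∫⁻ u, (M.clusterRate eps lam m ω u s : ℝ≥0∞) ∂ν
      ∂lebesgueNN < ∞ := by
  cases m with
  | none => exact (lintegral_mono_set Ioc_subset_Iic_self).trans_lt (h.eps_int t)
  | some i =>
    have hi : i < n := by simpa [states] using hm
    refine (lintegral_mono_set (Ioc_subset_Ioc_left ?_)).trans_lt (h.lam_int (M.point i ω) t)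
    exact ENNReal.toNNReal_mono (ne_top_of_le_ne_top ENNReal.coe_ne_top hL)
      (M.time_le_lastTime hi ω)

/-- The rate of a mother is integrable only after her own time. The interval starts at the last
quake, which is no earlier than the mother. -/
theorem hazard_ne_top [SigmaFinite ν] (h : RegularRates ν gam eps lam) {n : ℕ} {m : Option ℕ} {ω : Ω}
    {t : ℝ≥0} (hm : m ∈ states n) (hL : M.lastTime n ω ≤ t) :
    M.hazard ν gam eps lam m ω (Ioc (M.lastTime n ω).toNNReal t) ≠ ∞ := by
  rw [hazard, withDensity_apply _ measurableSet_Ioc]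
  simp_rw [M.lintegral_gam_add_clusterRate h]
  rw [lintegral_add_left (Measurable.lintegral_prod_right' (f := fun x : ℝ≥0 × E =>
    (gam x.2 x.1 : ℝ≥0∞)) (h.gam_meas.comp measurable_swap).coe_nnreal_ennreal)]
  exact (ENNReal.add_lt_top.2 ⟨(lintegral_mono_set Ioc_subset_Iic_self).trans_lt (h.gam_int t),
    M.lintegral_clusterRate_lt_top h hm hL⟩).ne

variable [SigmaFinite ν]

theorem measurable_surv (h : RegularRates ν gam eps lam) {n : ℕ} {m : Option ℕ}
    (hm : m ∈ states n) (t : ℝ≥0) :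
    Measurable[M.fullPast n] fun ω => M.surv ν gam eps lam n m ω t :=
  M.measurable_comp_surv h (measurable_id'' (M.obsPast_le_fullPast n)) measurable_const hm

/-- With `Λ` the cumulative rate and `τ` the next time, integrate `e(s) = exp (-Λ(s, t])` over the
quakes in the gap up to `t`. The sum of the two intensity identities equates the means of `hit`, the
value `e(τ)` on `τ ≤ t`, and `inner`, the integral of `e` against `Λ` up to `min t τ`. Calculus
gives `inner + surv = exp (-Λ(min t τ, t]) = hit + 1_{t < τ}` pointwise, and cancelling the equal
means leaves the formula. -/
theorem measure_no_quake {P : Measure Ω} [IsProbabilityMeasure P] (h : RegularRates ν gam eps lam)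
    (hN : HasIntensity P M.fullHistory M.N ν (fun u s _ => gam u s))
    (hC : HasIntensity P M.fullHistory M.C ν (M.clusterIntensity lam eps))
    {n : ℕ} {m : Option ℕ} {t : ℝ≥0} (hm : m ∈ states n) {B : Set Ω}
    (hB : MeasurableSet[M.fullPast n] B)
    (hBm : ∀ ω ∈ B, M.lastTime n ω ≤ t ∧ M.motherAfter n ω = m) :
    P (B ∩ {ω | (t : ℝ≥0∞) < M.time n ω}) = ∫⁻ ω in B, M.surv ν gam eps lam n m ω t ∂P := by
  have hB' := M.fullPast_le n _ hB
  set e : Ω → ℝ≥0 → ℝ≥0∞ := fun ω s =>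
    ENNReal.ofReal (Real.exp (-(M.hazard ν gam eps lam m ω).real (Ioc s t))) with he
  have he1 : ∀ ω s, e ω s ≤ 1 := fun ω s => by simp [he]
  set G : Ω × (E × ℝ≥0) → ℝ≥0∞ := {x | x.1 ∈ B ∧ x.2.2 ≤ t}.indicator fun x => e x.1 x.2.2 with hGdef
  have hG : Measurable[(M.fullPast n).prod inferInstance] G := by
    let _ : MeasurableSpace (Ω × (E × ℝ≥0)) := (M.fullPast n).prod inferInstance
    have h1 : Measurable[_, M.fullPast n] (Prod.fst : Ω × (E × ℝ≥0) → Ω) :=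
      @measurable_fst _ _ (M.fullPast n) _
    have h2 : Measurable fun x : Ω × (E × ℝ≥0) => x.2 := @measurable_snd _ _ (M.fullPast n) _
    have h3 : Measurable fun x : Ω × (E × ℝ≥0) => x.2.2 := measurable_snd.comp h2
    refine Measurable.indicator ?_ ((h1 hB).inter (h3 measurableSet_Iic))
    exact (Real.measurable_exp.comp (M.measurable_comp_hazard h
      ((measurable_id'' (M.obsPast_le_fullPast n)).comp h1) h3 measurable_const
        hm).ennreal_toReal.neg).ennreal_ofReal
  have h0 := M.setLIntegral_labelSet_of_hasIntensity hN n hG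
  have h1 := M.setLIntegral_labelSet_of_hasIntensity hC n hG
  set inner : Ω → ℝ≥0∞ := fun ω =>
    ∫⁻ s in Ioc (M.lastTime n ω).toNNReal (min (t : ℝ≥0∞) (M.time n ω)).toNNReal, e ω s
      ∂(M.hazard ν gam eps lam m ω) with hinner
  set hit : Ω → ℝ≥0∞ := {ω | M.time n ω ≤ t}.indicator fun ω => e ω (M.time n ω).toNNReal with hhit
  have hleft : ∫⁻ ω in {ω | M.time n ω ≠ ∞}, G (ω, M.point n ω) ∂P = ∫⁻ ω in B, hit ω ∂P := by
    have hmt : MeasurableSet {ω | M.time n ω ≠ ∞} :=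
      (M.measurable_time n (measurableSet_singleton ∞)).compl
    rw [← lintegral_indicator hmt, ← lintegral_indicator hB']
    congr 1
    ext ω
    by_cases hω : ω ∈ B
    · rw [indicator_of_mem hω]
      by_cases ht : M.time n ω ≤ t
      · have hne : M.time n ω ≠ ∞ := ne_top_of_le_ne_top ENNReal.coe_ne_top ht
        have h2 : (M.time n ω).toNNReal ≤ t := by
          rwa [← ENNReal.coe_le_coe, ENNReal.coe_toNNReal hne]
        rw [indicator_of_mem (show ω ∈ {ω | M.time n ω ≠ ∞} from hne), hhit,
          indicator_of_mem (show ω ∈ {ω | M.time n ω ≤ t} from ht), hGdef,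
          indicator_of_mem (by exact ⟨hω, h2⟩)]
        rfl
      · rw [hhit, indicator_of_notMem (show ω ∉ {ω | M.time n ω ≤ t} from ht)]
        by_cases hne : M.time n ω = ∞
        · rw [indicator_of_notMem (by simpa using hne)]
        · have h2 : ¬ (M.time n ω).toNNReal ≤ t := by
            rwa [← ENNReal.coe_le_coe, ENNReal.coe_toNNReal hne]
          rw [indicator_of_mem (by exact hne), hGdef, indicator_of_notMem]
          exact fun hx => h2 hx.2
    · rw [indicator_of_notMem hω]
      have : G (ω, M.point n ω) = 0 := indicator_of_notMem (fun hx => hω hx.1) _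
      by_cases hne : ω ∈ {ω | M.time n ω ≠ ∞}
      · rw [indicator_of_mem hne, this]
      · rw [indicator_of_notMem hne]
  have hright : (∫⁻ ω, ∫⁻ s in M.gap n ω, ∫⁻ u, G (ω, (u, s)) * gam u s ∂ν ∂lebesgueNN ∂P)
      + (∫⁻ ω, ∫⁻ s in M.gap n ω, ∫⁻ u, G (ω, (u, s)) * M.clusterIntensity lam eps u s ω
        ∂ν ∂lebesgueNN ∂P) = ∫⁻ ω in B, inner ω ∂P := by
    have hGm : Measurable G := hG.mono
      (sup_le_sup (MeasurableSpace.comap_mono (M.fullPast_le n)) le_rfl) le_rfl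
    have hGg : Measurable fun x : (Ω × ℝ≥0) × E => G (x.1.1, (x.2, x.1.2)) * gam x.2 x.1.2 :=
      (hGm.comp (by fun_prop)).mul
        (h.gam_meas.comp (measurable_snd.prodMk (measurable_snd.comp
          measurable_fst))).coe_nnreal_ennreal
    have hJ := Measurable.lintegral_prod_right' (ν := ν) hGg
    have hA1 : Measurable fun ω => ∫⁻ s in M.gap n ω, ∫⁻ u, G (ω, (u, s)) * gam u s ∂ν
        ∂lebesgueNN := by
      have hW : MeasurableSet {x : Ω × ℝ≥0 | M.lastTime n x.1 < x.2 ∧ (x.2 : ℝ≥0∞) ≤ M.time n x.1} :=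
        (measurableSet_lt (f := fun x : Ω × ℝ≥0 => M.lastTime n x.1)
          ((M.measurable_lastTime n).comp measurable_fst)
          (measurable_coe_nnreal_ennreal.comp measurable_snd)).inter
        (measurableSet_le (g := fun x : Ω × ℝ≥0 => M.time n x.1)
          (measurable_coe_nnreal_ennreal.comp measurable_snd)
          ((M.measurable_time n).comp measurable_fst))
      have := Measurable.lintegral_prod_right' (ν := lebesgueNN) (hJ.indicator hW)
      convert this using 1
      ext ω
      rw [← lintegral_indicator (M.measurableSet_gap n ω)]
      rfl
    rw [← lintegral_add_left hA1, ← lintegral_indicator hB']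
    congr 1; ext ω
    by_cases hω : ω ∈ B
    · obtain ⟨hL, hmo⟩ := hBm ω hω
      have hmin : min (t : ℝ≥0∞) (M.time n ω) ≠ ∞ :=
        ne_top_of_le_ne_top ENNReal.coe_ne_top (min_le_left _ _)
      have htr : Measurable (M.totalRate ν gam eps lam m ω) :=
        M.measurable_comp_totalRate h (measurable_const (a := ω)) measurable_id hm
      have hem : Measurable (e ω) := (Real.measurable_exp.comp (M.measurable_comp_hazard h
        (measurable_const (a := ω)) measurable_id measurable_const
          hm).ennreal_toReal.neg).ennreal_ofReal
      have hset : Ioc (M.lastTime n ω).toNNReal (min (t : ℝ≥0∞) (M.time n ω)).toNNReal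
          = M.gap n ω ∩ Iic t := by
        ext s
        simp only [gap, mem_Ioc, mem_inter_iff, mem_ofPred_eq, mem_Iic]
        rw [← ENNReal.coe_lt_coe, ← ENNReal.coe_le_coe, ← ENNReal.coe_le_coe,
          ENNReal.coe_toNNReal hmin, le_min_iff,
          ENNReal.coe_toNNReal (ne_top_of_le_ne_top ENNReal.coe_ne_top hL)]
        tauto
      have hin : inner ω = ∫⁻ s in M.gap n ω ∩ Iic t,
          (M.totalRate ν gam eps lam m ω * e ω) s ∂lebesgueNN := by
        rw [← hset, ← setLIntegral_withDensity_eq_setLIntegral_mul _ htr hem measurableSet_Ioc]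
        rfl
      have hJω : Measurable fun s => ∫⁻ u, G (ω, (u, s)) * gam u s ∂ν :=
        hJ.comp measurable_prodMk_left
      -- The rates of single and cluster quakes add up to the density of the hazard, and the
      -- integrand does not depend on the mark.
      rw [indicator_of_mem hω, hin, ← lintegral_add_left hJω, inter_comm,
        ← setLIntegral_indicator measurableSet_Iic]
      refine setLIntegral_congr_fun (M.measurableSet_gap n ω) fun s hs => ?_
      by_cases hst : s ≤ t
      · have hGe : ∀ u, G (ω, (u, s)) = e ω s := fun u => indicator_of_mem
          (show (ω, (u, s)) ∈ {x : Ω × (E × ℝ≥0) | x.1 ∈ B ∧ x.2.2 ≤ t} from ⟨hω, hst⟩) _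
        have hne : e ω s ≠ ∞ := ENNReal.ofReal_ne_top
        simp_rw [hGe, M.clusterIntensity_eq eps lam hs.1 hs.2, hmo]
        rw [lintegral_const_mul' _ _ hne, lintegral_const_mul' _ _ hne, ← mul_add,
          ← M.lintegral_gam_add_clusterRate h, indicator_of_mem (by exact hst), Pi.mul_apply,
          mul_comm]
      · have hGe : ∀ u, G (ω, (u, s)) = 0 := fun u => indicator_of_notMem (fun hx => hst hx.2) _
        simp [hGe, indicator_of_notMem (show s ∉ Iic t from hst)]
    · have h0 : ∀ x, G (ω, x) = 0 := fun x => indicator_of_notMem (fun hx => hω hx.1) _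
      simp [h0, indicator_of_notMem hω]
  have hsum : ∫⁻ ω in B, hit ω ∂P = ∫⁻ ω in B, inner ω ∂P := by
    rw [← hleft, ← hright, ← h0, ← h1, M.setLIntegral_labelSet_add]
  have hpt : ∀ ω ∈ B, inner ω + M.surv ν gam eps lam n m ω t
      = hit ω + {ω | (t : ℝ≥0∞) < M.time n ω}.indicator 1 ω := by
    intro ω hω
    obtain ⟨hL, -⟩ := hBm ω hω
    have hLne : M.lastTime n ω ≠ ∞ := ne_top_of_le_ne_top ENNReal.coe_ne_top hL
    have hmin : min (t : ℝ≥0∞) (M.time n ω) ≠ ∞ :=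
      ne_top_of_le_ne_top ENNReal.coe_ne_top (min_le_left _ _)
    have hI := lintegral_exp_neg_measureReal_Ioc (μ := M.hazard ν gam eps lam m ω)
      (a := (M.lastTime n ω).toNNReal) (b := (min (t : ℝ≥0∞) (M.time n ω)).toNNReal) (t := t)
      (ENNReal.toNNReal_mono hmin (le_min hL (M.lastTime_le_time n ω)))
      (by rw [← ENNReal.coe_le_coe, ENNReal.coe_toNNReal hmin]; exact min_le_left _ _)
      (M.hazard_ne_top h hm hL)
    rw [hinner]
    refine hI.trans ?_
    by_cases ht : M.time n ω ≤ t
    · rw [hhit, indicator_of_mem (by exact ht), indicator_of_notMem (by simpa using ht),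
        min_eq_right ht, add_zero]
    · rw [hhit, indicator_of_notMem (by exact ht), indicator_of_mem (by simpa using ht),
        min_eq_left (not_le.1 ht).le]
      simp
  -- Finiteness permits the cancellation of `hit` in extended nonnegative reals.
  have hfin : ∫⁻ ω in B, hit ω ∂P ≠ ∞ := by
    have : ∫⁻ ω in B, hit ω ∂P ≤ ∫⁻ ω in B, 1 ∂P := lintegral_mono fun ω =>
      (indicator_le_self' (fun _ _ => zero_le) ω).trans (he1 _ _)
    exact ne_top_of_le_ne_top (by simp) this
  have hmset : MeasurableSet {ω | (t : ℝ≥0∞) < M.time n ω} :=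
    measurableSet_lt measurable_const (M.measurable_time n)
  have hS := setLIntegral_congr_fun (μ := P) hB' hpt
  rw [lintegral_add_right _ ((M.measurable_surv h hm t).mono (M.fullPast_le n)
    le_rfl).coe_nnreal_ennreal, lintegral_add_right _ (measurable_one.indicator hmset), ← hsum,
    lintegral_indicator_one hmset, Measure.restrict_apply hmset, inter_comm] at hS
  exact ((ENNReal.add_right_inj hfin).1 hS).symm

/-- No quake occurs up to time `t`, tested against functions of the first `n` quakes. -/
theorem setLIntegral_no_quake {P : Measure Ω} [IsProbabilityMeasure P]
    (h : RegularRates ν gam eps lam)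
    (hN : HasIntensity P M.fullHistory M.N ν (fun u s _ => gam u s))
    (hC : HasIntensity P M.fullHistory M.C ν (M.clusterIntensity lam eps))
    {n : ℕ} {m : Option ℕ} (hm : m ∈ states n) (t : ℝ≥0) {g : Ω → ℝ≥0∞}
    (hg : Measurable[M.fullPast n] g) :
    ∫⁻ ω in {ω | M.motherAfter n ω = m ∧ M.lastTime n ω ≤ t ∧ (t : ℝ≥0∞) < M.time n ω}, g ω ∂P
      = ∫⁻ ω in {ω | M.motherAfter n ω = m ∧ M.lastTime n ω ≤ t},
          g ω * M.surv ν gam eps lam n m ω t ∂P := by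
  set S : Set Ω := {ω | M.motherAfter n ω = m ∧ M.lastTime n ω ≤ t} with hS
  have hSm : MeasurableSet[M.fullPast n] S :=
    (M.measurableSet_motherAfter n m).inter
      (M.measurable_comp_lastTime (measurable_id'' (M.obsPast_le_fullPast n)) measurableSet_Iic)
  have hSm' := M.fullPast_le n _ hSm
  have hmset : MeasurableSet {ω | (t : ℝ≥0∞) < M.time n ω} :=
    measurableSet_lt measurable_const (M.measurable_time n)
  have hSt : {ω | M.motherAfter n ω = m ∧ M.lastTime n ω ≤ t ∧ (t : ℝ≥0∞) < M.time n ω}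
      = S ∩ {ω | (t : ℝ≥0∞) < M.time n ω} := by ext; simp [hS, and_assoc]
  have hsurv : Measurable fun ω => (M.surv ν gam eps lam n m ω t : ℝ≥0∞) :=
    ((M.measurable_surv h hm t).mono (M.fullPast_le n) le_rfl).coe_nnreal_ennreal
  have key := lintegral_mul_eq_of_forall_setLIntegral_eq (P := P) (M.fullPast_le n)
    (φ := (S ∩ {ω | (t : ℝ≥0∞) < M.time n ω}).indicator 1)
    (ψ := S.indicator fun ω => (M.surv ν gam eps lam n m ω t : ℝ≥0∞))
    (measurable_one.indicator (hSm'.inter hmset)) (hsurv.indicator hSm') (fun A hA => by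
      have hAS : MeasurableSet[M.fullPast n] (A ∩ S) := hA.inter hSm
      have := M.measure_no_quake h hN hC hm hAS fun ω hω => ⟨hω.2.2, hω.2.1⟩
      rw [lintegral_indicator_one (hSm'.inter hmset),
        Measure.restrict_apply (hSm'.inter hmset), lintegral_indicator hSm',
        Measure.restrict_restrict hSm', inter_comm S A, ← this]
      congr 1; ext; simp; tauto) hg
  rw [hSt, ← lintegral_indicator (hSm'.inter hmset), ← lintegral_indicator hSm']
  convert key using 2
  · ext ω; by_cases hω : ω ∈ S ∩ {ω | (t : ℝ≥0∞) < M.time n ω}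
    · rw [indicator_of_mem hω, indicator_of_mem hω]; simp
    · rw [indicator_of_notMem hω, indicator_of_notMem hω]; simp
  · ext ω; by_cases hω : ω ∈ S
    · rw [indicator_of_mem hω, indicator_of_mem hω]
    · rw [indicator_of_notMem hω, indicator_of_notMem hω]; simp

end QuakeProcess

/-! ### The law of the next quake given the active mother -/

namespace QuakeProcess

variable {Ω E : Type*} [mΩ : MeasurableSpace Ω] [mE : MeasurableSpace E] (M : QuakeProcess Ω E)
  {ν : Measure E} {gam eps : E → ℝ≥0 → ℝ≥0} {lam : E → ℝ≥0 → E × ℝ≥0 → ℝ≥0}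

/-- The reference measure for the next quake: the product of the law of the past with `ν(du) ds`,
restricted to the times after the last of the first `n` quakes. -/
noncomputable def nextMeasure (P : Measure Ω) (ν : Measure E) (n : ℕ) : Measure (Ω × (E × ℝ≥0)) :=
  (P.prod (ν.prod lebesgueNN)).restrict {x | M.lastTime n x.1 < x.2.2}

theorem measurableSet_lastTime_lt (n : ℕ) :
    MeasurableSet {x : Ω × (E × ℝ≥0) | M.lastTime n x.1 < x.2.2} :=
  measurableSet_lt (f := fun x : Ω × (E × ℝ≥0) => M.lastTime n x.1)
    ((M.measurable_lastTime n).comp measurable_fst)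
    (measurable_coe_nnreal_ennreal.comp (measurable_snd.comp measurable_snd))

theorem prod_fullPast_le (n : ℕ) : (M.fullPast n).prod (inferInstance : MeasurableSpace (E × ℝ≥0))
    ≤ (inferInstance : MeasurableSpace (Ω × (E × ℝ≥0))) :=
  sup_le_sup (MeasurableSpace.comap_mono (M.fullPast_le n)) le_rfl

theorem prod_obsPast_le_prod_fullPast (n : ℕ) :
    (M.obsPast n).prod (inferInstance : MeasurableSpace (E × ℝ≥0))
      ≤ (M.fullPast n).prod (inferInstance : MeasurableSpace (E × ℝ≥0)) :=
  sup_le_sup (MeasurableSpace.comap_mono (M.obsPast_le_fullPast n)) le_rfl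

theorem measurable_fst_prod_obsPast (n : ℕ) :
    Measurable[(M.obsPast n).prod (inferInstance : MeasurableSpace (E × ℝ≥0)), M.obsPast n]
      (Prod.fst : Ω × (E × ℝ≥0) → Ω) := @measurable_fst _ _ (M.obsPast n) _

theorem measurable_snd_prod_obsPast (n : ℕ) :
    Measurable[(M.obsPast n).prod (inferInstance : MeasurableSpace (E × ℝ≥0))]
      (Prod.snd : Ω × (E × ℝ≥0) → E × ℝ≥0) := @measurable_snd _ _ (M.obsPast n) _

theorem measurableSet_time_ne_top (n : ℕ) : MeasurableSet {ω | M.time n ω ≠ ∞} :=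
  (M.measurable_time n (measurableSet_singleton ∞)).compl

variable [SigmaFinite ν]

/-- The law of the next quake after the first `n`, with label `b`, when `m` is the active mother. -/
theorem setLIntegral_labelSet_mother {P : Measure Ω} [IsProbabilityMeasure P]
    (h : RegularRates ν gam eps lam)
    (hN : HasIntensity P M.fullHistory M.N ν (fun u s _ => gam u s))
    (hC : HasIntensity P M.fullHistory M.C ν (M.clusterIntensity lam eps))
    {n : ℕ} {m : Option ℕ} (hm : m ∈ states n) {b : Bool} {κ : E → ℝ≥0 → Ω → ℝ≥0}
    (hκ : HasIntensity P M.fullHistory (M.counting b) ν κ) {R : Ω × (E × ℝ≥0) → ℝ≥0}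
    (hR : Measurable[(M.fullPast n).prod inferInstance] R)
    (hκR : ∀ ω s u, M.motherAfter n ω = m → s ∈ M.gap n ω → κ u s ω = R (ω, (u, s)))
    {G : Ω × (E × ℝ≥0) → ℝ≥0∞} (hG : Measurable[(M.fullPast n).prod inferInstance] G) :
    ∫⁻ ω in M.labelSet b n ∩ {ω | M.motherAfter n ω = m}, G (ω, M.point n ω) ∂P
      = ∫⁻ x in {x | M.motherAfter n x.1 = m},
          G x * (M.surv ν gam eps lam n m x.1 x.2.2 * R x : ℝ≥0) ∂(M.nextMeasure P ν n) := by
  have hmo := M.measurableSet_motherAfter n m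
  have hmo' := M.fullPast_le n _ hmo
  have hpm : MeasurableSet {x : Ω × (E × ℝ≥0) | M.motherAfter n x.1 = m} := measurable_fst hmo'
  have hpm' : MeasurableSet[(M.fullPast n).prod inferInstance]
      {x : Ω × (E × ℝ≥0) | M.motherAfter n x.1 = m} :=
    (@measurable_fst Ω (E × ℝ≥0) (M.fullPast n) _) hmo
  have hGm : Measurable G := hG.mono (M.prod_fullPast_le n) le_rfl
  have hRm : Measurable fun x => (R x : ℝ≥0∞) :=
    (hR.mono (M.prod_fullPast_le n) le_rfl).coe_nnreal_ennreal
  set S : Set (Ω × (E × ℝ≥0)) := {x | M.lastTime n x.1 < x.2.2 ∧ (x.2.2 : ℝ≥0∞) < M.time n x.1}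
    with hSdef
  have hSm : MeasurableSet S := (M.measurableSet_lastTime_lt n).inter (measurableSet_lt
    (g := fun x : Ω × (E × ℝ≥0) => M.time n x.1)
    (measurable_coe_nnreal_ennreal.comp (measurable_snd.comp measurable_snd))
    ((M.measurable_time n).comp measurable_fst))
  have hGR : Measurable fun x => G x * R x := hGm.mul hRm
  set Φ : Ω × (E × ℝ≥0) → ℝ≥0∞ :=
    (S ∩ {x | M.motherAfter n x.1 = m}).indicator fun x => G x * R x with hΦ
  have hΦm : Measurable Φ := hGR.indicator (hSm.inter hpm)
  have hsurvm : Measurable fun x : Ω × (E × ℝ≥0) =>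
      (M.surv ν gam eps lam n m x.1 x.2.2 * R x : ℝ≥0) :=
    (M.measurable_comp_surv h ((measurable_id'' (M.obsPast_le n)).comp measurable_fst)
      (measurable_snd.comp measurable_snd) hm).mul (hR.mono (M.prod_fullPast_le n) le_rfl)
  have h1 : ∫⁻ ω in M.labelSet b n ∩ {ω | M.motherAfter n ω = m}, G (ω, M.point n ω) ∂P
      = ∫⁻ ω, ∫⁻ s in M.gap n ω, ∫⁻ u, {x : Ω × (E × ℝ≥0) | M.motherAfter n x.1 = m}.indicator G
        (ω, (u, s)) * κ u s ω ∂ν ∂lebesgueNN ∂P := by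
    rw [← M.setLIntegral_labelSet_of_hasIntensity hκ n (hG.indicator hpm'), inter_comm,
      ← setLIntegral_indicator hmo']
    rfl
  have h2 : ∀ ω, ∫⁻ s in M.gap n ω, ∫⁻ u, {x : Ω × (E × ℝ≥0) | M.motherAfter n x.1 = m}.indicator G
        (ω, (u, s)) * κ u s ω ∂ν ∂lebesgueNN = ∫⁻ x, Φ (ω, x) ∂(ν.prod lebesgueNN) := by
    intro ω
    have hΦω : Measurable fun x => Φ (ω, x) := hΦm.comp measurable_prodMk_left
    rw [lintegral_prod_symm _ hΦω.aemeasurable, ← lintegral_indicator (M.measurableSet_gap n ω)]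
    -- The gap contains the time of the next quake, whereas survival up to `s` requires that time to
    -- exceed `s`; the two sets differ in one Lebesgue-null point.
    have hae : ∀ᵐ s ∂lebesgueNN, s ≠ (M.time n ω).toNNReal := by
      simp [ae_iff, measure_singleton]
    refine lintegral_congr_ae (hae.mono fun s hs => ?_)
    dsimp only
    by_cases hgap : s ∈ M.gap n ω
    · rw [indicator_of_mem hgap]
      refine lintegral_congr fun u => ?_
      have hlt : (s : ℝ≥0∞) < M.time n ω := by
        refine lt_of_le_of_ne hgap.2 fun he => hs ?_
        rw [← he, ENNReal.toNNReal_coe]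
      by_cases hmω : M.motherAfter n ω = m
      · rw [hΦ, indicator_of_mem (by exact hmω), indicator_of_mem (by exact ⟨⟨hgap.1, hlt⟩, hmω⟩),
          hκR ω s u hmω hgap]
      · rw [hΦ, indicator_of_notMem (by exact hmω),
          indicator_of_notMem (by exact fun hx => hmω hx.2), zero_mul]
    · rw [indicator_of_notMem hgap]
      have h0 : ∀ u, Φ (ω, (u, s)) = 0 := fun u =>
        indicator_of_notMem (fun hx => hgap ⟨hx.1.1, hx.1.2.le⟩) _
      simp [h0]
  have hrhs : Measurable fun x => G x * (M.surv ν gam eps lam n m x.1 x.2.2 * R x : ℝ≥0) :=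
    hGm.mul hsurvm.coe_nnreal_ennreal
  rw [h1]
  simp_rw [h2]
  rw [lintegral_lintegral_swap (f := fun ω x => Φ (ω, x)) hΦm.aemeasurable, nextMeasure,
    Measure.restrict_restrict hpm,
    ← lintegral_indicator (hpm.inter (M.measurableSet_lastTime_lt n)),
    lintegral_prod_symm _ (hrhs.indicator
      (hpm.inter (M.measurableSet_lastTime_lt n))).aemeasurable]
  refine lintegral_congr fun x => ?_
  -- After Fubini the mark and time `x` are fixed; `g` depends on the first `n` quakes only, and the
  -- event that none follows by time `x.2` is replaced by its survival probability.
  set g : Ω → ℝ≥0∞ := {ω | M.lastTime n ω < x.2}.indicator fun ω => G (ω, x) * R (ω, x) with hg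
  have hLm : Measurable[M.fullPast n] (M.lastTime n) :=
    M.measurable_comp_lastTime (measurable_id'' (M.obsPast_le_fullPast n))
  have hx : Measurable[M.fullPast n, (M.fullPast n).prod inferInstance] fun ω : Ω => (ω, x) :=
    @measurable_prodMk_right _ _ (M.fullPast n) _ x
  have hgm : Measurable[M.fullPast n] g :=
    Measurable.indicator ((hG.comp hx).mul (hR.comp hx).coe_nnreal_ennreal)
      (hLm measurableSet_Iio)
  have key := M.setLIntegral_no_quake h hN hC hm x.2 hgm
  have hA : MeasurableSet {ω | M.motherAfter n ω = m ∧ M.lastTime n ω ≤ x.2 ∧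
      (x.2 : ℝ≥0∞) < M.time n ω} :=
    hmo'.inter ((M.measurable_lastTime n measurableSet_Iic).inter
      (M.measurable_time n measurableSet_Ioi))
  have hB : MeasurableSet {ω | M.motherAfter n ω = m ∧ M.lastTime n ω ≤ x.2} :=
    hmo'.inter (M.measurable_lastTime n measurableSet_Iic)
  rw [← lintegral_indicator hA, ← lintegral_indicator hB] at key
  convert key using 2
  · ext ω
    by_cases hω : ω ∈ {ω | M.motherAfter n ω = m ∧ M.lastTime n ω ≤ x.2 ∧
      (x.2 : ℝ≥0∞) < M.time n ω}
    · rw [indicator_of_mem hω]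
      by_cases hL : M.lastTime n ω < x.2
      · rw [hg, indicator_of_mem (by exact hL), hΦ,
          indicator_of_mem (by exact ⟨⟨hL, hω.2.2⟩, hω.1⟩)]
      · rw [hg, indicator_of_notMem (by exact hL), hΦ,
          indicator_of_notMem (by exact fun hx => hL hx.1.1)]
    · rw [indicator_of_notMem hω, hΦ,
        indicator_of_notMem (by exact fun hx => hω ⟨hx.2, hx.1.1.le, hx.1.2⟩)]
  · ext ω
    by_cases hω : ω ∈ {ω | M.motherAfter n ω = m ∧ M.lastTime n ω ≤ x.2}
    · rw [indicator_of_mem hω]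
      by_cases hL : M.lastTime n ω < x.2
      · have hmem : (ω, x) ∈ {x : Ω × (E × ℝ≥0) | M.motherAfter n x.1 = m} ∩
            {x | M.lastTime n x.1 < x.2.2} := ⟨hω.1, hL⟩
        rw [hg, indicator_of_mem hmem,
          indicator_of_mem (show ω ∈ {ω | M.lastTime n ω < x.2} from hL)]
        push_cast
        ring
      · have hmem : (ω, x) ∉ {x : Ω × (E × ℝ≥0) | M.motherAfter n x.1 = m} ∩
            {x | M.lastTime n x.1 < x.2.2} := fun hx => hL hx.2
        rw [hg, indicator_of_notMem hmem,
          indicator_of_notMem (show ω ∉ {ω | M.lastTime n ω < x.2} from hL), zero_mul]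
    · rw [indicator_of_notMem hω, indicator_of_notMem (by exact fun hx => hω ⟨hx.1, hx.2.le⟩)]

end QuakeProcess

/-! ### Transitions of the active mother and the coin -/

namespace QuakeProcess

variable {Ω E : Type*} [mΩ : MeasurableSpace Ω] [mE : MeasurableSpace E] (M : QuakeProcess Ω E)
  {ν : Measure E} {gam eps : E → ℝ≥0 → ℝ≥0} {lam : E → ℝ≥0 → E × ℝ≥0 → ℝ≥0} {p : ℝ≥0}

/-- The active mother after a cluster quake with number `n` and coin `k`. -/
def moveTo (n : ℕ) (k : Bool) : Option ℕ → Option ℕ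
  | none => some n
  | some i => if k then none else some i

/-- The probability that a cluster quake with number `n` turns the active mother `m` into `m'`. -/
def moveProb (p : ℝ≥0) (n : ℕ) (m m' : Option ℕ) : ℝ≥0 :=
  p * (if moveTo n true m = m' then 1 else 0) + (1 - p) * (if moveTo n false m = m' then 1 else 0)

theorem motherAfter_succ_of_true {n : ℕ} {ω : Ω} (h : M.inCluster n ω = true) :
    M.motherAfter (n + 1) ω = moveTo n (M.kill n ω) (M.motherAfter n ω) := by
  rw [motherAfter_succ, h]
  rcases M.motherAfter n ω with _ | i <;> rfl

theorem motherAfter_succ_of_false {n : ℕ} {ω : Ω} (h : M.inCluster n ω = false) :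
    M.motherAfter (n + 1) ω = M.motherAfter n ω := by
  rw [motherAfter_succ, h]

theorem moveTo_mem_states {n : ℕ} {m : Option ℕ} (hm : m ∈ states n) (k : Bool) :
    moveTo n k m ∈ states (n + 1) := by
  rcases m with _ | i
  · simp [moveTo, states]
  · have hi : i < n := by simpa [states] using hm
    rcases k with _ | _ <;> simp [moveTo, states]
    omega

theorem states_mono {n : ℕ} {m : Option ℕ} (hm : m ∈ states n) : m ∈ states (n + 1) := by
  rcases m with _ | i
  · simp [states]
  · have hi : i < n := by simpa [states] using hm
    simp [states]
    omega

theorem sum_moveProb (hp : p ≤ 1) {n : ℕ} {m : Option ℕ} (hm : m ∈ states n) :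
    ∑ m' ∈ states (n + 1), moveProb p n m m' = 1 := by
  simp only [moveProb, Finset.sum_add_distrib, ← Finset.mul_sum, Finset.sum_ite_eq,
    moveTo_mem_states hm, if_true, mul_one]
  exact add_tsub_cancel_of_le hp

/-- The rate of quakes at `x = (ω, (u, s))` that turn the active mother `m` into `m'`. -/
def jumpRate (gam eps : E → ℝ≥0 → ℝ≥0) (lam : E → ℝ≥0 → E × ℝ≥0 → ℝ≥0) (p : ℝ≥0) (n : ℕ)
    (m' m : Option ℕ) (x : Ω × (E × ℝ≥0)) : ℝ≥0 :=
  (if m = m' then 1 else 0) * gam x.2.1 x.2.2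
    + moveProb p n m m' * M.clusterRate eps lam m x.1 x.2.1 x.2.2

/-- The rate of quakes at `x = (ω, (u, s))` when `m` is the active mother. -/
def markRate (gam eps : E → ℝ≥0 → ℝ≥0) (lam : E → ℝ≥0 → E × ℝ≥0 → ℝ≥0)
    (m : Option ℕ) (x : Ω × (E × ℝ≥0)) : ℝ≥0 :=
  gam x.2.1 x.2.2 + M.clusterRate eps lam m x.1 x.2.1 x.2.2

theorem sum_jumpRate (hp : p ≤ 1) {n : ℕ} {m : Option ℕ} (hm : m ∈ states n)
    (x : Ω × (E × ℝ≥0)) :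
    ∑ m' ∈ states (n + 1), M.jumpRate gam eps lam p n m' m x = M.markRate gam eps lam m x := by
  simp only [jumpRate, markRate, Finset.sum_add_distrib, ← Finset.sum_mul, sum_moveProb hp hm,
    Finset.sum_ite_eq, states_mono hm, if_true, one_mul]

/-- Everything that precedes the coin of quake `n`. -/
def coinPast (n : ℕ) (ω : Ω) : (Fin n → ℝ≥0∞ × E × Bool × Bool) × ℝ≥0∞ × E × Bool :=
  ((fun j : Fin n => (M.time j ω, M.mark j ω, M.inCluster j ω, M.kill j ω)),
    (M.time n ω, M.mark n ω, M.inCluster n ω))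

/-- The σ-algebra of everything that precedes the coin of quake `n`. -/
@[reducible]
def coinPastSigma (n : ℕ) : MeasurableSpace Ω := MeasurableSpace.comap (M.coinPast n) inferInstance

/-- The coin of quake `n` is independent of the first `n` quakes and of quake `n` itself. -/
theorem lintegral_mul_moveTo {P : Measure Ω} [IsProbabilityMeasure P]
    (hk : ∀ n, P {ω | M.kill n ω = true} = p)
    (hind : ∀ n, IndepFun (M.kill n) (M.coinPast n) P)
    (n : ℕ) (m m' : Option ℕ) {G : Ω × (E × ℝ≥0) → ℝ≥0∞}
    (hG : Measurable[(M.fullPast n).prod inferInstance] G) :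
    ∫⁻ ω in M.labelSet true n, G (ω, M.point n ω) *
        (if moveTo n (M.kill n ω) m = m' then 1 else 0) ∂P
      = (∫⁻ ω in M.labelSet true n, G (ω, M.point n ω) ∂P) * moveProb p n m m' := by
  have hpm : Measurable[M.coinPastSigma n] (M.coinPast n) := comap_measurable _
  have h1 : ∀ j : Fin n, Measurable[M.coinPastSigma n] fun ω =>
      (M.time j ω, M.mark j ω, M.inCluster j ω, M.kill j ω) := fun j =>
    (measurable_pi_apply j).comp (measurable_fst.comp hpm)
  -- Everything except the coin, including the time, mark and label of quake `n`, is measurable with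
  -- respect to a σ-algebra independent of that coin, so the expectation factorizes.
  have hfull : M.fullPast n ≤ M.coinPastSigma n := by
    refine pointPast_le_iff.2 fun i hi => ?_
    have ht : Measurable[M.coinPastSigma n] (M.time i) := measurable_fst.comp (h1 ⟨i, hi⟩)
    have hf : Measurable[M.coinPastSigma n] (M.fullMark i) := measurable_snd.comp (h1 ⟨i, hi⟩)
    exact hf.prodMk ht
  have h2 : Measurable[M.coinPastSigma n] fun ω => (M.time n ω, M.mark n ω, M.inCluster n ω) :=
    measurable_snd.comp hpm
  have ht : Measurable[M.coinPastSigma n] (M.time n) := measurable_fst.comp h2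
  have hu : Measurable[M.coinPastSigma n] (M.mark n) := measurable_fst.comp (measurable_snd.comp h2)
  have hc : Measurable[M.coinPastSigma n] (M.inCluster n) := measurable_snd.comp (measurable_snd.comp h2)
  have hpt : Measurable[M.coinPastSigma n] (M.point n) := hu.prodMk ht.ennreal_toNNReal
  have hls : MeasurableSet[M.coinPastSigma n] (M.labelSet true n) :=
    (ht (measurableSet_singleton ∞)).compl.inter (hc (measurableSet_singleton true))
  have hle_mΩ : M.coinPastSigma n ≤ mΩ := by
    refine measurable_iff_comap_le.1 (Measurable.prodMk (measurable_pi_lambda _ fun j => ?_) ?_)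
    · exact (M.measurable_time j).prodMk ((M.measurable_mark j).prodMk
        ((M.measurable_inCluster j).prodMk (M.measurable_kill j)))
    · exact (M.measurable_time n).prodMk ((M.measurable_mark n).prodMk (M.measurable_inCluster n))
  have hXm : Measurable[M.coinPastSigma n] ((M.labelSet true n).indicator fun ω => G (ω, M.point n ω)) := by
    refine Measurable.indicator ?_ hls
    exact hG.comp (@Measurable.prodMk _ _ _ _ (M.fullPast n) _ _ _ (measurable_id'' hfull) hpt)
  have hmove : Measurable fun k : Bool => (if moveTo n k m = m' then (1 : ℝ≥0∞) else 0) :=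
    measurable_of_countable _
  have key := lintegral_mul_eq_lintegral_mul_lintegral_of_independent_measurableSpace hle_mΩ
    (measurable_iff_comap_le.1 (M.measurable_kill n)) (hind n).symm hXm
    (hmove.comp (comap_measurable (M.kill n)))
  have hm' := M.measurableSet_labelSet true n
  have hfalse : P {ω | M.kill n ω = false} = (1 - p : ℝ≥0) := by
    have := prob_compl_eq_one_sub (μ := P) (M.measurable_kill n (measurableSet_singleton true))
    have hset : {ω | M.kill n ω = false} = (M.kill n ⁻¹' {true})ᶜ := by ext ω; simp
    rw [ENNReal.coe_sub, ENNReal.coe_one, ← hk n, hset]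
    exact this
  have hE : ∫⁻ ω, ((fun k : Bool => (if moveTo n k m = m' then (1 : ℝ≥0∞) else 0)) ∘ M.kill n) ω ∂P
      = moveProb p n m m' := by
    have hmap : ∀ k, P.map (M.kill n) {k} = P {ω | M.kill n ω = k} := fun k =>
      Measure.map_apply (M.measurable_kill n) (measurableSet_singleton k)
    have := lintegral_map (μ := P) hmove (M.measurable_kill n)
    simp only [Function.comp_apply]
    rw [← this, lintegral_fintype, Fintype.sum_bool, hmap, hmap, hk n, hfalse, moveProb]
    push_cast
    simp only [mul_comm]
    congr 2 <;> split_ifs <;> simp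
  rw [hE, lintegral_indicator hm'] at key
  rw [← key, ← lintegral_indicator hm']
  congr 1; ext ω
  by_cases hω : ω ∈ M.labelSet true n <;> simp [hω]

end QuakeProcess

/-! ### The recursive weights and the joint law of quake and mother -/

namespace QuakeProcess

variable {Ω E : Type*} [mΩ : MeasurableSpace Ω] [mE : MeasurableSpace E] (M : QuakeProcess Ω E)
  {ν : Measure E} {gam eps : E → ℝ≥0 → ℝ≥0} {lam : E → ℝ≥0 → E × ℝ≥0 → ℝ≥0} {p : ℝ≥0}

/-- The facts about the mother-quake model that determine the filter: the intensities of both kinds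
of quakes with respect to the full history, and the law of the coins. -/
structure IntensityModel (P : Measure Ω) (ν : Measure E) (gam eps : E → ℝ≥0 → ℝ≥0)
    (lam : E → ℝ≥0 → E × ℝ≥0 → ℝ≥0) (p : ℝ≥0) : Prop where
  rates : RegularRates ν gam eps lam
  single : HasIntensity P M.fullHistory M.N ν (fun u s _ => gam u s)
  cluster : HasIntensity P M.fullHistory M.C ν (M.clusterIntensity lam eps)
  coin_prob : ∀ n, P {ω | M.kill n ω = true} = p
  coin_indep : ∀ n, IndepFun (M.kill n) (M.coinPast n) P
  prob_le_one : p ≤ 1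

theorem measurableSet_motherAfter' (n : ℕ) (m : Option ℕ) :
    MeasurableSet {ω | M.motherAfter n ω = m} :=
  M.fullPast_le n _ (M.measurableSet_motherAfter n m)

theorem measurable_comp_pointAt {n : ℕ} {G : Ω × (E × ℝ≥0) → ℝ≥0∞}
    (hG : Measurable[(M.fullPast n).prod inferInstance] G) :
    Measurable fun ω => G (ω, M.point n ω) :=
  (hG.mono (M.prod_fullPast_le n) le_rfl).comp (measurable_id.prodMk (M.measurable_point n))

theorem measurable_prod_gam (h : RegularRates ν gam eps lam) (n : ℕ) :
    Measurable[(M.obsPast n).prod inferInstance]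
      fun x : Ω × (E × ℝ≥0) => gam x.2.1 x.2.2 :=
  h.gam_meas.comp (M.measurable_snd_prod_obsPast n)

theorem measurable_prod_clusterRate (h : RegularRates ν gam eps lam) {n : ℕ} {m : Option ℕ}
    (hm : m ∈ states n) : Measurable[(M.obsPast n).prod inferInstance]
      fun x : Ω × (E × ℝ≥0) => M.clusterRate eps lam m x.1 x.2.1 x.2.2 :=
  M.measurable_comp_clusterRate h (M.measurable_fst_prod_obsPast n)
    (measurable_fst.comp (M.measurable_snd_prod_obsPast n))
    (measurable_snd.comp (M.measurable_snd_prod_obsPast n)) hm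

/-- The average of the rates `R m`, weighted with `w` and the survival probabilities. -/
noncomputable def mix (ν : Measure E) (gam eps : E → ℝ≥0 → ℝ≥0)
    (lam : E → ℝ≥0 → E × ℝ≥0 → ℝ≥0) (n : ℕ) (w : Option ℕ → Ω → ℝ≥0)
    (R : Option ℕ → Ω × (E × ℝ≥0) → ℝ≥0) (x : Ω × (E × ℝ≥0)) : ℝ≥0 :=
  ∑ m ∈ states n, w m x.1 * (M.surv ν gam eps lam n m x.1 x.2.2 * R m x)

/-- The posterior probability, given the first `n` quakes, that `m` is the active mother. -/
noncomputable def weight (ν : Measure E) (gam eps : E → ℝ≥0 → ℝ≥0)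
    (lam : E → ℝ≥0 → E × ℝ≥0 → ℝ≥0) (p : ℝ≥0) : ℕ → Option ℕ → Ω → ℝ≥0
  | 0, m, _ => if m = none then 1 else 0
  | n + 1, m', ω =>
    M.mix ν gam eps lam n (weight ν gam eps lam p n) (M.jumpRate gam eps lam p n m')
        (ω, M.point n ω)
      / M.mix ν gam eps lam n (weight ν gam eps lam p n) (M.markRate gam eps lam) (ω, M.point n ω)

/-- Summing the Bayes numerators over the new states gives the denominator, because the transition
probabilities sum to 1. -/
theorem sum_mix_jumpRate (hp : p ≤ 1) (n : ℕ) (w : Option ℕ → Ω → ℝ≥0) (x : Ω × (E × ℝ≥0)) :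
    ∑ m' ∈ states (n + 1), M.mix ν gam eps lam n w (M.jumpRate gam eps lam p n m') x
      = M.mix ν gam eps lam n w (M.markRate gam eps lam) x := by
  simp only [mix]
  rw [Finset.sum_comm]
  refine Finset.sum_congr rfl fun m hm => ?_
  rw [← Finset.mul_sum, ← Finset.mul_sum, M.sum_jumpRate hp hm]

theorem measurable_jumpRate (h : RegularRates ν gam eps lam) {n : ℕ} (m' : Option ℕ) {m : Option ℕ}
    (hm : m ∈ states n) : Measurable[(M.obsPast n).prod inferInstance]
      (M.jumpRate gam eps lam p n m' m) :=
  (measurable_const.mul (M.measurable_prod_gam h n)).add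
    (measurable_const.mul (M.measurable_prod_clusterRate h hm))

theorem measurable_markRate (h : RegularRates ν gam eps lam) {n : ℕ} {m : Option ℕ}
    (hm : m ∈ states n) : Measurable[(M.obsPast n).prod inferInstance]
      (M.markRate gam eps lam m) :=
  (M.measurable_prod_gam h n).add (M.measurable_prod_clusterRate h hm)

variable [SigmaFinite ν]

theorem measurable_prod_surv (h : RegularRates ν gam eps lam) {n : ℕ} {m : Option ℕ}
    (hm : m ∈ states n) : Measurable[(M.obsPast n).prod inferInstance]
      fun x : Ω × (E × ℝ≥0) => M.surv ν gam eps lam n m x.1 x.2.2 :=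
  M.measurable_comp_surv h (M.measurable_fst_prod_obsPast n)
    (measurable_snd.comp (M.measurable_snd_prod_obsPast n)) hm

/-- The joint law of the next quake and the active mother after it. -/
theorem setLIntegral_next_mother {P : Measure Ω} [IsProbabilityMeasure P]
    (h : M.IntensityModel P ν gam eps lam p) (n : ℕ) (m' : Option ℕ) {G : Ω × (E × ℝ≥0) → ℝ≥0∞}
    (hG : Measurable[(M.fullPast n).prod inferInstance] G) :
    ∫⁻ ω in {ω | M.time n ω ≠ ∞ ∧ M.motherAfter (n + 1) ω = m'}, G (ω, M.point n ω) ∂P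
      = ∑ m ∈ states n, ∫⁻ x in {x | M.motherAfter n x.1 = m},
          G x * (M.surv ν gam eps lam n m x.1 x.2.2 * M.jumpRate gam eps lam p n m' m x : ℝ≥0)
            ∂(M.nextMeasure P ν n) := by
  have hle := M.prod_obsPast_le_prod_fullPast (E := E) n
  have hGm := M.measurable_comp_pointAt hG
  have hls := M.measurableSet_labelSet
  have hmo := M.measurableSet_motherAfter' n
  have hset : MeasurableSet {ω | M.time n ω ≠ ∞ ∧ M.motherAfter (n + 1) ω = m'} :=
    (M.measurableSet_time_ne_top n).inter (M.measurableSet_motherAfter' (n + 1) m')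
  set c : Option ℕ → ℝ≥0∞ := fun m => if m = m' then 1 else 0 with hc
  have hct : ∀ m, c m ≠ ∞ := fun m => by simp only [hc]; split_ifs <;> simp
  set mv : Option ℕ → Ω → ℝ≥0∞ := fun m ω => if moveTo n (M.kill n ω) m = m' then 1 else 0 with hmv
  have hmvm : ∀ m, Measurable (mv m) := fun m =>
    (measurable_of_countable fun k : Bool => if moveTo n k m = m' then (1 : ℝ≥0∞) else 0).comp
      (M.measurable_kill n)
  -- Splits by the old mother `m` and the label: a single quake contributes only if `m = m'`, a
  -- cluster quake only if its coin moves `m` to `m'`.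
  have hpt : ∀ ω, {ω | M.time n ω ≠ ∞ ∧ M.motherAfter (n + 1) ω = m'}.indicator
      (fun ω => G (ω, M.point n ω)) ω = ∑ m ∈ states n,
      (c m * (M.labelSet false n ∩ {ω | M.motherAfter n ω = m}).indicator
          (fun ω => G (ω, M.point n ω)) ω
        + (M.labelSet true n ∩ {ω | M.motherAfter n ω = m}).indicator
          (fun ω => G (ω, M.point n ω) * mv m ω) ω) := by
    intro ω
    rw [Finset.sum_eq_single (M.motherAfter n ω)]
    · by_cases ht : M.time n ω = ∞
      · simp [ht, labelSet]
      · rcases hl : M.inCluster n ω with _ | _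
        · simp [labelSet, ht, hl, indicator_apply, hc, M.motherAfter_succ_of_false hl]
        · simp [labelSet, ht, hl, indicator_apply, hmv, M.motherAfter_succ_of_true hl]
    · intro m _ hm
      simp [hm.symm]
    · exact fun hn => absurd (M.motherAfter_mem_states n ω) hn
  have hm1 : ∀ m, Measurable fun ω => c m * (M.labelSet false n ∩
      {ω | M.motherAfter n ω = m}).indicator (fun ω => G (ω, M.point n ω)) ω := fun m =>
    measurable_const.mul (hGm.indicator ((hls false n).inter (hmo m)))
  have hm2 : ∀ m, Measurable fun ω => (M.labelSet true n ∩
      {ω | M.motherAfter n ω = m}).indicator (fun ω => G (ω, M.point n ω) * mv m ω) ω := fun m =>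
    (hGm.mul (hmvm m)).indicator ((hls true n).inter (hmo m))
  rw [← lintegral_indicator hset]
  simp_rw [hpt]
  have hm12 : ∀ m, Measurable fun ω => c m * (M.labelSet false n ∩
      {ω | M.motherAfter n ω = m}).indicator (fun ω => G (ω, M.point n ω)) ω +
        (M.labelSet true n ∩ {ω | M.motherAfter n ω = m}).indicator
          (fun ω => G (ω, M.point n ω) * mv m ω) ω := fun m => (hm1 m).add (hm2 m)
  rw [lintegral_finsetSum _ fun m _ => hm12 m]
  refine Finset.sum_congr rfl fun m hm => ?_
  have hR1 : Measurable[(M.fullPast n).prod inferInstance]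
      fun x : Ω × (E × ℝ≥0) => gam x.2.1 x.2.2 :=
    (M.measurable_prod_gam h.rates n).mono hle le_rfl
  have hR2 := (M.measurable_prod_clusterRate h.rates hm).mono hle le_rfl
  have hS := (M.measurable_prod_surv h.rates hm).mono hle le_rfl
  have hpm : MeasurableSet[(M.fullPast n).prod inferInstance]
      {x : Ω × (E × ℝ≥0) | M.motherAfter n x.1 = m} :=
    (@measurable_fst Ω (E × ℝ≥0) (M.fullPast n) _) (M.measurableSet_motherAfter n m)
  -- The two labels have densities proportional to `gam` and `clusterRate`; `e3` replaces the coin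
  -- by `moveProb`, and the sum is `jumpRate`.
  have e1 := M.setLIntegral_labelSet_mother h.rates h.single h.cluster hm h.single hR1
    (fun _ _ _ _ _ => rfl) hG
  have e2 := M.setLIntegral_labelSet_mother h.rates h.single h.cluster hm h.cluster hR2
    (fun ω s u h1 h2 => by rw [M.clusterIntensity_eq eps lam h2.1 h2.2, h1]) hG
  have e3 := M.lintegral_mul_moveTo h.coin_prob h.coin_indep n m m' (hG.indicator hpm)
  have e4 : ∫⁻ ω in M.labelSet true n, {x : Ω × (E × ℝ≥0) | M.motherAfter n x.1 = m}.indicator G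
      (ω, M.point n ω) ∂P = ∫⁻ ω in M.labelSet true n ∩ {ω | M.motherAfter n ω = m},
        G (ω, M.point n ω) ∂P := by
    rw [inter_comm, ← setLIntegral_indicator (hmo m)]; rfl
  have e5 : ∫⁻ ω in M.labelSet true n, {x : Ω × (E × ℝ≥0) | M.motherAfter n x.1 = m}.indicator G
      (ω, M.point n ω) * mv m ω ∂P = ∫⁻ ω in M.labelSet true n ∩ {ω | M.motherAfter n ω = m},
        G (ω, M.point n ω) * mv m ω ∂P := by
    rw [inter_comm, ← setLIntegral_indicator (hmo m)]
    congr 1; ext ω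
    by_cases hω : M.motherAfter n ω = m <;> simp [hω]
  rw [lintegral_add_left (hm1 m), lintegral_const_mul' _ _ (hct m),
    lintegral_indicator ((hls false n).inter (hmo m)),
    lintegral_indicator ((hls true n).inter (hmo m)), ← e5, e3, e4, e1, e2,
    ← lintegral_const_mul' _ _ (hct m), mul_comm _ (moveProb p n m m' : ℝ≥0∞),
    ← lintegral_const_mul' _ _ ENNReal.coe_ne_top, ← lintegral_add_left]
  · refine lintegral_congr fun x => ?_
    simp only [jumpRate, hc]
    push_cast
    split_ifs <;> simp <;> ring
  · exact measurable_const.mul ((hG.mono (M.prod_fullPast_le n) le_rfl).mul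
      ((hS.mul hR1).mono (M.prod_fullPast_le n) le_rfl).coe_nnreal_ennreal)

theorem measurable_mix (h : RegularRates ν gam eps lam) {n : ℕ} {w : Option ℕ → Ω → ℝ≥0}
    (hw : ∀ m, Measurable[M.obsPast n] (w m)) {R : Option ℕ → Ω × (E × ℝ≥0) → ℝ≥0}
    (hR : ∀ m ∈ states n, Measurable[(M.obsPast n).prod inferInstance] (R m)) :
    Measurable[(M.obsPast n).prod inferInstance] (M.mix ν gam eps lam n w R) :=
  Finset.measurable_fun_sum _ fun m hm => ((hw m).comp (M.measurable_fst_prod_obsPast n)).mul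
    ((M.measurable_prod_surv h hm).mul (hR m hm))

theorem measurable_pointAt_obsPast (n : ℕ) : Measurable[M.obsPast (n + 1),
    (M.obsPast n).prod inferInstance] fun ω => (ω, M.point n ω) := by
  have h1 : Measurable[M.obsPast (n + 1)] (M.point n) :=
    M.measurable_comp_point (f := id) (@measurable_id _ (M.obsPast (n + 1))) n.lt_succ_self
  exact @Measurable.prodMk _ _ _ _ (M.obsPast n) _ _ _
    (measurable_id'' (pointPast_mono M.time M.mark n)) h1

theorem measurable_weight (h : RegularRates ν gam eps lam) (n : ℕ) (m : Option ℕ) :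
    Measurable[M.obsPast n] (M.weight ν gam eps lam p n m) := by
  induction n generalizing m with
  | zero => exact @measurable_const _ _ _ (M.obsPast 0) _
  | succ n ih =>
    have h1 := (M.measurable_mix h ih fun m' hm' => M.measurable_jumpRate (p := p) h m hm').comp
      (M.measurable_pointAt_obsPast n)
    have h2 := (M.measurable_mix h ih fun m' hm' => M.measurable_markRate h hm').comp
      (M.measurable_pointAt_obsPast n)
    exact h1.div h2

end QuakeProcess

/-! ### The posterior law of the mother at quakes -/

namespace QuakeProcess

variable {Ω E : Type*} [mΩ : MeasurableSpace Ω] [mE : MeasurableSpace E] (M : QuakeProcess Ω E)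
  {ν : Measure E} {gam eps : E → ℝ≥0 → ℝ≥0} {lam : E → ℝ≥0 → E × ℝ≥0 → ℝ≥0} {p : ℝ≥0}

/-- The family `w` gives the conditional law of the active mother given the first `n` quakes. -/
def IsPosterior (P : Measure Ω) (n : ℕ) (w : Option ℕ → Ω → ℝ≥0) : Prop :=
  ∀ m ∈ states n, ∀ g : Ω → ℝ≥0∞, Measurable[M.obsPast n] g →
    ∫⁻ ω in {ω | M.lastTime n ω ≠ ∞ ∧ M.motherAfter n ω = m}, g ω ∂P
      = ∫⁻ ω in {ω | M.lastTime n ω ≠ ∞}, g ω * w m ω ∂P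

theorem measurableSet_lastTime_ne_top (n : ℕ) : MeasurableSet {ω | M.lastTime n ω ≠ ∞} :=
  (M.measurable_lastTime n (measurableSet_singleton ∞)).compl

theorem prod_obsPast_le (n : ℕ) : (M.obsPast n).prod (inferInstance : MeasurableSpace (E × ℝ≥0))
    ≤ (inferInstance : MeasurableSpace (Ω × (E × ℝ≥0))) :=
  (M.prod_obsPast_le_prod_fullPast n).trans (M.prod_fullPast_le n)

variable [SigmaFinite ν]

/-- By Fubini, the indicator of the hidden state may be replaced by its conditional probability at
each fixed mark and time, since what remains is observable. -/
theorem IsPosterior.setLIntegral_nextMeasure {M : QuakeProcess Ω E} {P : Measure Ω}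
    [IsProbabilityMeasure P] {n : ℕ} {w : Option ℕ → Ω → ℝ≥0} (hw : M.IsPosterior P n w)
    (hwm : ∀ m, Measurable[M.obsPast n] (w m)) {m : Option ℕ} (hm : m ∈ states n)
    {F : Ω × (E × ℝ≥0) → ℝ≥0∞} (hF : Measurable[(M.obsPast n).prod inferInstance] F) :
    ∫⁻ x in {x | M.motherAfter n x.1 = m}, F x ∂(M.nextMeasure P ν n)
      = ∫⁻ x, F x * w m x.1 ∂(M.nextMeasure P ν n) := by
  have hFm : Measurable F := hF.mono (M.prod_obsPast_le n) le_rfl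
  have hmo := M.measurableSet_motherAfter' n m
  have hpm : MeasurableSet {x : Ω × (E × ℝ≥0) | M.motherAfter n x.1 = m} := measurable_fst hmo
  have hLm := M.measurableSet_lastTime_lt n
  have hwm' : Measurable fun x : Ω × (E × ℝ≥0) => (w m x.1 : ℝ≥0∞) :=
    (((hwm m).mono (M.obsPast_le n) le_rfl).comp measurable_fst).coe_nnreal_ennreal
  have hFw : Measurable fun x : Ω × (E × ℝ≥0) => F x * (w m x.1 : ℝ≥0∞) := hFm.mul hwm'
  rw [nextMeasure, Measure.restrict_restrict hpm, ← lintegral_indicator (hpm.inter hLm),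
    ← lintegral_indicator hLm, lintegral_prod_symm _ (hFm.indicator (hpm.inter hLm)).aemeasurable,
    lintegral_prod_symm _ (hFw.indicator hLm).aemeasurable]
  refine lintegral_congr fun x => ?_
  set g : Ω → ℝ≥0∞ := {ω | M.lastTime n ω < x.2}.indicator fun ω => F (ω, x) with hg
  have hx : Measurable[M.obsPast n, (M.obsPast n).prod inferInstance] fun ω : Ω => (ω, x) :=
    @measurable_prodMk_right _ _ (M.obsPast n) _ x
  have hgm : Measurable[M.obsPast n] g := Measurable.indicator (hF.comp hx)
    (M.measurable_comp_lastTime (f := id) (@measurable_id _ (M.obsPast n)) measurableSet_Iio)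
  have key := hw m hm g hgm
  have hset : MeasurableSet {ω | M.lastTime n ω ≠ ∞ ∧ M.motherAfter n ω = m} :=
    (M.measurableSet_lastTime_ne_top n).inter hmo
  rw [← lintegral_indicator hset, ← lintegral_indicator (M.measurableSet_lastTime_ne_top n)] at key
  convert key using 2
  · ext ω
    by_cases hL : M.lastTime n ω < x.2
    · have hLt : M.lastTime n ω ≠ ∞ := (hL.trans ENNReal.coe_lt_top).ne
      by_cases hω : M.motherAfter n ω = m <;> simp [hg, hL, hLt, hω]
    · simp [indicator_apply, hg, hL]
  · ext ω
    by_cases hL : M.lastTime n ω < x.2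
    · have hLt : M.lastTime n ω ≠ ∞ := (hL.trans ENNReal.coe_lt_top).ne
      simp [indicator_apply, hg, hL, hLt]
    · simp [indicator_apply, hg, hL]

/-- Averaging the joint law over the hidden old mother gives a density in observable quantities: the
numerator of Bayes' formula. -/
theorem IsPosterior.setLIntegral_next_mother {M : QuakeProcess Ω E} {P : Measure Ω}
    [IsProbabilityMeasure P] (h : M.IntensityModel P ν gam eps lam p) {n : ℕ}
    {w : Option ℕ → Ω → ℝ≥0} (hw : M.IsPosterior P n w)
    (hwm : ∀ m, Measurable[M.obsPast n] (w m)) (m' : Option ℕ)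
    {G : Ω × (E × ℝ≥0) → ℝ≥0∞} (hG : Measurable[(M.obsPast n).prod inferInstance] G) :
    ∫⁻ ω in {ω | M.time n ω ≠ ∞ ∧ M.motherAfter (n + 1) ω = m'}, G (ω, M.point n ω) ∂P
      = ∫⁻ x, G x * M.mix ν gam eps lam n w (M.jumpRate gam eps lam p n m') x
          ∂(M.nextMeasure P ν n) := by
  have hmeas : ∀ m ∈ states n, Measurable[(M.obsPast n).prod inferInstance]
      fun x : Ω × (E × ℝ≥0) => G x * (M.surv ν gam eps lam n m x.1 x.2.2
        * M.jumpRate gam eps lam p n m' m x : ℝ≥0) := fun m hm =>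
    hG.mul ((M.measurable_prod_surv h.rates hm).mul
      (M.measurable_jumpRate h.rates m' hm)).coe_nnreal_ennreal
  have hwm' : ∀ m, Measurable fun x : Ω × (E × ℝ≥0) => (w m x.1 : ℝ≥0∞) := fun m =>
    (((hwm m).mono (M.obsPast_le n) le_rfl).comp measurable_fst).coe_nnreal_ennreal
  have hsummand : ∀ m ∈ states n, Measurable fun x : Ω × (E × ℝ≥0) => G x *
      (M.surv ν gam eps lam n m x.1 x.2.2 * M.jumpRate gam eps lam p n m' m x : ℝ≥0) * w m x.1 :=
    fun m hm => ((hmeas m hm).mono (M.prod_obsPast_le n) le_rfl).mul (hwm' m)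
  rw [M.setLIntegral_next_mother h n m' (hG.mono (M.prod_obsPast_le_prod_fullPast n) le_rfl),
    Finset.sum_congr rfl fun m hm => hw.setLIntegral_nextMeasure hwm hm (hmeas m hm),
    ← lintegral_finsetSum' _ fun m hm => (hsummand m hm).aemeasurable]
  refine lintegral_congr fun x => ?_
  rw [mix, ENNReal.ofNNReal_finsetSum, Finset.mul_sum]
  refine Finset.sum_congr rfl fun m _ => ?_
  push_cast
  ring

/-- The Bayes denominator: the density of the next quake, once the new mother is summed out. -/
theorem IsPosterior.setLIntegral_next {M : QuakeProcess Ω E} {P : Measure Ω}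
    [IsProbabilityMeasure P] (h : M.IntensityModel P ν gam eps lam p) {n : ℕ}
    {w : Option ℕ → Ω → ℝ≥0} (hw : M.IsPosterior P n w)
    (hwm : ∀ m, Measurable[M.obsPast n] (w m))
    {G : Ω × (E × ℝ≥0) → ℝ≥0∞} (hG : Measurable[(M.obsPast n).prod inferInstance] G) :
    ∫⁻ ω in {ω | M.time n ω ≠ ∞}, G (ω, M.point n ω) ∂P
      = ∫⁻ x, G x * M.mix ν gam eps lam n w (M.markRate gam eps lam) x
          ∂(M.nextMeasure P ν n) := by
  have hGm := M.measurable_comp_pointAt (hG.mono (M.prod_obsPast_le_prod_fullPast n) le_rfl)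
  have hset : ∀ m', MeasurableSet {ω | M.time n ω ≠ ∞ ∧ M.motherAfter (n + 1) ω = m'} := fun m' =>
    (M.measurableSet_time_ne_top n).inter (M.measurableSet_motherAfter' (n + 1) m')
  have hmix : ∀ m', Measurable fun x => G x *
      M.mix ν gam eps lam n w (M.jumpRate gam eps lam p n m') x := fun m' =>
    (hG.mul (M.measurable_mix h.rates hwm fun m hm =>
      M.measurable_jumpRate h.rates m' hm).coe_nnreal_ennreal).mono (M.prod_obsPast_le n) le_rfl
  have h1 : ∫⁻ ω in {ω | M.time n ω ≠ ∞}, G (ω, M.point n ω) ∂P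
      = ∑ m' ∈ states (n + 1), ∫⁻ ω in {ω | M.time n ω ≠ ∞ ∧ M.motherAfter (n + 1) ω = m'},
          G (ω, M.point n ω) ∂P := by
    simp_rw [← lintegral_indicator (hset _), ← lintegral_indicator (M.measurableSet_time_ne_top n)]
    rw [← lintegral_finsetSum _ fun m' _ => hGm.indicator (hset m')]
    congr 1; ext ω
    rw [Finset.sum_eq_single (M.motherAfter (n + 1) ω)]
    · simp [indicator_apply]
    · intro m _ hm
      simp [hm.symm]
    · exact fun hn => absurd (M.motherAfter_mem_states (n + 1) ω) hn
  rw [h1, Finset.sum_congr rfl fun m' _ => hw.setLIntegral_next_mother h hwm m' hG,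
    ← lintegral_finsetSum _ fun m' _ => hmix m']
  refine lintegral_congr fun x => ?_
  rw [← Finset.mul_sum, ← M.sum_mix_jumpRate h.prob_le_one, ENNReal.ofNNReal_finsetSum]

/-- Bayes' formula by induction: integrating the ratio `num / den` against the law of the next
quake, which has density `den`, recovers the joint density `num`. -/
theorem isPosterior_weight {P : Measure Ω} [IsProbabilityMeasure P]
    (h : M.IntensityModel P ν gam eps lam p) (n : ℕ) :
    M.IsPosterior P n (M.weight ν gam eps lam p n) := by
  induction n with
  | zero =>
    intro m hm g hg
    obtain rfl : m = none := by
      rcases m with _ | i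
      · rfl
      · simp [states] at hm
    simp [lastTime, motherAfter, weight]
  | succ n ih =>
    intro m' hm' g hg
    have hwm : ∀ m, Measurable[M.obsPast n] (M.weight ν gam eps lam p n m) :=
      M.measurable_weight h.rates n
    -- A function of the first `n + 1` quakes is a function of the first `n` and of the mark and
    -- time of quake `n`. `G` is its restriction to finite times.
    obtain ⟨f, hf, hgf⟩ : ∃ f : Ω × (E × ℝ≥0∞) → ℝ≥0∞,
        Measurable[(M.obsPast n).prod inferInstance] f ∧
          g = f ∘ fun ω => (ω, (M.mark n ω, M.time n ω)) := by
      refine @Measurable.exists_eq_measurable_comp Ω (Ω × (E × ℝ≥0∞)) ℝ≥0∞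
        ((M.obsPast n).prod inferInstance) _ _ _ _ _ ?_
      convert hg using 1
      rw [MeasurableSpace.prod, MeasurableSpace.comap_sup, MeasurableSpace.comap_comp,
        MeasurableSpace.comap_comp]
      change MeasurableSpace.comap id _ ⊔ _ = _
      rw [MeasurableSpace.comap_id]
      rfl
    set G : Ω × (E × ℝ≥0) → ℝ≥0∞ := fun x => f (x.1, (x.2.1, (x.2.2 : ℝ≥0∞))) with hG
    have hGm : Measurable[(M.obsPast n).prod inferInstance] G := by
      refine hf.comp (@Measurable.prodMk _ _ _ _ (M.obsPast n) _ _ _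
        (M.measurable_fst_prod_obsPast n) ?_)
      exact (measurable_fst.comp (M.measurable_snd_prod_obsPast n)).prodMk
        (measurable_coe_nnreal_ennreal.comp (measurable_snd.comp (M.measurable_snd_prod_obsPast n)))
    have hgG : ∀ ω, M.time n ω ≠ ∞ → g ω = G (ω, M.point n ω) := fun ω hω => by
      rw [hgf, hG]
      simp [point, ENNReal.coe_toNNReal hω]
    set num := M.mix ν gam eps lam n (M.weight ν gam eps lam p n) (M.jumpRate gam eps lam p n m')
      with hnum
    set den := M.mix ν gam eps lam n (M.weight ν gam eps lam p n) (M.markRate gam eps lam) with hden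
    have hnm : Measurable[(M.obsPast n).prod inferInstance] num :=
      M.measurable_mix h.rates hwm fun m hm => M.measurable_jumpRate h.rates m' hm
    have hdm : Measurable[(M.obsPast n).prod inferInstance] den :=
      M.measurable_mix h.rates hwm fun m hm => M.measurable_markRate h.rates hm
    have hle : ∀ x, num x ≤ den x := fun x => by
      rw [hden, ← M.sum_mix_jumpRate (gam := gam) (eps := eps) (lam := lam) h.prob_le_one n _ x]
      exact Finset.single_le_sum
        (f := fun m' => M.mix ν gam eps lam n (M.weight ν gam eps lam p n)
          (M.jumpRate gam eps lam p n m') x) (fun _ _ => zero_le) hm'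
    have hset : MeasurableSet {ω | M.time n ω ≠ ∞ ∧ M.motherAfter (n + 1) ω = m'} :=
      (M.measurableSet_time_ne_top n).inter (M.measurableSet_motherAfter' (n + 1) m')
    change ∫⁻ ω in {ω | M.time n ω ≠ ∞ ∧ M.motherAfter (n + 1) ω = m'}, g ω ∂P
      = ∫⁻ ω in {ω | M.time n ω ≠ ∞}, g ω * (num (ω, M.point n ω) / den (ω, M.point n ω) : ℝ≥0) ∂P
    rw [setLIntegral_congr_fun hset fun ω hω => hgG ω hω.1,
      setLIntegral_congr_fun (M.measurableSet_time_ne_top n) fun ω hω =>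
        congrArg (· * ((num (ω, M.point n ω) / den (ω, M.point n ω) : ℝ≥0) : ℝ≥0∞)) (hgG ω hω),
      ih.setLIntegral_next_mother h hwm m' hGm,
      ih.setLIntegral_next h hwm (G := fun x => G x * (num x / den x : ℝ≥0))
        (hGm.mul (hnm.div hdm).coe_nnreal_ennreal)]
    refine lintegral_congr fun x => ?_
    rw [mul_assoc, ← ENNReal.coe_mul]
    congr 2
    -- Where `den` vanishes, `num ≤ den` vanishes too, so the convention for division by zero does
    -- no harm.
    rcases eq_or_ne (den x) 0 with h0 | h0
    · have : num x = 0 := nonpos_iff_eq_zero.1 (h0 ▸ hle x)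
      rw [this, zero_div, zero_mul]
      exact this
    · exact (div_mul_cancel₀ _ h0).symm

/-- The density of the next quake integrates to zero over its own zero set, so almost surely the
quake does not fall there. -/
theorem ae_mix_markRate_ne_zero {P : Measure Ω} [IsProbabilityMeasure P]
    (h : M.IntensityModel P ν gam eps lam p) (n : ℕ) :
    ∀ᵐ ω ∂P, M.time n ω ≠ ∞ → M.mix ν gam eps lam n (M.weight ν gam eps lam p n)
      (M.markRate gam eps lam) (ω, M.point n ω) ≠ 0 := by
  have hwm : ∀ m, Measurable[M.obsPast n] (M.weight ν gam eps lam p n m) :=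
    M.measurable_weight h.rates n
  set den := M.mix ν gam eps lam n (M.weight ν gam eps lam p n) (M.markRate gam eps lam) with hden
  have hdm : Measurable[(M.obsPast n).prod inferInstance] den :=
    M.measurable_mix h.rates hwm fun m hm => M.measurable_markRate h.rates hm
  have hG : Measurable[(M.obsPast n).prod inferInstance]
      ((den ⁻¹' {0}).indicator fun _ => (1 : ℝ≥0∞)) :=
    measurable_const.indicator (hdm (measurableSet_singleton 0))
  have key := (M.isPosterior_weight h n).setLIntegral_next h hwm hG
  have h0 : ∀ x, (den ⁻¹' {0}).indicator (fun _ => (1 : ℝ≥0∞)) x * den x = 0 := fun x => by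
    by_cases hx : den x = 0 <;> simp [hx]
  simp_rw [← hden, h0, lintegral_zero] at key
  rw [lintegral_eq_zero_iff (M.measurable_comp_pointAt
    (hG.mono (M.prod_obsPast_le_prod_fullPast n) le_rfl))] at key
  filter_upwards [(ae_restrict_iff' (M.measurableSet_time_ne_top n)).1 key] with ω hω ht hz
  have := hω ht
  simp [hz] at this

theorem ae_sum_weight {P : Measure Ω} [IsProbabilityMeasure P]
    (h : M.IntensityModel P ν gam eps lam p) (n : ℕ) :
    ∀ᵐ ω ∂P, M.lastTime n ω ≠ ∞ → ∑ m ∈ states n, M.weight ν gam eps lam p n m ω = 1 := by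
  cases n with
  | zero => exact Eventually.of_forall fun ω _ => by simp [states, weight]
  | succ n =>
    filter_upwards [M.ae_mix_markRate_ne_zero h n] with ω hω ht
    simp only [weight]
    rw [← Finset.sum_div, M.sum_mix_jumpRate h.prob_le_one]
    exact div_self (hω ht)

end QuakeProcess

/-! ### The explicit filter at a fixed time -/

namespace QuakeProcess

variable {Ω E : Type*} [mΩ : MeasurableSpace Ω] [mE : MeasurableSpace E] (M : QuakeProcess Ω E)
  {ν : Measure E} {gam eps : E → ℝ≥0 → ℝ≥0} {lam : E → ℝ≥0 → E × ℝ≥0 → ℝ≥0} {p : ℝ≥0}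

/-- The event that exactly `k` quakes have occurred by time `t`. -/
def cell (t : ℝ≥0) (k : ℕ) : Set Ω := {ω | M.lastTime k ω ≤ t ∧ (t : ℝ≥0∞) < M.time k ω}

theorem mem_cell_count (t : ℝ≥0) (ω : Ω) : ω ∈ M.cell t (M.count t ω) := by
  have hex : ∃ n, (t : ℝ≥0∞) < M.time n ω :=
    ((M.tendsto_time ω).eventually (lt_mem_nhds ENNReal.coe_lt_top)).exists
  have hmem : ω ∈ M.cell t (Nat.find hex) := by
    refine ⟨?_, Nat.find_spec hex⟩
    rcases hk : Nat.find hex with _ | k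
    · exact zero_le
    · exact not_lt.1 (Nat.find_min hex (by omega : k < Nat.find hex))
  rwa [M.count_eq hmem.1 hmem.2]

theorem mem_cell_iff {t : ℝ≥0} {k : ℕ} {ω : Ω} : ω ∈ M.cell t k ↔ M.count t ω = k :=
  ⟨fun h => M.count_eq h.1 h.2, fun h => h ▸ M.mem_cell_count t ω⟩

theorem measurableSet_cell (t : ℝ≥0) (k : ℕ) : MeasurableSet (M.cell t k) :=
  (M.measurable_lastTime k measurableSet_Iic).inter (M.measurable_time k measurableSet_Ioi)

theorem lintegral_eq_tsum_cell {P : Measure Ω} (t : ℝ≥0) (f : Ω → ℝ≥0∞) :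
    ∫⁻ ω, f ω ∂P = ∑' k, ∫⁻ ω in M.cell t k, f ω ∂P := by
  rw [← lintegral_iUnion (M.measurableSet_cell t), iUnion_eq_univ_iff.2, setLIntegral_univ]
  · exact fun ω => ⟨_, M.mem_cell_count t ω⟩
  · intro j k hjk
    rw [Function.onFun, Set.disjoint_left]
    exact fun ω h1 h2 => hjk ((M.mem_cell_iff.1 h1).symm.trans (M.mem_cell_iff.1 h2))

theorem thetaAlpha_eq (i : ℕ) (t : ℝ≥0) (ω : Ω) :
    M.thetaAlpha i t ω = if M.motherAfter (M.count t ω) ω = some i then 1 else 0 := by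
  rw [thetaAlpha, theta, D]
  rcases M.motherAfter (M.count t ω) ω with _ | j
  · simp [thetaOf, activeOf]
  · by_cases hj : j = i <;> simp [thetaOf, activeOf, hj]

theorem measurableSet_obsHistory_time_le (t : ℝ≥0) (k : ℕ) :
    MeasurableSet[M.obsHistory t] {ω | M.time k ω ≤ t} := by
  have h := measurableSet_pointHistory_mark M.measurable_time M.measurable_mark
    (le_refl t) k MeasurableSet.univ
  simp only [mem_univ, and_true] at h
  exact h

theorem measurableSet_obsHistory_inter {k : ℕ} {t : ℝ≥0} {A : Set Ω}
    (hA : MeasurableSet[M.obsPast k] A) :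
    MeasurableSet[M.obsHistory t] (A ∩ {ω | M.lastTime k ω ≤ t}) := by
  obtain ⟨B, hB, hBA⟩ := measurable_subtype_pointPast_pointHistory M.measurable_time
    M.measurable_mark (L := M.lastTime k) (n := k) (fun i hi ω => M.time_le_lastTime hi ω) t hA
  have hL : MeasurableSet[M.obsHistory t] {ω | M.lastTime k ω ≤ t} := by
    cases k with
    | zero =>
      have : {ω | M.lastTime 0 ω ≤ t} = univ := by ext; simp [lastTime]
      rw [this]; exact @MeasurableSet.univ _ (_)
    | succ k =>
      exact M.measurableSet_obsHistory_time_le t k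
  have : A ∩ {ω | M.lastTime k ω ≤ t} = B ∩ {ω | M.lastTime k ω ≤ t} := by
    ext ω
    refine and_congr_left fun hω => ?_
    have := congrArg (fun s => (⟨ω, hω⟩ : {ω | M.lastTime k ω ≤ t}) ∈ s) hBA
    exact this.symm.to_iff
  rw [this]
  exact @MeasurableSet.inter _ (M.obsHistory t) _ _ hB hL

/-- On the cell with `k` quakes so far the first `k` points are known at time `t`, and so is the
absence of a further one. -/
theorem measurableSet_obsHistory_inter_cell {k : ℕ} {t : ℝ≥0} {A : Set Ω}
    (hA : MeasurableSet[M.obsPast k] A) : MeasurableSet[M.obsHistory t] (A ∩ M.cell t k) := by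
  have h1 : MeasurableSet[M.obsHistory t] {ω | M.time k ω ≤ t} :=
    M.measurableSet_obsHistory_time_le t k
  have : A ∩ M.cell t k = (A ∩ {ω | M.lastTime k ω ≤ t}) \ {ω | M.time k ω ≤ t} := by
    ext ω; simp [cell, and_assoc]
  rw [this]
  exact @MeasurableSet.diff _ (M.obsHistory t) _ _ (M.measurableSet_obsHistory_inter hA) h1

/-- The posterior probability at time `t` that `m` is the active mother, when exactly `k` quakes
have occurred by time `t`. -/
noncomputable def posterior (ν : Measure E) (gam eps : E → ℝ≥0 → ℝ≥0)
    (lam : E → ℝ≥0 → E × ℝ≥0 → ℝ≥0) (p : ℝ≥0) (k : ℕ) (m : Option ℕ) (t : ℝ≥0) (ω : Ω) : ℝ≥0 :=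
  if m ∈ states k then M.weight ν gam eps lam p k m ω * M.surv ν gam eps lam k m ω t
    / ∑ j ∈ states k, M.weight ν gam eps lam p k j ω * M.surv ν gam eps lam k j ω t else 0

/-- The explicit version of the filter. -/
noncomputable def explicitFilter (ν : Measure E) (gam eps : E → ℝ≥0 → ℝ≥0)
    (lam : E → ℝ≥0 → E × ℝ≥0 → ℝ≥0) (p : ℝ≥0) (i : ℕ) (t : ℝ≥0) (ω : Ω) : ℝ :=
  M.posterior ν gam eps lam p (M.count t ω) (some i) t ω

theorem posterior_le_one (k : ℕ) (m : Option ℕ) (t : ℝ≥0) (ω : Ω) :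
    M.posterior ν gam eps lam p k m t ω ≤ 1 := by
  rw [posterior]
  split_ifs with hm
  · refine div_le_one_of_le₀ ?_ zero_le
    exact Finset.single_le_sum (f := fun j => M.weight ν gam eps lam p k j ω *
      M.surv ν gam eps lam k j ω t) (fun _ _ => zero_le) hm
  · exact zero_le_one

variable [SigmaFinite ν]

theorem measurable_posterior (h : RegularRates ν gam eps lam) (k : ℕ) (m : Option ℕ) (t : ℝ≥0) :
    Measurable[M.obsPast k] (M.posterior ν gam eps lam p k m t) := by
  have hs : ∀ m ∈ states k, Measurable[M.obsPast k] fun ω =>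
      M.weight ν gam eps lam p k m ω * M.surv ν gam eps lam k m ω t := fun m hm =>
    (M.measurable_weight h k m).mul
      (M.measurable_comp_surv (f := id) h (@measurable_id _ (M.obsPast k))
        (@measurable_const _ _ _ (M.obsPast k) t) hm)
  by_cases hm : m ∈ states k
  · have : M.posterior ν gam eps lam p k m t = fun ω =>
        M.weight ν gam eps lam p k m ω * M.surv ν gam eps lam k m ω t
          / ∑ j ∈ states k, M.weight ν gam eps lam p k j ω * M.surv ν gam eps lam k j ω t := by
      ext ω; simp [posterior, hm]
    rw [this]
    exact (hs m hm).div (Finset.measurable_fun_sum _ hs)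
  · have : M.posterior ν gam eps lam p k m t = fun _ => 0 := by
      ext ω; simp [posterior, hm]
    rw [this]
    exact @measurable_const _ _ _ (M.obsPast k) _

theorem measurable_explicitFilter (h : RegularRates ν gam eps lam) (i : ℕ) (t : ℝ≥0) :
    Measurable[M.obsHistory t] (M.explicitFilter ν gam eps lam p i t) := by
  intro U hU
  have : M.explicitFilter ν gam eps lam p i t ⁻¹' U = ⋃ k,
      (fun ω => (M.posterior ν gam eps lam p k (some i) t ω : ℝ)) ⁻¹' U ∩ M.cell t k := by
    ext ω
    simp [M.mem_cell_iff, explicitFilter]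
  rw [this]
  refine @MeasurableSet.iUnion _ _ (M.obsHistory t) _ _ fun k =>
    M.measurableSet_obsHistory_inter_cell ?_
  exact (measurable_coe_nnreal_real.comp (M.measurable_posterior h k (some i) t)) hU

/-- The survival formula removes the condition on the next quake. The survival factor depends on
observed points only, so the posterior at the last quake then removes the hidden mother. -/
theorem setLIntegral_cell_mother {P : Measure Ω} [IsProbabilityMeasure P]
    (h : M.IntensityModel P ν gam eps lam p) {k : ℕ} {m : Option ℕ} (hm : m ∈ states k) (t : ℝ≥0)
    {g : Ω → ℝ≥0∞} (hg : Measurable[M.obsPast k] g) :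
    ∫⁻ ω in M.cell t k ∩ {ω | M.motherAfter k ω = m}, g ω ∂P
      = ∫⁻ ω in {ω | M.lastTime k ω ≤ t}, g ω *
          (M.weight ν gam eps lam p k m ω * M.surv ν gam eps lam k m ω t : ℝ≥0) ∂P := by
  have hmo := M.measurableSet_motherAfter' k m
  have hLo : MeasurableSet[M.obsPast k] {ω | M.lastTime k ω ≤ t} :=
    M.measurable_comp_lastTime (f := id) (@measurable_id _ (M.obsPast k)) measurableSet_Iic
  have hL := M.obsPast_le k _ hLo
  have hsurv : Measurable[M.obsPast k] fun ω => M.surv ν gam eps lam k m ω t :=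
    M.measurable_comp_surv (f := id) h.rates (@measurable_id _ (M.obsPast k))
        (@measurable_const _ _ _ (M.obsPast k) t) hm
  have h1 := M.setLIntegral_no_quake h.rates h.single h.cluster hm t
    (hg.mono (M.obsPast_le_fullPast k) le_rfl)
  have hc : M.cell t k ∩ {ω | M.motherAfter k ω = m} =
      {ω | M.motherAfter k ω = m ∧ M.lastTime k ω ≤ t ∧ (t : ℝ≥0∞) < M.time k ω} := by
    ext; simp only [cell, mem_inter_iff, mem_ofPred_eq]; tauto
  have hgs : Measurable[M.obsPast k] ({ω | M.lastTime k ω ≤ t}.indicator fun ω =>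
      g ω * (M.surv ν gam eps lam k m ω t : ℝ≥0∞)) :=
    (hg.mul hsurv.coe_nnreal_ennreal).indicator hLo
  have h2 := M.isPosterior_weight h k m hm _ hgs
  have hs1 : MeasurableSet {ω | M.lastTime k ω ≠ ∞ ∧ M.motherAfter k ω = m} :=
    (M.measurableSet_lastTime_ne_top k).inter hmo
  have hs2 : MeasurableSet {ω | M.motherAfter k ω = m ∧ M.lastTime k ω ≤ t} := hmo.inter hL
  rw [hc, h1, ← lintegral_indicator hs2, ← lintegral_indicator hL]
  rw [← lintegral_indicator hs1, ← lintegral_indicator (M.measurableSet_lastTime_ne_top k)] at h2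
  convert h2 using 2
  · ext ω
    by_cases hω : M.lastTime k ω ≤ t
    · have hne : M.lastTime k ω ≠ ∞ := ne_top_of_le_ne_top ENNReal.coe_ne_top hω
      simp [indicator_apply, hω, hne]
    · simp [indicator_apply, hω]
  · ext ω
    by_cases hω : M.lastTime k ω ≤ t
    · have hne : M.lastTime k ω ≠ ∞ := ne_top_of_le_ne_top ENNReal.coe_ne_top hω
      simp [indicator_apply, hω, hne]
      ring
    · simp [indicator_apply, hω]

theorem setLIntegral_cell {P : Measure Ω} [IsProbabilityMeasure P]
    (h : M.IntensityModel P ν gam eps lam p) (k : ℕ) (t : ℝ≥0)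
    {g : Ω → ℝ≥0∞} (hg : Measurable[M.obsPast k] g) :
    ∫⁻ ω in M.cell t k, g ω ∂P = ∫⁻ ω in {ω | M.lastTime k ω ≤ t}, g ω *
      (∑ m ∈ states k, M.weight ν gam eps lam p k m ω * M.surv ν gam eps lam k m ω t : ℝ≥0) ∂P := by
  have hmo := M.measurableSet_motherAfter' k
  have hgm := hg.mono (M.obsPast_le k) le_rfl
  have hsurv : ∀ m ∈ states k, Measurable[M.obsPast k] fun ω => g ω *
      (M.weight ν gam eps lam p k m ω * M.surv ν gam eps lam k m ω t : ℝ≥0) := fun m hm =>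
    hg.mul ((M.measurable_weight h.rates k m).mul
      (M.measurable_comp_surv (f := id) h.rates (@measurable_id _ (M.obsPast k))
        (@measurable_const _ _ _ (M.obsPast k) t) hm)).coe_nnreal_ennreal
  have h1 : ∫⁻ ω in M.cell t k, g ω ∂P
      = ∑ m ∈ states k, ∫⁻ ω in M.cell t k ∩ {ω | M.motherAfter k ω = m}, g ω ∂P := by
    have hset : ∀ m, MeasurableSet (M.cell t k ∩ {ω | M.motherAfter k ω = m}) := fun m =>
      (M.measurableSet_cell t k).inter (hmo m)
    rw [Finset.sum_congr rfl fun m _ => (lintegral_indicator (hset m) _).symm,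
      ← lintegral_indicator (M.measurableSet_cell t k),
      ← lintegral_finsetSum _ fun m _ => hgm.indicator (hset m)]
    congr 1; ext ω
    rw [Finset.sum_eq_single (M.motherAfter k ω)]
    · by_cases hω : ω ∈ M.cell t k <;> simp [hω]
    · intro m _ hm
      simp [hm.symm]
    · exact fun hn => absurd (M.motherAfter_mem_states k ω) hn
  rw [h1, Finset.sum_congr rfl fun m hm => M.setLIntegral_cell_mother h hm t hg,
    ← lintegral_finsetSum' _ fun m hm => ((hsurv m hm).mono (M.obsPast_le k) le_rfl).aemeasurable]
  refine lintegral_congr fun ω => ?_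
  rw [ENNReal.ofNNReal_finsetSum, Finset.mul_sum]

/-- Bayes' formula for the event that no further quake has occurred: the ratio times its denominator
is the unnormalized weight, also when both are zero. -/
theorem setLIntegral_posterior {P : Measure Ω} [IsProbabilityMeasure P]
    (h : M.IntensityModel P ν gam eps lam p) (k : ℕ) (m : Option ℕ) (t : ℝ≥0)
    {g : Ω → ℝ≥0∞} (hg : Measurable[M.obsPast k] g) :
    ∫⁻ ω in M.cell t k, g ω * M.posterior ν gam eps lam p k m t ω ∂P
      = ∫⁻ ω in M.cell t k ∩ {ω | M.motherAfter k ω = m}, g ω ∂P := by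
  by_cases hm : m ∈ states k
  · have hgp : Measurable[M.obsPast k] fun ω =>
        g ω * (M.posterior ν gam eps lam p k m t ω : ℝ≥0∞) :=
      hg.mul (M.measurable_posterior h.rates k m t).coe_nnreal_ennreal
    rw [M.setLIntegral_cell_mother h hm t hg, M.setLIntegral_cell h k t hgp]
    refine lintegral_congr fun ω => ?_
    rw [mul_assoc, ← ENNReal.coe_mul, posterior, if_pos hm]
    congr 2
    set S := ∑ j ∈ states k, M.weight ν gam eps lam p k j ω * M.surv ν gam eps lam k j ω t with hS
    rcases eq_or_ne S 0 with h0 | h0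
    · rw [h0, mul_zero]
      exact ((Finset.sum_eq_zero_iff_of_nonneg fun _ _ => zero_le).1 h0 m hm).symm
    · exact div_mul_cancel₀ _ h0
  · have h1 : M.cell t k ∩ {ω | M.motherAfter k ω = m} = ∅ := by
      ext ω
      simp only [mem_inter_iff, mem_ofPred_eq, mem_empty_iff_false, iff_false, not_and]
      rintro - rfl
      exact hm (M.motherAfter_mem_states k ω)
    simp [h1, posterior, hm]

theorem explicitFilter_ae_eq_condExp {P : Measure Ω} [IsProbabilityMeasure P]
    (h : M.IntensityModel P ν gam eps lam p) (i : ℕ) (t : ℝ≥0) :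
    M.explicitFilter ν gam eps lam p i t =ᵐ[P] P[M.thetaAlpha i t | M.obsHistory t] := by
  have hle := (M.obsHistory).le t
  have hmeasF := M.measurable_explicitFilter (p := p) h.rates i t
  have hF := hmeasF.mono hle le_rfl
  have hF0 : ∀ ω, 0 ≤ M.explicitFilter ν gam eps lam p i t ω := fun ω => NNReal.coe_nonneg _
  have hF1 : ∀ ω, M.explicitFilter ν gam eps lam p i t ω ≤ 1 := fun ω =>
    NNReal.coe_le_one.2 (M.posterior_le_one _ _ _ _)
  have hFint : Integrable (M.explicitFilter ν gam eps lam p i t) P :=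
    Integrable.of_bound hF.aestronglyMeasurable 1 (Eventually.of_forall fun ω => by
      rw [Real.norm_of_nonneg (hF0 ω)]; exact hF1 ω)
  have hZ : Measurable (M.thetaAlpha i t) := by
    have hset : MeasurableSet {ω | M.motherAfter (M.count t ω) ω = some i} := by
      have : {ω | M.motherAfter (M.count t ω) ω = some i}
          = ⋃ k, {ω | M.motherAfter k ω = some i} ∩ M.cell t k := by
        ext ω; simp [M.mem_cell_iff]
      rw [this]
      exact MeasurableSet.iUnion fun k =>
        (M.measurableSet_motherAfter' k _).inter (M.measurableSet_cell t k)
    rw [funext (M.thetaAlpha_eq i t)]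
    exact Measurable.ite hset measurable_const measurable_const
  have hZ0 : ∀ ω, 0 ≤ M.thetaAlpha i t ω := fun ω => NNReal.coe_nonneg _
  have hZint : Integrable (M.thetaAlpha i t) P :=
    Integrable.of_bound hZ.aestronglyMeasurable 1 (Eventually.of_forall fun ω => by
      rw [M.thetaAlpha_eq]; split_ifs <;> simp)
  refine ae_eq_condExp_of_forall_setIntegral_eq hle hZint (fun _ _ _ => hFint.integrableOn)
    (fun A hA _ => ?_) hmeasF.stronglyMeasurable.aestronglyMeasurable
  rw [integral_eq_lintegral_of_nonneg_ae (Eventually.of_forall hF0) hF.aestronglyMeasurable,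
    integral_eq_lintegral_of_nonneg_ae (Eventually.of_forall hZ0) hZ.aestronglyMeasurable]
  congr 1
  have hA' := hle A hA
  -- The defining identity of the conditional expectation is checked on each cell, where `A`
  -- coincides with an event `B` of the first `k` observed points.
  rw [← lintegral_indicator hA', ← lintegral_indicator hA', M.lintegral_eq_tsum_cell t,
    M.lintegral_eq_tsum_cell t]
  congr 1; ext k
  obtain ⟨B, hB, hAB⟩ := exists_pointPast_inter_eq M.measurable_time M.measurable_mark
    (L := M.lastTime k) (n := k) M.monotone_time hA
  have hmo := M.measurableSet_motherAfter' k (some i)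
  have hBm : Measurable[M.obsPast k] (B.indicator fun _ => (1 : ℝ≥0∞)) :=
    measurable_const.indicator hB
  have key := M.setLIntegral_posterior h k (some i) t hBm
  rw [inter_comm, ← setLIntegral_indicator hmo] at key
  have e1 : ∀ ω ∈ M.cell t k,
      A.indicator (fun ω => ENNReal.ofReal (M.explicitFilter ν gam eps lam p i t ω)) ω
        = B.indicator (fun _ => 1) ω * (M.posterior ν gam eps lam p k (some i) t ω : ℝ≥0∞) := by
    intro ω hω
    have hc := M.mem_cell_iff.1 hω
    by_cases hA : ω ∈ A
    · have hB := (hAB ω hω.1 hω.2).1 hA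
      simp [hA, hB, explicitFilter, hc]
    · have hB : ω ∉ B := fun hB => hA ((hAB ω hω.1 hω.2).2 hB)
      simp [hA, hB]
  have e2 : ∀ ω ∈ M.cell t k, A.indicator (fun ω => ENNReal.ofReal (M.thetaAlpha i t ω)) ω
      = {ω | M.motherAfter k ω = some i}.indicator (B.indicator fun _ => 1) ω := by
    intro ω hω
    have hc := M.mem_cell_iff.1 hω
    by_cases hA : ω ∈ A
    · have hB := (hAB ω hω.1 hω.2).1 hA
      by_cases hm : M.motherAfter k ω = some i <;> simp [hA, hB, M.thetaAlpha_eq, hc, hm]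
    · have hB : ω ∉ B := fun hB => hA ((hAB ω hω.1 hω.2).2 hB)
      simp [hA, hB, indicator_apply]
  rw [setLIntegral_congr_fun (M.measurableSet_cell t k) e1,
    setLIntegral_congr_fun (M.measurableSet_cell t k) e2]
  exact key

end QuakeProcess

/-! ### Path regularity and uniqueness of the filter -/

/-- Right-continuous functions that agree on a dense set are equal. -/
theorem eq_of_eqOn_dense_of_continuousWithinAt_Ici {f g : ℝ≥0 → ℝ} {D : Set ℝ≥0} (hD : Dense D)
    (hf : ∀ t, ContinuousWithinAt f (Ici t) t) (hg : ∀ t, ContinuousWithinAt g (Ici t) t)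
    (hfg : EqOn f g D) : f = g := by
  funext t
  have hcl : t ∈ closure (Ioi t ∩ D) :=
    closure_minimal (hD.open_subset_closure_inter isOpen_Ioi) isClosed_closure
      (closure_Ioi t ▸ self_mem_Ici)
  have := mem_closure_iff_nhdsWithin_neBot.1 hcl
  have hsub : Ioi t ∩ D ⊆ Ici t := inter_subset_left.trans Ioi_subset_Ici_self
  refine tendsto_nhds_unique ((hf t).mono hsub) (((hg t).mono hsub).congr' ?_)
  filter_upwards [self_mem_nhdsWithin] with s hs using (hfg hs.2).symm

namespace QuakeProcess

variable {Ω E : Type*} [mΩ : MeasurableSpace Ω] [mE : MeasurableSpace E] (M : QuakeProcess Ω E)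
  {ν : Measure E} {gam eps : E → ℝ≥0 → ℝ≥0} {lam : E → ℝ≥0 → E × ℝ≥0 → ℝ≥0} {p : ℝ≥0}

theorem coe_surv (n : ℕ) (m : Option ℕ) (ω : Ω) (t : ℝ≥0) :
    (M.surv ν gam eps lam n m ω t : ℝ)
      = Real.exp (-(M.hazard ν gam eps lam m ω).real (Ioc (M.lastTime n ω).toNNReal t)) :=
  Real.coe_toNNReal _ (Real.exp_pos _).le

theorem surv_pos (n : ℕ) (m : Option ℕ) (ω : Ω) (t : ℝ≥0) : 0 < M.surv ν gam eps lam n m ω t :=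
  Real.toNNReal_pos.2 (Real.exp_pos _)

theorem surv_lastTime (n : ℕ) (m : Option ℕ) (ω : Ω) :
    M.surv ν gam eps lam n m ω (M.lastTime n ω).toNNReal = 1 := by
  simp [surv]

theorem sum_weight_mul_surv_pos {k : ℕ} {ω : Ω} (t : ℝ≥0)
    (hw : ∑ m ∈ states k, M.weight ν gam eps lam p k m ω = 1) :
    0 < ∑ m ∈ states k, M.weight ν gam eps lam p k m ω * M.surv ν gam eps lam k m ω t := by
  obtain ⟨m, hm, hne⟩ := Finset.exists_ne_zero_of_sum_ne_zero (hw ▸ one_ne_zero)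
  exact Finset.sum_pos' (fun _ _ => zero_le)
    ⟨m, hm, mul_pos (pos_iff_ne_zero.2 hne) (M.surv_pos k m ω t)⟩

theorem posterior_lastTime {k : ℕ} {ω : Ω} {m : Option ℕ} (hm : m ∈ states k)
    (hw : ∑ m ∈ states k, M.weight ν gam eps lam p k m ω = 1) :
    M.posterior ν gam eps lam p k m (M.lastTime k ω).toNNReal ω = M.weight ν gam eps lam p k m ω := by
  simp [posterior, hm, surv_lastTime, hw]

theorem sum_posterior {k : ℕ} {ω : Ω} (t : ℝ≥0)
    (hw : ∑ m ∈ states k, M.weight ν gam eps lam p k m ω = 1) :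
    ∑ m ∈ states k, M.posterior ν gam eps lam p k m t ω = 1 := by
  rw [Finset.sum_congr rfl fun m (hm : m ∈ states k) => show M.posterior ν gam eps lam p k m t ω = _
    from if_pos hm, ← Finset.sum_div]
  exact div_self (M.sum_weight_mul_surv_pos t hw).ne'

/-- The probability of no quake since the last one factors out of every mixture, so it cancels in
the ratio and Bayes' formula can be written with the posterior just before the quake. -/
theorem mix_weight_eq {k : ℕ} {ω : Ω} (x : E × ℝ≥0)
    (hw : ∑ m ∈ states k, M.weight ν gam eps lam p k m ω = 1)
    (R : Option ℕ → Ω × (E × ℝ≥0) → ℝ≥0) :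
    M.mix ν gam eps lam k (M.weight ν gam eps lam p k) R (ω, x)
      = (∑ m ∈ states k, M.weight ν gam eps lam p k m ω * M.surv ν gam eps lam k m ω x.2)
        * ∑ m ∈ states k, M.posterior ν gam eps lam p k m x.2 ω * R m (ω, x) := by
  have hpos := M.sum_weight_mul_surv_pos x.2 hw
  rw [mix, Finset.mul_sum]
  refine Finset.sum_congr rfl fun m hm => ?_
  rw [posterior, if_pos hm, ← mul_assoc, ← mul_assoc, mul_div_cancel₀ _ hpos.ne']

/-- The Bayes formula at a quake. -/
theorem weight_succ_eq {k : ℕ} {ω : Ω} (m' : Option ℕ)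
    (hw : ∑ m ∈ states k, M.weight ν gam eps lam p k m ω = 1) :
    M.weight ν gam eps lam p (k + 1) m' ω
      = (∑ m ∈ states k, M.posterior ν gam eps lam p k m (M.point k ω).2 ω
          * M.jumpRate gam eps lam p k m' m (ω, M.point k ω))
        / ∑ m ∈ states k, M.posterior ν gam eps lam p k m (M.point k ω).2 ω
          * M.markRate gam eps lam m (ω, M.point k ω) := by
  rw [weight, M.mix_weight_eq _ hw, M.mix_weight_eq _ hw,
    mul_div_mul_left _ _ (M.sum_weight_mul_surv_pos _ hw).ne']

/-- An old mother can be active after the quake only if she was active before: through a single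
quake, or through an offspring whose coin spares the cluster. -/
theorem sum_mul_jumpRate_of_lt {k i : ℕ} (hi : i < k) (v : Option ℕ → ℝ≥0) (x : Ω × (E × ℝ≥0)) :
    ∑ m ∈ states k, v m * M.jumpRate gam eps lam p k (some i) m x
      = v (some i) * (gam x.2.1 x.2.2 + (1 - p) * lam x.2.1 x.2.2 (M.point i x.1)) := by
  rw [Finset.sum_eq_single (some i)]
  · simp [jumpRate, moveProb, moveTo, clusterRate]
  · intro m _ hm
    rcases m with _ | j
    · simp [jumpRate, moveProb, moveTo, hi.ne']
    · simp [jumpRate, moveProb, moveTo, show j ≠ i from fun h => hm (h ▸ rfl)]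
  · intro h
    simp [states, hi] at h

/-- Quake `k` becomes the mother only as a cluster quake in the inactive state; its coin plays no
role there, so both outcomes add to probability 1. -/
theorem sum_mul_jumpRate_self (hp : p ≤ 1) (k : ℕ) (v : Option ℕ → ℝ≥0) (x : Ω × (E × ℝ≥0)) :
    ∑ m ∈ states k, v m * M.jumpRate gam eps lam p k (some k) m x
      = v none * eps x.2.1 x.2.2 := by
  rw [Finset.sum_eq_single none]
  · simp [jumpRate, moveProb, moveTo, clusterRate, add_tsub_cancel_of_le hp]
  · intro m hm hne
    rcases m with _ | j
    · exact absurd rfl hne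
    · have hj : j < k := by simpa [states] using hm
      simp [jumpRate, moveProb, moveTo, hj.ne]
  · intro h
    simp [states] at h

theorem explicitFilter_eq_posterior {k i : ℕ} {t : ℝ≥0} {ω : Ω} (hL : M.lastTime k ω ≤ t)
    (ht : (t : ℝ≥0∞) < M.time k ω) : M.explicitFilter ν gam eps lam p i t ω
      = M.posterior ν gam eps lam p k (some i) t ω := by
  rw [explicitFilter, M.count_eq hL ht]

variable [SigmaFinite ν]

theorem continuousOn_surv (h : RegularRates ν gam eps lam) {n : ℕ} {m : Option ℕ} {ω : Ω} {t : ℝ≥0}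
    (hm : m ∈ states n) (hL : M.lastTime n ω ≤ t) :
    ContinuousOn (fun s => M.surv ν gam eps lam n m ω s) (Icc (M.lastTime n ω).toNNReal t) :=
  continuous_real_toNNReal.comp_continuousOn (Real.continuous_exp.comp_continuousOn
    (continuousOn_measureReal_Ioc (M.hazard_ne_top h hm hL)).neg)

theorem continuousOn_posterior (h : RegularRates ν gam eps lam) {k : ℕ} (m : Option ℕ) {ω : Ω}
    {t : ℝ≥0} (hL : M.lastTime k ω ≤ t)
    (hw : ∑ m ∈ states k, M.weight ν gam eps lam p k m ω = 1) :
    ContinuousOn (fun s => (M.posterior ν gam eps lam p k m s ω : ℝ))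
      (Icc (M.lastTime k ω).toNNReal t) := by
  refine NNReal.continuous_coe.comp_continuousOn ?_
  by_cases hm : m ∈ states k
  · simp only [posterior, hm, if_true]
    refine ContinuousOn.div (continuousOn_const.mul (M.continuousOn_surv h hm hL))
      (continuousOn_finsetSum _ fun j hj => continuousOn_const.mul (M.continuousOn_surv h hj hL))
      fun s _ => (M.sum_weight_mul_surv_pos s hw).ne'
  · simp only [posterior, hm, if_false]
    exact continuousOn_const

theorem continuousWithinAt_explicitFilter (h : RegularRates ν gam eps lam) {ω : Ω}
    (hw : ∀ k, M.lastTime k ω ≠ ∞ → ∑ m ∈ states k, M.weight ν gam eps lam p k m ω = 1)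
    (i : ℕ) (t : ℝ≥0) :
    ContinuousWithinAt (fun s => M.explicitFilter ν gam eps lam p i s ω) (Ici t) t := by
  obtain ⟨hL, ht⟩ := M.mem_cell_count t ω
  set k := M.count t ω
  -- The next quake may be at `∞`; a finite `T` before it gives a right neighbourhood of `t` without
  -- quakes.
  obtain ⟨T, htT, hT⟩ := ENNReal.lt_iff_exists_nnreal_btwn.1 ht
  have htT' : t < T := by exact_mod_cast htT
  have hLne : M.lastTime k ω ≠ ∞ := ne_top_of_le_ne_top ENNReal.coe_ne_top hL
  have hLt : (M.lastTime k ω).toNNReal ≤ t := ENNReal.toNNReal_mono ENNReal.coe_ne_top hL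
  have hc := (M.continuousOn_posterior h (some i) (hL.trans htT.le) (hw k hLne)) t ⟨hLt, htT'.le⟩
  have hc' : ContinuousWithinAt (fun s => (M.posterior ν gam eps lam p k (some i) s ω : ℝ))
      (Ici t) t := (hc.mono (Icc_subset_Icc_left hLt)).mono_of_mem_nhdsWithin
        (Icc_mem_nhdsGE htT')
  refine hc'.congr_of_eventuallyEq ?_ (M.explicitFilter_eq_posterior hL ht)
  filter_upwards [Icc_mem_nhdsGE htT'] with s hs
  exact M.explicitFilter_eq_posterior (hL.trans (by exact_mod_cast hs.1))
    (lt_of_le_of_lt (by exact_mod_cast hs.2) hT)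

/-- The formula for the posterior between quakes is continuous up to and including the next quake
time, so its value there is the left limit of the filter. -/
theorem tendsto_explicitFilter (h : RegularRates ν gam eps lam) {ω : Ω} {k : ℕ} {t : ℝ≥0}
    (hw : ∑ m ∈ states k, M.weight ν gam eps lam p k m ω = 1) (hL : M.lastTime k ω < t)
    (ht : (t : ℝ≥0∞) ≤ M.time k ω) (i : ℕ) :
    Tendsto (fun s => M.explicitFilter ν gam eps lam p i s ω) (𝓝[<] t)
      (𝓝 (M.posterior ν gam eps lam p k (some i) t ω)) := by
  have hLne : M.lastTime k ω ≠ ∞ := (hL.trans ENNReal.coe_lt_top).ne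
  have hLt : (M.lastTime k ω).toNNReal < t := by
    rwa [← ENNReal.coe_lt_coe, ENNReal.coe_toNNReal hLne]
  have hc := (M.continuousOn_posterior h (some i) hL.le hw) t ⟨hLt.le, le_rfl⟩
  have hmem := Ioo_mem_nhdsLT hLt
  refine (hc.tendsto.mono_left (nhdsWithin_le_of_mem
    (mem_of_superset hmem Ioo_subset_Icc_self))).congr' ?_
  filter_upwards [hmem] with s hs
  refine (M.explicitFilter_eq_posterior ?_ (lt_of_lt_of_le (by exact_mod_cast hs.2) ht)).symm
  rw [← ENNReal.coe_toNNReal hLne]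
  exact_mod_cast hs.1.le

theorem exists_tendsto_explicitFilter (h : RegularRates ν gam eps lam) {ω : Ω}
    (hw : ∀ k, M.lastTime k ω ≠ ∞ → ∑ m ∈ states k, M.weight ν gam eps lam p k m ω = 1)
    (i : ℕ) (t : ℝ≥0) :
    ∃ l, Tendsto (fun s => M.explicitFilter ν gam eps lam p i s ω) (𝓝[<] t) (𝓝 l) := by
  rcases eq_or_ne t 0 with rfl | ht
  · exact ⟨0, by simp⟩
  have hex : ∃ n, (t : ℝ≥0∞) ≤ M.time n ω :=
    ((M.tendsto_time ω).eventually (le_mem_nhds ENNReal.coe_lt_top)).exists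
  have hL : M.lastTime (Nat.find hex) ω < t := by
    rcases hk : Nat.find hex with _ | k
    · simpa [lastTime] using pos_iff_ne_zero.2 ht
    · exact not_le.1 (Nat.find_min hex (by omega : k < Nat.find hex))
  exact ⟨_, M.tendsto_explicitFilter h (hw _ (hL.trans ENNReal.coe_lt_top).ne) hL
    (Nat.find_spec hex) i⟩

theorem isFilterOf_explicitFilter {P : Measure Ω} [IsProbabilityMeasure P]
    (h : M.IntensityModel P ν gam eps lam p) (i : ℕ) :
    IsFilterOf M P (M.thetaAlpha i) (M.explicitFilter ν gam eps lam p i) where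
  condExp := M.explicitFilter_ae_eq_condExp h i
  cadlag := by
    filter_upwards [ae_all_iff.2 (M.ae_sum_weight h)] with ω hω t
    exact ⟨M.continuousWithinAt_explicitFilter h.rates hω i t,
      M.exists_tendsto_explicitFilter h.rates hω i t⟩

/-- Versions agree almost surely at each time, hence simultaneously on a countable dense set, hence
everywhere by right continuity. -/
theorem _root_.IsFilterOf.ae_forall_eq {M : QuakeProcess Ω E} {P : Measure Ω}
    {Z π π' : ℝ≥0 → Ω → ℝ} (h : IsFilterOf M P Z π) (h' : IsFilterOf M P Z π') :
    ∀ᵐ ω ∂P, ∀ t, π t ω = π' t ω := by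
  obtain ⟨D, hDc, hD⟩ := TopologicalSpace.exists_countable_dense ℝ≥0
  have hae : ∀ᵐ ω ∂P, ∀ t ∈ D, π t ω = π' t ω :=
    (ae_ball_iff hDc).2 fun t _ => (h.condExp t).trans (h'.condExp t).symm
  filter_upwards [hae, h.cadlag, h'.cadlag] with ω hω h1 h2
  exact congrFun (eq_of_eqOn_dense_of_continuousWithinAt_Ici hD (fun t => (h1 t).1)
    (fun t => (h2 t).1) hω)

theorem measureReal_hazard (h : RegularRates ν gam eps lam) {n : ℕ} {m : Option ℕ} {ω : Ω}
    {t : ℝ≥0} (hm : m ∈ states n) (hL : M.lastTime n ω ≤ t) :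
    IntegrableOn (fun s => ∫ u, (M.clusterRate eps lam m ω u s : ℝ) ∂ν)
      (Ioc (M.lastTime n ω).toNNReal t) lebesgueNN ∧
    (M.hazard ν gam eps lam m ω).real (Ioc (M.lastTime n ω).toNNReal t)
      = (∫⁻ s in Ioc (M.lastTime n ω).toNNReal t, ∫⁻ u, (gam u s : ℝ≥0∞) ∂ν ∂lebesgueNN).toReal
        + ∫ s in Ioc (M.lastTime n ω).toNNReal t, ∫ u, (M.clusterRate eps lam m ω u s : ℝ) ∂ν
          ∂lebesgueNN := by
  have hrate : Measurable fun x : E × ℝ≥0 => M.clusterRate eps lam m ω x.1 x.2 :=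
    M.measurable_comp_clusterRate (f := fun _ => ω) h
      (@measurable_const _ _ (M.obsPast n) _ ω) measurable_fst measurable_snd hm
  -- This holds for every `s`: where the rate has infinite mass, both sides take the default value
  -- 0. Such `s` form a null set in the interval.
  have hinner : ∀ s, ∫ u, (M.clusterRate eps lam m ω u s : ℝ) ∂ν
      = (∫⁻ u, (M.clusterRate eps lam m ω u s : ℝ≥0∞) ∂ν).toReal := fun s => by
    have hs : Measurable fun u => (M.clusterRate eps lam m ω u s : ℝ) :=
      (hrate.comp (measurable_id.prodMk measurable_const)).coe_nnreal_real
    rw [integral_eq_lintegral_of_nonneg_ae (Eventually.of_forall fun u => NNReal.coe_nonneg _)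
      hs.aestronglyMeasurable]
    simp
  have hR : Measurable fun s => ∫⁻ u, (M.clusterRate eps lam m ω u s : ℝ≥0∞) ∂ν :=
    Measurable.lintegral_prod_right' (f := fun x : ℝ≥0 × E =>
      (M.clusterRate eps lam m ω x.2 x.1 : ℝ≥0∞)) (hrate.comp measurable_swap).coe_nnreal_ennreal
  have hG : Measurable fun s => ∫⁻ u, (gam u s : ℝ≥0∞) ∂ν :=
    Measurable.lintegral_prod_right' (f := fun x : ℝ≥0 × E =>
      (gam x.2 x.1 : ℝ≥0∞)) (h.gam_meas.comp measurable_swap).coe_nnreal_ennreal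
  have hRfin := M.lintegral_clusterRate_lt_top h hm hL
  have hGfin : ∫⁻ s in Ioc (M.lastTime n ω).toNNReal t, ∫⁻ u, (gam u s : ℝ≥0∞) ∂ν ∂lebesgueNN < ∞ :=
    (lintegral_mono_set Ioc_subset_Iic_self).trans_lt (h.gam_int t)
  simp_rw [hinner]
  refine ⟨integrable_toReal_of_lintegral_ne_top hR.aemeasurable hRfin.ne, ?_⟩
  rw [integral_toReal hR.aemeasurable (ae_lt_top hR hRfin.ne), Measure.real, hazard,
    withDensity_apply _ measurableSet_Ioc]
  simp_rw [M.lintegral_gam_add_clusterRate h]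
  rw [lintegral_add_left hG, ENNReal.toReal_add hGfin.ne hRfin.ne]

/-- The exponents of both states contain the same integral of `gam`, so their ratio retains only the
difference of the cluster rates. -/
theorem surv_some (h : RegularRates ν gam eps lam) {k j : ℕ} {ω : Ω} {t : ℝ≥0} (hj : j < k)
    (hL : M.lastTime k ω ≤ t) :
    (M.surv ν gam eps lam k (some j) ω t : ℝ)
      = M.decay ν eps lam k j t ω * M.surv ν gam eps lam k none ω t := by
  obtain ⟨hi, hs⟩ := M.measureReal_hazard h (m := some j) (n := k) (by simp [states, hj]) hL
  obtain ⟨hi0, hs0⟩ := M.measureReal_hazard h (m := none) (n := k) (by simp [states]) hL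
  rw [coe_surv, coe_surv, decay, hs, hs0, ← Real.exp_add]
  simp only [clusterRate] at hi hi0 ⊢
  rw [integral_sub hi hi0]
  congr 1
  ring

end QuakeProcess

/-! ### The filter equations -/

namespace QuakeProcess

variable {Ω E : Type*} [mΩ : MeasurableSpace Ω] [mE : MeasurableSpace E] (M : QuakeProcess Ω E)
  {ν : Measure E} {gam eps : E → ℝ≥0 → ℝ≥0} {lam : E → ℝ≥0 → E × ℝ≥0 → ℝ≥0} {p : ℝ≥0}

theorem explicitFilter_lastTime {k i : ℕ} {ω : Ω} (hi : i < k) (hL : M.lastTime k ω ≠ ∞)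
    (hw : ∑ m ∈ states k, M.weight ν gam eps lam p k m ω = 1) :
    M.explicitFilter ν gam eps lam p i (M.lastTime k ω).toNNReal ω
      = M.weight ν gam eps lam p k (some i) ω := by
  have hc := ENNReal.coe_toNNReal hL
  rw [M.explicitFilter_eq_posterior (k := k) hc.ge (hc.symm ▸ M.lastTime_lt_time hL),
    M.posterior_lastTime (by simp [states, hi]) hw]

/-- The filter between quakes. -/
theorem explicitFilter_between [SigmaFinite ν] (h : RegularRates ν gam eps lam) {ω : Ω} {k : ℕ}
    {t : ℝ≥0} (hw : ∑ m ∈ states k, M.weight ν gam eps lam p k m ω = 1)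
    (hL : M.lastTime k ω ≤ t) (ht : (t : ℝ≥0∞) < M.time k ω) :
    0 < M.bDenom ν eps lam (M.explicitFilter ν gam eps lam p) k t ω ∧
      ∀ i < k, M.explicitFilter ν gam eps lam p i t ω
        = M.explicitFilter ν gam eps lam p i (M.lastTime k ω).toNNReal ω
          * M.decay ν eps lam k i t ω
          * (1 / M.bDenom ν eps lam (M.explicitFilter ν gam eps lam p) k t ω) := by
  have hLne : M.lastTime k ω ≠ ∞ := ne_top_of_le_ne_top ENNReal.coe_ne_top hL
  have hpos : (0 : ℝ) < (∑ m ∈ states k, M.weight ν gam eps lam p k m ω *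
      M.surv ν gam eps lam k m ω t : ℝ≥0) := NNReal.coe_pos.2 (M.sum_weight_mul_surv_pos t hw)
  have h0 : (0 : ℝ) < M.surv ν gam eps lam k none ω t := NNReal.coe_pos.2 (M.surv_pos k none ω t)
  -- The survival probability of the inactive state is pulled out of the normalizer. Its weight is 1
  -- minus the sum of the others, which is the origin of the constant term in `bDenom`.
  have hden : (∑ m ∈ states k, M.weight ν gam eps lam p k m ω * M.surv ν gam eps lam k m ω t : ℝ≥0)
      = M.bDenom ν eps lam (M.explicitFilter ν gam eps lam p) k t ω
        * M.surv ν gam eps lam k none ω t := by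
    have hw' : (∑ m ∈ states k, M.weight ν gam eps lam p k m ω : ℝ≥0) = (1 : ℝ) := by
      rw [hw, NNReal.coe_one]
    rw [sum_states] at hw' ⊢
    push_cast at hw' ⊢
    rw [bDenom, Finset.sum_congr rfl fun j hj => congrArg (· * M.decay ν eps lam k j t ω)
      (M.explicitFilter_lastTime (Finset.mem_range.1 hj) hLne hw),
      Finset.sum_congr rfl fun j hj => M.explicitFilter_lastTime (Finset.mem_range.1 hj) hLne hw,
      Finset.sum_congr rfl fun j hj => congrArg ((M.weight ν gam eps lam p k (some j) ω : ℝ) * ·)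
        (M.surv_some h (Finset.mem_range.1 hj) hL), add_sub_assoc, ← eq_sub_of_add_eq hw',
      add_mul, Finset.sum_mul, add_comm]
    simp only [mul_assoc]
  have hb : 0 < M.bDenom ν eps lam (M.explicitFilter ν gam eps lam p) k t ω :=
    pos_of_mul_pos_left (hden ▸ hpos) h0.le
  refine ⟨hb, fun i hi => ?_⟩
  rw [M.explicitFilter_lastTime hi hLne hw, M.explicitFilter_eq_posterior hL ht, posterior,
    if_pos (by simp [states, hi]), NNReal.coe_div, hden, NNReal.coe_mul, M.surv_some h hi hL]
  field_simp

/-- The filter at a quake. -/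
theorem explicitFilter_jump [SigmaFinite ν] (h : RegularRates ν gam eps lam) (hp : p ≤ 1) {ω : Ω}
    {k : ℕ} (hw : ∀ k, M.lastTime k ω ≠ ∞ → ∑ m ∈ states k, M.weight ν gam eps lam p k m ω = 1)
    (ht : M.time k ω ≠ ∞) (hmix : M.mix ν gam eps lam k (M.weight ν gam eps lam p k)
      (M.markRate gam eps lam) (ω, M.point k ω) ≠ 0) :
    0 < M.jumpDenom gam eps lam (M.explicitFilter ν gam eps lam p) k ω ∧
      (∀ i < k, M.explicitFilter ν gam eps lam p i (M.time k ω).toNNReal ω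
        = M.preJump (M.explicitFilter ν gam eps lam p) k i ω
            * (M.gamAt gam k ω + (1 - p) * M.lamAt lam k i ω)
          / M.jumpDenom gam eps lam (M.explicitFilter ν gam eps lam p) k ω) ∧
      M.explicitFilter ν gam eps lam p k (M.time k ω).toNNReal ω
        = (M.epsAt eps k ω - ∑ j ∈ Finset.range k, M.epsAt eps k ω
            * M.preJump (M.explicitFilter ν gam eps lam p) k j ω)
          / M.jumpDenom gam eps lam (M.explicitFilter ν gam eps lam p) k ω := by
  have hLne : M.lastTime k ω ≠ ∞ := ne_top_of_le_ne_top ht (M.lastTime_le_time k ω)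
  have hwk := hw k hLne
  have hc := ENNReal.coe_toNNReal ht
  set v : Option ℕ → ℝ≥0 := fun m => M.posterior ν gam eps lam p k m (M.point k ω).2 ω with hv
  have hpre : ∀ j, M.preJump (M.explicitFilter ν gam eps lam p) k j ω = v (some j) := fun j => by
    -- A positive quake time makes the left neighbourhood filter nontrivial, so that `leftLim` is a
    -- genuine limit.
    have hpos : 0 < (M.time k ω).toNNReal := by
      refine ENNReal.toNNReal_pos (ne_of_gt ?_) ht
      exact (M.time_pos ω).trans_le (M.monotone_time (Nat.zero_le k) ω)
    have : (𝓝[<] (M.time k ω).toNNReal).NeBot := nhdsLT_neBot_of_exists_lt ⟨0, hpos⟩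
    exact leftLim_eq_of_tendsto
      (M.tendsto_explicitFilter h hwk (hc.symm ▸ M.lastTime_lt_time hLne) hc.le j)
  have hvsum : (v none : ℝ) + ∑ j ∈ Finset.range k, (v (some j) : ℝ) = 1 := by
    have := M.sum_posterior (M.point k ω).2 hwk
    rw [sum_states] at this
    exact_mod_cast this
  have hden : M.jumpDenom gam eps lam (M.explicitFilter ν gam eps lam p) k ω
      = (∑ m ∈ states k, v m * M.markRate gam eps lam m (ω, M.point k ω) : ℝ≥0) := by
    have hg : ∀ j, (v (some j) * M.markRate gam eps lam (some j) (ω, M.point k ω) : ℝ)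
        = v (some j) * M.gamAt gam k ω + (M.lamAt lam k j ω - M.epsAt eps k ω) * v (some j)
          + v (some j) * M.epsAt eps k ω := fun j => by
      simp only [markRate, clusterRate, gamAt, lamAt, epsAt, point]
      push_cast
      ring
    have hg0 : (v none * M.markRate gam eps lam none (ω, M.point k ω) : ℝ)
        = v none * (M.gamAt gam k ω + M.epsAt eps k ω) := by
      simp only [markRate, clusterRate, gamAt, epsAt, point]
      push_cast
      ring
    rw [sum_states]
    push_cast
    simp only [hg, hg0, Finset.sum_add_distrib, ← Finset.sum_mul, jumpDenom, hpre]
    -- Eliminating the inactive state through total mass 1 turns the averaged total rate into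
    -- `jumpDenom`.
    rw [← sub_eq_iff_eq_add.2 hvsum.symm]
    ring
  have hdpos : 0 < M.jumpDenom gam eps lam (M.explicitFilter ν gam eps lam p) k ω := by
    rw [hden, NNReal.coe_pos, pos_iff_ne_zero]
    rw [M.mix_weight_eq _ hwk] at hmix
    exact right_ne_zero_of_mul hmix
  have hjump : ∀ i < k + 1, M.explicitFilter ν gam eps lam p i (M.time k ω).toNNReal ω
      = (∑ m ∈ states k, v m * M.jumpRate gam eps lam p k (some i) m (ω, M.point k ω) : ℝ≥0)
        / M.jumpDenom gam eps lam (M.explicitFilter ν gam eps lam p) k ω := fun i hi => by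
    rw [hden, ← NNReal.coe_div, ← M.weight_succ_eq (some i) hwk]
    -- At the time of quake `k`, no time has elapsed since the last of the first `k + 1` quakes, so
    -- the filter equals the new weight.
    exact M.explicitFilter_lastTime (k := k + 1) hi ht (hw (k + 1) ht)
  refine ⟨hdpos, fun i hi => ?_, ?_⟩
  · rw [hjump i (hi.trans k.lt_succ_self), M.sum_mul_jumpRate_of_lt hi, hpre]
    push_cast [NNReal.coe_sub hp]
    rfl
  · rw [hjump k k.lt_succ_self, M.sum_mul_jumpRate_self hp, ← Finset.mul_sum]
    simp only [hpre]
    rw [eq_sub_of_add_eq' hvsum]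
    push_cast
    simp only [epsAt, point]
    ring

/-- The facts of the mother-quake model that determine the filter. -/
theorem _root_.IsMotherQuakeModel.intensityModel {M : QuakeProcess Ω E} {P : Measure Ω}
    [IsProbabilityMeasure P] [SigmaFinite ν] {p : ℝ} (h : RegularRates ν gam eps lam) (hp1 : p ≤ 1)
    (hM : IsMotherQuakeModel M P ν gam eps lam p) :
    M.IntensityModel P ν gam eps lam p.toNNReal where
  rates := h
  single := M.hasIntensity_single h.gam_meas h.gam_int hM.poisson hM.compatible
  cluster := hM.intensity
  coin_prob := hM.kill_prob
  coin_indep := hM.kill_indep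
  prob_le_one := Real.toNNReal_le_one.2 hp1

end QuakeProcess

theorem theorem3p1 {Ω E : Type*} [MeasurableSpace Ω] [MeasurableSpace E]
    (P : Measure Ω) [IsProbabilityMeasure P] (ν : Measure E) [SigmaFinite ν]
    (gam eps : E → ℝ≥0 → ℝ≥0) (lam : E → ℝ≥0 → E × ℝ≥0 → ℝ≥0)
    (p q : ℝ) (hp0 : 0 ≤ p) (hp1 : p ≤ 1) (hq : q = 1 - p)
    (hgam : Measurable fun x : E × ℝ≥0 => gam x.1 x.2)
    (heps : Measurable fun x : E × ℝ≥0 => eps x.1 x.2)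
    (hlam : Measurable fun x : E × ℝ≥0 × (E × ℝ≥0) => lam x.1 x.2.1 x.2.2)
    (hgam_int : ∀ T : ℝ≥0, ∫⁻ s in Iic T, ∫⁻ u, (gam u s : ℝ≥0∞) ∂ν ∂lebesgueNN < ∞)
    (heps_int : ∀ T : ℝ≥0, ∫⁻ s in Iic T, ∫⁻ u, (eps u s : ℝ≥0∞) ∂ν ∂lebesgueNN < ∞)
    (hlam_int : ∀ (y : E × ℝ≥0) (T : ℝ≥0),
      ∫⁻ s in Ioc y.2 T, ∫⁻ u, (lam u s y : ℝ≥0∞) ∂ν ∂lebesgueNN < ∞)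
    (M : QuakeProcess Ω E) (hM : IsMotherQuakeModel M P ν gam eps lam p) :
    (∃ π : ℕ → ℝ≥0 → Ω → ℝ, ∀ i, IsFilterOf M P (M.thetaAlpha i) (π i)) ∧
    ∀ π : ℕ → ℝ≥0 → Ω → ℝ, (∀ i, IsFilterOf M P (M.thetaAlpha i) (π i)) →
      ∀ᵐ ω ∂P,
        (∀ (k : ℕ) (t : ℝ≥0), M.lastTime k ω ≤ t → (t : ℝ≥0∞) < M.time k ω →
          0 < M.bDenom ν eps lam π k t ω ∧
          ∀ i < k, π i t ω = π i (M.lastTime k ω).toNNReal ω * M.decay ν eps lam k i t ω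
            * (1 / M.bDenom ν eps lam π k t ω)) ∧
        (∀ k : ℕ, M.time k ω < ∞ →
          0 < M.jumpDenom gam eps lam π k ω ∧
          (∀ i < k, π i (M.time k ω).toNNReal ω =
            M.preJump π k i ω * (M.gamAt gam k ω + q * M.lamAt lam k i ω)
              / M.jumpDenom gam eps lam π k ω) ∧
          π k (M.time k ω).toNNReal ω =
            (M.epsAt eps k ω - ∑ j ∈ Finset.range k, M.epsAt eps k ω * M.preJump π k j ω)
              / M.jumpDenom gam eps lam π k ω) := by
  have hR : RegularRates ν gam eps lam := ⟨hgam, heps, hlam, hgam_int, heps_int, hlam_int⟩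
  have hI := hM.intensityModel hR hp1
  have hF := M.isFilterOf_explicitFilter hI
  refine ⟨⟨_, hF⟩, fun π hπ => ?_⟩
  filter_upwards [ae_all_iff.2 (M.ae_sum_weight hI), ae_all_iff.2 (M.ae_mix_markRate_ne_zero hI),
    ae_all_iff.2 fun i => (hπ i).ae_forall_eq (hF i)] with ω hw hmix heq
  set F := M.explicitFilter ν gam eps lam p.toNNReal
  have hb : ∀ k t, M.bDenom ν eps lam π k t ω = M.bDenom ν eps lam F k t ω := fun k t => by
    simp only [QuakeProcess.bDenom, heq]
  -- Left limits and random times see the whole path, which is why equality at all times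
  -- simultaneously is needed.
  have hpre : ∀ k j, M.preJump π k j ω = M.preJump F k j ω := fun k j => by
    simp only [QuakeProcess.preJump, heq]
  have hd : ∀ k, M.jumpDenom gam eps lam π k ω = M.jumpDenom gam eps lam F k ω := fun k => by
    simp only [QuakeProcess.jumpDenom, hpre]
  refine ⟨fun k t hL ht => ?_, fun k ht => ?_⟩
  · simp only [hb, heq]
    exact M.explicitFilter_between hR (hw k (ne_top_of_le_ne_top ENNReal.coe_ne_top hL)) hL ht
  · simp only [hd, hpre, heq, hq]
    have := M.explicitFilter_jump hR hI.prob_le_one hw ht.ne (hmix k ht.ne)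
    rwa [Real.coe_toNNReal p hp0] at this
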